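/- Let $n\ge 3$ and let $\Omega\subset\mathbb{R}^n$ be a bounded domain with Lipschitz boundary, with outward unit normal $\eta$ and surface measure $ds$. Let $\mathcal{C}\ell_{0,n}$ be the real Clifford algebra generated by $e_1,\dots,e_n$ with $e_ie_j+e_je_i=-2\delta_{ij}$, with conjugation $a\mapsto\overline a$ (the anti-automorphism with $\overline{e_i}=-e_i$) and scalar part $\mathrm{Sc}$, and let $D=\sum_{i=1}^n e_i\partial_i$. Let $f\in W^{1,\infty}(\Omega)$ be real-valued and away from zero, i.e. $|f|\ge c$ a.e. in $\Omega$ for some constant $c>0$. Let $1<p<\infty$ and let $w\in L^p(\Omega,\mathcal{C}\ell_{0,n})$ be a solution, in the sense of distributions, of the main Vekua equation $$Dw=\frac{\nabla f}{f}\,\overline w\qquad\text{in }\Omega .$$ Put $u_0=w_0/f$ with $w_0=\mathrm{Sc}\,w$, and assume that $u_0$ has well-defined boundary values and normal derivative, in the following sense: $u_0\in W^{1,1}(\Omega)$ has the trace $u_0|_{\partial\Omega}\in L^1(\partial\Omega)$, the limit in $L^1(\partial\Omega)$ of $v_k|_{\partial\Omega}$ for some $v_k\in C^1(\mathbb{R}^n)$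 with $v_k\to u_0$ in $W^{1,1}(\Omega)$; and $\nabla u_0$ has a normal trace $\nabla u_0|_{\partial\Omega}\cdot\eta\in L^1(\partial\Omega)$, the limit in $L^1(\partial\Omega)$ of $V_k\cdot\eta$ for some $V_k\in C^1(\mathbb{R}^n;\mathbb{R}^n)$ such that $V_k\to\nabla u_0$ in $L^1(\Omega)$ and $\operatorname{div}V_k$ converges in $L^1(\Omega)$. Let $\sigma_n$ be the surface area of the unit sphere in $\mathbb{R}^n$ and $E(x)=-\dfrac{x}{\sigma_n|x|^n}$ the Cauchy kernel. Then, for every $x\in\Omega$ and every $x\in\mathbb{R}^n\setminus\overline\Omega$, the integrals below converge absolutely and $$\int_{\partial\Omega}\Big(-E(y-x)\cdot\eta(y)\,u_0|_{\partial\Omega}(y)+\frac{1}{\sigma_n(n-2)}\frac{1}{|x-y|^{n-2}}\,\nabla u_0|_{\partial\Omega}(y)\cdot\eta(y)\Big)\,ds_y+\int_\Omega\frac{2}{\sigma_n(n-2)}\frac{1}{|x-y|^{n-2}}\,\frac{\nabla f(y)}{f(y)}\cdot\nabla u_0(y)\,dy=\begin{cases}u_0(x),&x\in\Omega,\\ 0,&x\in\mathbb{R}^n\setminus\overline\Omega,\end{cases}$$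 where for $x\in\Omega$ the value $u_0(x)$ is that of the continuous representative of $u_0$ in $\Omega$, which exists. -/

import Mathlib

open MeasureTheory Set Filter Topology
open scoped ENNReal NNReal ContDiff

noncomputable section

/-- Euclidean space `ℝⁿ`. -/
abbrev Eucl (n : ℕ) : Type := EuclideanSpace ℝ (Fin n)

/-- The `i`-th vector of the standard basis of `ℝⁿ`. -/
def basisVec {n : ℕ} (i : Fin n) : Eucl n := EuclideanSpace.single i (1 : ℝ)

/-! The Clifford algebra `Cl_{0,n}` -/

/-- The quadratic form `x ↦ -(x₁² + ⋯ + xₙ²)`. -/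
def cliffordForm (n : ℕ) : QuadraticForm ℝ (Fin n → ℝ) :=
  QuadraticMap.weightedSumSquares ℝ (fun _ : Fin n => (-1 : ℝ))

/-- The real Clifford algebra `Cl_{0,n}`, in which `eᵢ eⱼ + eⱼ eᵢ = -2 δᵢⱼ`.
Its conjugation (the anti-automorphism with `eᵢ ↦ -eᵢ`) is Mathlib's `star`. -/
abbrev Cl (n : ℕ) : Type := CliffordAlgebra (cliffordForm n)

/-- The generator `eᵢ` of `Cl_{0,n}`. -/
def cliffordGen {n : ℕ} (i : Fin n) : Cl n :=
  CliffordAlgebra.ι (cliffordForm n) (Pi.single i (1 : ℝ))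

/-- The vector `x = ∑ xᵢ eᵢ`, as an element of `Cl_{0,n}`. -/
def cliffordVec {n : ℕ} (x : Eucl n) : Cl n := ∑ i, x i • cliffordGen i

/-- The scalar part `Sc a = [a]₀`. The linear isomorphism `equivExterior` matches
`e_{i₁} ⋯ e_{iₖ}` with `e_{i₁} ∧ ⋯ ∧ e_{iₖ}` for `i₁ < ⋯ < iₖ`, and `algebraMapInv` is the
projection of the exterior algebra to its component of degree `0`. -/
def scalarPart {n : ℕ} (a : Cl n) : ℝ :=
  ExteriorAlgebra.algebraMapInv (CliffordAlgebra.equivExterior (cliffordForm n) a)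

/-! Lipschitz domains, surface measure, outward normal -/

/-- A bounded domain with Lipschitz boundary: near every boundary point `p` there are a unit
vector `ν` and a Lipschitz function `γ` of the component of `z` orthogonal to `ν`, such that
`Ω` is locally the part of space strictly above the graph of `γ` in direction `ν`. -/
structure IsLipschitzDomain {n : ℕ} (Ω : Set (Eucl n)) : Prop where
  isOpen : IsOpen Ω
  isConnected : IsConnected Ω
  isBounded : Bornology.IsBounded Ω
  lipschitz_frontier : ∀ p ∈ frontier Ω, ∃ r > 0, ∃ ν : Eucl n, ‖ν‖ = 1 ∧
    ∃ (K : ℝ≥0) (γ : Eucl n → ℝ), LipschitzWith K γ ∧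
      ∀ z ∈ Metric.ball p r, (z ∈ Ω ↔ γ (z - inner ℝ ν z • ν) < inner ℝ ν z)

/-- The surface measure `ds` on `∂Ω`: the `(n-1)`-dimensional Hausdorff measure (normalised so
as to agree with Lebesgue measure on hyperplanes) restricted to `∂Ω`. -/
def surfaceMeasure {n : ℕ} (Ω : Set (Eucl n)) : Measure (Eucl n) :=
  (Measure.euclideanHausdorffMeasure (n - 1)).restrict (frontier Ω)

/-- `ν` is the outward unit normal to `Ω` at `y`: near `y`, up to cones of arbitrarily small
opening around the hyperplane `y + ν^⊥`, the set `Ω` is the half-space `⟪z - y, ν⟫ < 0`. -/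
def IsOutwardNormal {n : ℕ} (Ω : Set (Eucl n)) (y ν : Eucl n) : Prop :=
  ‖ν‖ = 1 ∧ ∀ ε > 0, ∀ᶠ z in 𝓝 y,
    (inner ℝ (z - y) ν < -(ε * ‖z - y‖) → z ∈ Ω) ∧
    (ε * ‖z - y‖ < inner ℝ (z - y) ν → z ∉ Ω)

open Classical in
/-- The outward unit normal `η(y)`; it exists at almost every point of a Lipschitz boundary,
and the value `0` is used where it does not. -/
def outwardNormal {n : ℕ} (Ω : Set (Eucl n)) (y : Eucl n) : Eucl n :=
  if h : ∃ ν, IsOutwardNormal Ω y ν then h.choose else 0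

/-! Weak derivatives, Sobolev functions, traces -/

/-- Test functions in `C_c^∞(Ω)`. -/
structure IsTestFunction {n : ℕ} (Ω : Set (Eucl n)) (ζ : Eucl n → ℝ) : Prop where
  contDiff : ContDiff ℝ ∞ ζ
  hasCompactSupport : HasCompactSupport ζ
  tsupport_subset : tsupport ζ ⊆ Ω

/-- The partial derivative `∂ᵢζ(y)`. -/
def partialDeriv {n : ℕ} (i : Fin n) (ζ : Eucl n → ℝ) (y : Eucl n) : ℝ :=
  fderiv ℝ ζ y (basisVec i)

/-- `u ∈ W^{1,p}(Ω)` with weak gradient `G = ∇u`. -/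
structure HasSobolevGradient {n : ℕ} (Ω : Set (Eucl n)) (p : ℝ≥0∞)
    (u : Eucl n → ℝ) (G : Eucl n → Eucl n) : Prop where
  memLp : MemLp u p (volume.restrict Ω)
  memLp_grad : MemLp G p (volume.restrict Ω)
  integral_eq : ∀ ζ, IsTestFunction Ω ζ → ∀ i,
    ∫ y in Ω, u y * partialDeriv i ζ y = -∫ y in Ω, ζ y * G y i

/-- `φ ∈ L¹(∂Ω)` is the trace on `∂Ω` of the function `u ∈ W^{1,1}(Ω)` with gradient `G`:
the limit in `L¹(∂Ω)` of the restrictions to `∂Ω` of `C¹` functions on `ℝⁿ` that converge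
to `u` in `W^{1,1}(Ω)`. -/
def HasTrace {n : ℕ} (Ω : Set (Eucl n)) (u : Eucl n → ℝ) (G : Eucl n → Eucl n)
    (φ : Eucl n → ℝ) : Prop :=
  Integrable φ (surfaceMeasure Ω) ∧
  ∃ v : ℕ → Eucl n → ℝ, (∀ k, ContDiff ℝ 1 (v k)) ∧
    Tendsto (fun k => ∫⁻ y in Ω, ‖v k y - u y‖ₑ) atTop (𝓝 0) ∧
    Tendsto (fun k => ∫⁻ y in Ω, ‖gradient (v k) y - G y‖ₑ) atTop (𝓝 0) ∧
    Tendsto (fun k => ∫⁻ y, ‖v k y - φ y‖ₑ ∂(surfaceMeasure Ω)) atTop (𝓝 0)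

/-- The divergence `div F(y) = ∑ᵢ ∂ᵢFᵢ(y)`. -/
def divergence {n : ℕ} (F : Eucl n → Eucl n) (y : Eucl n) : ℝ :=
  ∑ i, fderiv ℝ F y (basisVec i) i

/-- `ψ ∈ L¹(∂Ω)` is the normal trace `F|_{∂Ω} · η` of the vector field `F ∈ L¹(Ω)`: the limit in
`L¹(∂Ω)` of `Fₖ · η` for `C¹` vector fields `Fₖ` on `ℝⁿ` such that `Fₖ → F` in `L¹(Ω)` and
`div Fₖ` converges in `L¹(Ω)` (necessarily to the weak divergence of `F`). -/
def HasNormalTrace {n : ℕ} (Ω : Set (Eucl n)) (F : Eucl n → Eucl n) (ψ : Eucl n → ℝ) : Prop :=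
  Integrable ψ (surfaceMeasure Ω) ∧
  ∃ (d : Eucl n → ℝ) (V : ℕ → Eucl n → Eucl n), IntegrableOn d Ω ∧ (∀ k, ContDiff ℝ 1 (V k)) ∧
    Tendsto (fun k => ∫⁻ y in Ω, ‖V k y - F y‖ₑ) atTop (𝓝 0) ∧
    Tendsto (fun k => ∫⁻ y in Ω, ‖divergence (V k) y - d y‖ₑ) atTop (𝓝 0) ∧
    Tendsto (fun k => ∫⁻ y, ‖inner ℝ (V k y) (outwardNormal Ω y) - ψ y‖ₑ ∂(surfaceMeasure Ω))
      atTop (𝓝 0)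

/-! The main Vekua equation -/

/-- `w ∈ L^p(Ω, Cl_{0,n})` solves `D w = (∇f / f) w̄` in `Ω` in the sense of distributions, where
`D = ∑ eᵢ ∂ᵢ` and `gradf` is the weak gradient of `f`. A statement on `Cl_{0,n}`-valued
functions is read coordinatewise, that is, after applying every linear functional `ℓ` on the
finite-dimensional space `Cl_{0,n}`. -/
structure IsMainVekuaSolution {n : ℕ} (Ω : Set (Eucl n)) (p : ℝ≥0∞)
    (f : Eucl n → ℝ) (gradf : Eucl n → Eucl n) (w : Eucl n → Cl n) : Prop where
  memLp : ∀ ℓ : Module.Dual ℝ (Cl n), MemLp (fun y => ℓ (w y)) p (volume.restrict Ω)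
  equation : ∀ ζ, IsTestFunction Ω ζ → ∀ ℓ : Module.Dual ℝ (Cl n),
    -∑ i, ∫ y in Ω, partialDeriv i ζ y * ℓ (cliffordGen i * w y)
      = ∫ y in Ω, ζ y * ℓ (cliffordVec ((f y)⁻¹ • gradf y) * star (w y))

/-! The kernels and the representation formula -/

/-- The surface area `σₙ` of the unit sphere in `ℝⁿ`. -/
def sphereArea (n : ℕ) : ℝ := ((volume : Measure (Eucl n)).toSphere univ).toReal

/-- The Cauchy kernel `E(x) = -x / (σₙ |x|ⁿ)`. -/
def cauchyKernel {n : ℕ} (x : Eucl n) : Eucl n := -((sphereArea n * ‖x‖ ^ n)⁻¹ • x)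

/-- The integrand over `∂Ω`: `-E(y-x)·η(y) φ(y) + (1/(σₙ(n-2))) |x-y|^{-(n-2)} ψ(y)`, where `φ` and
`ψ` are the boundary values and the normal derivative. -/
def boundaryIntegrand {n : ℕ} (Ω : Set (Eucl n)) (φ ψ : Eucl n → ℝ) (x y : Eucl n) : ℝ :=
  -(inner ℝ (cauchyKernel (y - x)) (outwardNormal Ω y)) * φ y
    + 1 / (sphereArea n * ((n : ℝ) - 2)) * (1 / ‖x - y‖ ^ (n - 2)) * ψ y

/-- The integrand over `Ω`: `(2/(σₙ(n-2))) |x-y|^{-(n-2)} (∇f/f)(y)·∇u(y)`. -/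
def volumeIntegrand {n : ℕ} (f : Eucl n → ℝ) (gradf gradu : Eucl n → Eucl n)
    (x y : Eucl n) : ℝ :=
  2 / (sphereArea n * ((n : ℝ) - 2)) * (1 / ‖x - y‖ ^ (n - 2))
    * inner ℝ ((f y)⁻¹ • gradf y) (gradu y)

end

open MeasureTheory Set Filter Topology
open scoped ENNReal NNReal ContDiff Manifold

/-! ### Involution, reversal and right multiplication under a change of quadratic form. -/

namespace CliffordAlgebra

variable {R M : Type*} [CommRing R] [AddCommGroup M] [Module R M] {Q Q' : QuadraticForm R M}
  {B : LinearMap.BilinForm R M}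

/-! The algebraic core is that `u₀` solves the conductivity equation `div(f² ∇u₀) = 0`, that is `Δu₀
= -2 (∇f/f)·∇u₀`. Apply `a ↦ Sc(eₖ a)` to the Vekua equation. The numbers `Bₖᵢ = Sc(eₖ eᵢ w)` form
the matrix `-w₀ δₖᵢ` plus an antisymmetric one, and conjugating `w` transposes it, because `Sc` is a
trace invariant under conjugation. Multiplied by `f`, the equation becomes `∑ᵢ ∂ᵢ(f Bₖᵢ) = -2 (∂ₖf)
w₀`. Applying `∂ₖ` and summing over `k` removes the antisymmetric part, since Hessians are
symmetric, and what remains is the conductivity equation for `u₀ = w₀/f`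
(`IsMainVekuaSolution.laplacian_eq`). Everything is done weakly, with a product rule for
multiplication by `f ∈ W^{1,∞}` (`HasWeakDivergence.mul`).

The analytic core is Green's second identity. The divergence theorem on a Lipschitz domain for `C¹`
functions (`IsLipschitzDomain.integral_fderiv`) rests on the area formula for Lipschitz graphs,
flattening of the boundary and a partition of unity. It passes to `u₀` through the sequences
defining the two traces (`green_identity`). Take as test function a Newtonian kernel `Γ_ε(· - x)`
made smooth inside the ball of radius `ε`. Its negative Laplacian `ρ_ε` is an approximate identity
supported in that ball. For `x` off the boundary and `ε` small, the boundary integral equals `∫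
Γ_ε(y-x) d(y) dy + ∫ ρ_ε(y-x) u₀(y) dy`, where `d = Δu₀` (`boundaryIntegrand_integral`). If `x` lies
outside the closure, the second term vanishes and `Γ_ε = Γ` on `Ω`.

For every `x ∈ Ω`, and not only almost every one, `∫ Γ(y-x) |d| dy` must be finite and the
truncation error must tend to zero. A priori `∇u₀` is only integrable, so a bootstrap is used. Since
`|d| ≤ M |∇u₀|`, interior estimates bound `|∇u₀|` locally by `C + C ∫ |x-y|^{1-n} |∇u₀(y)| dy`
(`exists_ae_grad_le`). Substituting this into a potential with kernel `|z|^{-s}` bounds it by one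
with exponent `s - 1/2`. Starting from the `L¹` norm, the exponent climbs in half steps to `n -
3/2`, beyond the Newtonian `n - 2` (`exists_bound_lintegral_rieszKernel_grad`). The truncation error
is then `O(ε^{1/2})` locally uniformly in `x` (`exists_uniform_approx`). So the left side of the
formula is a locally uniform limit of the continuous mollifications of `u₀`, hence continuous and
almost everywhere equal to `u₀` (`continuousOn_and_ae_eq_of_approx`). -/

theorem contractLeft_mul_ι (d : Module.Dual R M) (v : M) (x : CliffordAlgebra Q) :
    contractLeft d (x * ι Q v) = contractLeft d x * ι Q v + d v • involute x := by
  induction x using CliffordAlgebra.left_induction with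
  | algebraMap r =>
    simp [Algebra.algebraMap_eq_smul_one, smul_smul, mul_comm]
  | add x y hx hy =>
    simp only [add_mul, map_add, hx, hy, smul_add]; abel
  | ι_mul x u hx =>
    rw [mul_assoc, contractLeft_ι_mul, hx, contractLeft_ι_mul, map_mul, involute_ι]
    simp only [mul_add, sub_mul, mul_assoc, mul_smul_comm, smul_mul_assoc, neg_mul, smul_neg]
    abel

theorem involute_contractLeft (d : Module.Dual R M) (x : CliffordAlgebra Q) :
    involute (contractLeft d x) = -contractLeft d (involute x) := by
  induction x using CliffordAlgebra.left_induction with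
  | algebraMap r => simp
  | add x y hx hy => simp only [map_add, hx, hy, neg_add]
  | ι_mul x u hx =>
    rw [contractLeft_ι_mul, map_mul, involute_ι, neg_mul, map_neg, contractLeft_ι_mul, map_sub,
      map_mul, involute_ι, hx, map_smul]
    simp

/-- Reversal carries a left factor `ι v` to the right, so the two Leibniz rules `contractLeft_ι_mul`
and `contractLeft_mul_ι` meet. The involution supplies the degree-dependent sign by which they
differ. -/
theorem contractLeft_involute_reverse (d : Module.Dual R M) (x : CliffordAlgebra Q) :
    contractLeft d (involute (reverse x)) = -reverse (contractLeft d x) := by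
  induction x using CliffordAlgebra.left_induction with
  | algebraMap r => simp
  | add x y hx hy => simp only [map_add, hx, hy, neg_add]
  | ι_mul x u hx =>
    rw [reverse.map_mul, reverse_ι, map_mul, involute_ι, mul_neg, map_neg, contractLeft_mul_ι, hx,
      involute_involute, contractLeft_ι_mul, map_sub, reverse.map_mul, reverse_ι, map_smul]
    simp only [neg_mul, neg_add, neg_neg, neg_sub]
    abel

theorem changeForm_involute (h : B.toQuadraticMap = Q' - Q) (x : CliffordAlgebra Q) :
    changeForm h (involute x) = involute (changeForm h x) := by
  induction x using CliffordAlgebra.left_induction with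
  | algebraMap r => simp [changeForm_algebraMap]
  | add x y hx hy => simp only [map_add, hx, hy]
  | ι_mul x u hx =>
    rw [map_mul, involute_ι, neg_mul, map_neg, changeForm_ι_mul, changeForm_ι_mul, hx, map_sub,
      map_mul, involute_ι, involute_contractLeft]
    simp only [neg_mul, neg_sub, sub_neg_eq_add]
    abel

/-- Mirror image of `changeForm_ι_mul`. Moving the contraction by `B v` past a generator `ι u` on
the left produces `B v u`, and the contraction by `B u` past `ι v` on the right produces `B u v`.
Symmetry of `B` makes them agree. -/
theorem changeForm_mul_ι (h : B.toQuadraticMap = Q' - Q) (hB : ∀ u v, B u v = B v u) (v : M)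
    (x : CliffordAlgebra Q) :
    changeForm h (x * ι Q v) =
      changeForm h x * ι Q' v + contractLeft (B v) (involute (changeForm h x)) := by
  induction x using CliffordAlgebra.left_induction with
  | algebraMap r =>
    simp [← Algebra.smul_def, changeForm_ι, changeForm_algebraMap]
  | add x y hx hy =>
    simp only [add_mul, map_add, hx, hy]; abel
  | ι_mul x u hx =>
    rw [mul_assoc, changeForm_ι_mul, hx, changeForm_ι_mul, map_add, contractLeft_mul_ι,
      map_sub, map_mul, involute_ι, involute_contractLeft, neg_mul, sub_neg_eq_add, map_add,
      map_neg, contractLeft_ι_mul, contractLeft_comm (d := B v), hB v u]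
    simp only [mul_add, sub_mul, mul_assoc]
    abel

theorem changeForm_reverse (h : B.toQuadraticMap = Q' - Q) (hB : ∀ u v, B u v = B v u)
    (x : CliffordAlgebra Q) :
    changeForm h (reverse x) = reverse (changeForm h x) := by
  induction x using CliffordAlgebra.left_induction with
  | algebraMap r => simp [changeForm_algebraMap]
  | add x y hx hy => simp only [map_add, hx, hy]
  | ι_mul x u hx =>
    rw [reverse.map_mul, reverse_ι, changeForm_mul_ι h hB, changeForm_ι_mul, hx, map_sub,
      reverse.map_mul, reverse_ι, contractLeft_involute_reverse]
    abel

end CliffordAlgebra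

theorem ExteriorAlgebra.algebraMapInv_involute {R M : Type*} [CommRing R] [AddCommGroup M]
    [Module R M] (x : ExteriorAlgebra R M) :
    ExteriorAlgebra.algebraMapInv (CliffordAlgebra.involute x) =
      ExteriorAlgebra.algebraMapInv x := by
  have : (ExteriorAlgebra.algebraMapInv (R := R) (M := M)).comp CliffordAlgebra.involute =
      ExteriorAlgebra.algebraMapInv := by
    apply ExteriorAlgebra.hom_ext
    ext m
    have := CliffordAlgebra.involute_ι (Q := (0 : QuadraticForm R M)) m
    simp [ExteriorAlgebra.algebraMapInv, ExteriorAlgebra.ι, this]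

  exact DFunLike.congr_fun this x

/-- The degree-zero projection is an algebra map into a commutative ring, so it does not see the
order of factors. -/
theorem ExteriorAlgebra.algebraMapInv_reverse {R M : Type*} [CommRing R] [AddCommGroup M]
    [Module R M] (x : ExteriorAlgebra R M) :
    ExteriorAlgebra.algebraMapInv (CliffordAlgebra.reverse x) =
      ExteriorAlgebra.algebraMapInv x := by
  induction x using CliffordAlgebra.left_induction with
  | algebraMap r => simp
  | add x y hx hy => simp only [map_add, hx, hy]
  | ι_mul x u hx =>
    rw [CliffordAlgebra.reverse.map_mul, CliffordAlgebra.reverse_ι, map_mul, map_mul, mul_comm, hx]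

/-! ### The scalar part is a trace; the functionals `Sc(eₖ eᵢ w)`. -/

section ScalarPart

variable {n : ℕ}

/-- The scalar part as a linear functional. -/
noncomputable def scalarPartDual (n : ℕ) : Module.Dual ℝ (Cl n) :=
  ExteriorAlgebra.algebraMapInv.toLinearMap ∘ₗ
    (CliffordAlgebra.equivExterior (cliffordForm n)).toLinearMap

theorem scalarPartDual_apply (a : Cl n) : scalarPartDual n a = scalarPart a := rfl

theorem scalarPart_eq_changeForm (a : Cl n) :
    scalarPart a = ExteriorAlgebra.algebraMapInv
      (CliffordAlgebra.changeForm
        (CliffordAlgebra.changeForm.associated_neg_proof (Q := cliffordForm n)) a) := rfl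

theorem scalarPart_involute (a : Cl n) :
    scalarPart (CliffordAlgebra.involute a) = scalarPart a := by
  rw [scalarPart_eq_changeForm, CliffordAlgebra.changeForm_involute,
    ExteriorAlgebra.algebraMapInv_involute, ← scalarPart_eq_changeForm]

theorem associated_neg_symm (u v : Fin n → ℝ) :
    QuadraticMap.associated (R := ℝ) (-cliffordForm n) u v =
      QuadraticMap.associated (R := ℝ) (-cliffordForm n) v u :=
  QuadraticMap.associated_isSymm ℝ (-cliffordForm n) u v

theorem scalarPart_reverse (a : Cl n) :
    scalarPart (CliffordAlgebra.reverse a) = scalarPart a := by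
  rw [scalarPart_eq_changeForm, CliffordAlgebra.changeForm_reverse _ associated_neg_symm,
    ExteriorAlgebra.algebraMapInv_reverse, ← scalarPart_eq_changeForm]

theorem scalarPart_star (a : Cl n) : scalarPart (star a) = scalarPart a := by
  rw [CliffordAlgebra.star_def, scalarPart_reverse, scalarPart_involute]

/-- In the exterior algebra a product with a vector has no degree-zero part, so only the contraction
terms of `changeForm_ι_mul` and `changeForm_mul_ι` contribute. They differ by an involution, which
is invisible in degree zero. -/
theorem scalarPart_ι_mul_comm (v : Fin n → ℝ) (a : Cl n) :
    scalarPart (CliffordAlgebra.ι (cliffordForm n) v * a) =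
      scalarPart (a * CliffordAlgebra.ι (cliffordForm n) v) := by
  have h0 : ∀ v : Fin n → ℝ, ExteriorAlgebra.algebraMapInv
      (CliffordAlgebra.ι (0 : QuadraticForm ℝ (Fin n → ℝ)) v : ExteriorAlgebra ℝ (Fin n → ℝ)) =
        0 := by
    intro v
    exact (CliffordAlgebra.lift_ι_apply _ _ _)
  rw [scalarPart_eq_changeForm, scalarPart_eq_changeForm,
    CliffordAlgebra.changeForm_mul_ι _ associated_neg_symm, CliffordAlgebra.changeForm_ι_mul,
    map_sub, map_add, map_mul, map_mul, h0, zero_mul, mul_zero, zero_sub, zero_add,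
    ← ExteriorAlgebra.algebraMapInv_involute, CliffordAlgebra.involute_contractLeft, map_neg,
    neg_neg]

theorem scalarPart_mul_comm (a b : Cl n) : scalarPart (a * b) = scalarPart (b * a) := by
  simp only [← scalarPartDual_apply]
  induction a using CliffordAlgebra.left_induction generalizing b with
  | algebraMap r => rw [Algebra.commutes]
  | add x y hx hy => simp only [add_mul, mul_add, map_add, hx, hy]
  | ι_mul x u hx =>
    have h := scalarPart_ι_mul_comm u (x * b)
    simp only [← scalarPartDual_apply] at h
    rw [mul_assoc, h, mul_assoc, hx, mul_assoc]

theorem cliffordForm_apply (v : Fin n → ℝ) : cliffordForm n v = -∑ i, v i * v i := by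
  simp [cliffordForm, QuadraticMap.weightedSumSquares_apply]

theorem polar_cliffordForm (u v : Fin n → ℝ) :
    QuadraticMap.polar (cliffordForm n) u v = -2 * ∑ i, u i * v i := by
  simp only [QuadraticMap.polar, cliffordForm_apply, Pi.add_apply, Finset.mul_sum,
    ← Finset.sum_neg_distrib, ← Finset.sum_sub_distrib]
  exact Finset.sum_congr rfl fun i _ => by ring

theorem cliffordGen_mul_self (i : Fin n) : cliffordGen i * cliffordGen i = (-1 : Cl n) := by
  rw [cliffordGen, CliffordAlgebra.ι_sq_scalar, cliffordForm_apply]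
  simp [Pi.single_apply]

theorem cliffordGen_mul_comm {i j : Fin n} (h : i ≠ j) :
    cliffordGen i * cliffordGen j = -(cliffordGen j * cliffordGen i : Cl n) := by
  rw [eq_neg_iff_add_eq_zero, cliffordGen, cliffordGen, CliffordAlgebra.ι_mul_ι_add_swap,
    polar_cliffordForm]
  simp [Pi.single_apply, h.symm]

theorem star_cliffordGen (i : Fin n) : star (cliffordGen i : Cl n) = -cliffordGen i :=
  CliffordAlgebra.star_ι _

/-- The functional `w ↦ Sc(eₖ eᵢ w)`. -/
noncomputable def bivectorDual (k i : Fin n) : Module.Dual ℝ (Cl n) :=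
  scalarPartDual n ∘ₗ LinearMap.mulLeft ℝ (cliffordGen k * cliffordGen i)

theorem bivectorDual_apply (k i : Fin n) (w : Cl n) :
    bivectorDual k i w = scalarPart (cliffordGen k * (cliffordGen i * w)) := by
  rw [← mul_assoc]; rfl

/-- Together with `bivectorDual_comm`: the matrix `Sc(eₖ eᵢ w)` is `-Sc(w)` times the identity plus
an antisymmetric matrix, so a symmetric matrix pairs with it only through its trace. -/
theorem bivectorDual_self (k : Fin n) (w : Cl n) : bivectorDual k k w = -scalarPart w := by
  rw [bivectorDual_apply, ← mul_assoc, cliffordGen_mul_self, neg_one_mul, ← scalarPartDual_apply,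
    map_neg, scalarPartDual_apply]

theorem bivectorDual_comm {k i : Fin n} (h : k ≠ i) (w : Cl n) :
    bivectorDual k i w = -bivectorDual i k w := by
  rw [bivectorDual_apply, bivectorDual_apply, ← mul_assoc, cliffordGen_mul_comm h, neg_mul,
    mul_assoc, ← scalarPartDual_apply, map_neg, scalarPartDual_apply]

/-- This removes the conjugate from the Vekua equation. Conjugating the whole argument turns `eₖ eᵢ
w̄` into `w eᵢ eₖ`, the two signs cancelling, and the trace property moves `w` to the end. -/
theorem bivectorDual_star (k i : Fin n) (w : Cl n) :
    bivectorDual k i (star w) = bivectorDual i k w := by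
  rw [bivectorDual_apply, ← scalarPart_star, star_mul, star_mul, star_star, star_cliffordGen,
    star_cliffordGen, mul_assoc, scalarPart_mul_comm, neg_mul_neg, bivectorDual_apply, ← mul_assoc]

end ScalarPart

/-! ### Weak divergences and the conductivity equation for `u₀`. -/

section WeakDivergence

variable {n : ℕ}

theorem IsTestFunction.partialDeriv {Ω : Set (Eucl n)} {ζ : Eucl n → ℝ}
    (h : IsTestFunction Ω ζ) (i : Fin n) : IsTestFunction Ω (partialDeriv i ζ) where
  contDiff := (h.contDiff.fderiv_right (m := ∞) (by simp)).clm_apply contDiff_const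
  hasCompactSupport := h.hasCompactSupport.fderiv_apply ℝ (basisVec i)
  tsupport_subset := (tsupport_fderiv_apply_subset ℝ (basisVec i)).trans h.tsupport_subset

theorem IsTestFunction.smooth_mul {Ω : Set (Eucl n)} {F ζ : Eucl n → ℝ}
    (h : IsTestFunction Ω ζ) (hF : ContDiff ℝ ∞ F) : IsTestFunction Ω (fun y => F y * ζ y) where
  contDiff := hF.mul h.contDiff
  hasCompactSupport := h.hasCompactSupport.mul_left
  tsupport_subset := (tsupport_mul_subset_right).trans h.tsupport_subset

theorem partialDeriv_mul {F ζ : Eucl n → ℝ} {y : Eucl n} (hF : DifferentiableAt ℝ F y)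
    (hζ : DifferentiableAt ℝ ζ y) (i : Fin n) :
    partialDeriv i (fun y => F y * ζ y) y = F y * partialDeriv i ζ y + ζ y * partialDeriv i F y := by
  simp only [partialDeriv]
  rw [fderiv_fun_mul hF hζ]
  simp

theorem IsTestFunction.continuous {Ω : Set (Eucl n)} {ζ : Eucl n → ℝ}
    (h : IsTestFunction Ω ζ) : Continuous ζ := h.contDiff.continuous

theorem IsTestFunction.exists_bound {Ω : Set (Eucl n)} {ζ : Eucl n → ℝ}
    (h : IsTestFunction Ω ζ) : ∃ C, 0 ≤ C ∧ ∀ y, |ζ y| ≤ C := by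
  obtain ⟨C, hC⟩ := h.hasCompactSupport.exists_bound_of_continuous h.continuous
  exact ⟨C, (norm_nonneg _).trans (hC 0), hC⟩

theorem IsTestFunction.integrable_mul {Ω : Set (Eucl n)} {ζ b : Eucl n → ℝ}
    (h : IsTestFunction Ω ζ) (hb : IntegrableOn b Ω) : IntegrableOn (fun y => ζ y * b y) Ω := by
  obtain ⟨C, -, hC⟩ := h.exists_bound
  exact hb.bdd_mul h.continuous.aestronglyMeasurable (ae_of_all _ hC)

/-- A function in `W^{1,∞}` can be approximated, near a compact set and with bounds, by smooth
functions that converge a.e. together with their first derivatives. -/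
theorem HasSobolevGradient.exists_smooth_approx {Ω : Set (Eucl n)} (hΩ : IsOpen Ω)
    {f : Eucl n → ℝ} {G : Eucl n → Eucl n} (hf : HasSobolevGradient Ω ⊤ f G)
    {K : Set (Eucl n)} (hK : IsCompact K) (hKΩ : K ⊆ Ω) :
    ∃ (F : ℕ → Eucl n → ℝ) (C : ℝ), (∀ k, ContDiff ℝ ∞ (F k)) ∧
      (∀ k, ∀ y ∈ K, |F k y| ≤ C ∧ ∀ i, |partialDeriv i (F k) y| ≤ C) ∧
      ∀ᵐ y, y ∈ K → Tendsto (fun k => F k y) atTop (𝓝 (f y)) ∧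
        ∀ i, Tendsto (fun k => partialDeriv i (F k) y) atTop (𝓝 (G y i)) := by
  obtain ⟨δ, hδ, hδK⟩ := hK.exists_thickening_subset_open hΩ hKΩ
  -- bounds
  obtain ⟨C₁, hC₁⟩ : ∃ C : ℝ, ∀ᵐ y ∂(volume.restrict Ω), ‖f y‖ ≤ C :=
    ⟨_, ae_le_lpNorm_exponent_top hf.memLp⟩
  obtain ⟨C₂, hC₂⟩ : ∃ C : ℝ, ∀ᵐ y ∂(volume.restrict Ω), ‖G y‖ ≤ C :=
    ⟨_, ae_le_lpNorm_exponent_top hf.memLp_grad⟩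
  set C := max (max C₁ C₂) 0
  have hC0 : 0 ≤ C := le_max_right _ _
  -- Outer radii below `δ` make the mollification at a point of `K` use only values inside `Ω`. The
  -- fixed ratio of outer to inner radius is what the almost everywhere convergence requires.
  let φ : ℕ → ContDiffBump (0 : Eucl n) := fun k =>
    ⟨δ / 2 / (k + 1) / 2, δ / 2 / (k + 1), by positivity, half_lt_self (by positivity)⟩
  have hφ : Tendsto (fun k => (φ k).rOut) atTop (𝓝 0) := by
    have := (tendsto_one_div_add_atTop_nhds_zero_nat (𝕜 := ℝ)).const_mul (δ / 2)
    simpa [φ, div_eq_mul_inv] using this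
  have hφ' : ∀ᶠ k in atTop, (φ k).rOut ≤ 2 * (φ k).rIn :=
    Eventually.of_forall fun k => by simp only [φ]; linarith
  have hφδ : ∀ k, (φ k).rOut < δ := fun k => by
    have : δ / 2 / ((k : ℝ) + 1) ≤ δ / 2 := div_le_self (by positivity) (by simp)
    simp only [φ]; linarith
  have bdd : ∀ h : Eucl n → ℝ, AEStronglyMeasurable h (volume.restrict Ω) →
      (∀ᵐ y ∂(volume.restrict Ω), ‖h y‖ ≤ C) →
      AEStronglyMeasurable (Ω.indicator h) volume ∧ (∀ᵐ y, ‖Ω.indicator h y‖ ≤ C) ∧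
      LocallyIntegrable (Ω.indicator h) := by
    intro h hm hb
    have h1 : AEStronglyMeasurable (Ω.indicator h) volume :=
      (aestronglyMeasurable_indicator_iff hΩ.measurableSet).2 hm
    have h2 : ∀ᵐ y, ‖Ω.indicator h y‖ ≤ C := by
      rw [ae_restrict_iff' hΩ.measurableSet] at hb
      filter_upwards [hb] with y hy
      by_cases hyΩ : y ∈ Ω
      · simpa [hyΩ] using hy hyΩ
      · simpa [hyΩ] using hC0
    refine ⟨h1, h2, ?_⟩
    rw [locallyIntegrable_iff]
    intro k hk
    exact Measure.integrableOn_of_bounded hk.measure_lt_top.ne h1 (ae_restrict_of_ae h2)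
  have hfm := bdd f hf.memLp.1 (hC₁.mono fun y hy =>
    hy.trans ((le_max_left _ _).trans (le_max_left _ _)))
  have hGm : ∀ i, _ := fun i => bdd (fun y => G y i)
    ((EuclideanSpace.proj (𝕜 := ℝ) i).continuous.comp_aestronglyMeasurable hf.memLp_grad.1)
    (hC₂.mono fun y hy => (PiLp.norm_apply_le (G y) i).trans
      (hy.trans ((le_max_right _ _).trans (le_max_left _ _))))
  -- bounds on mollifications
  have mollbd : ∀ h : Eucl n → ℝ, (∀ᵐ y, ‖h y‖ ≤ C) → ∀ k y,
      |convolution ((φ k).normed volume) h (ContinuousLinearMap.lsmul ℝ ℝ) volume y| ≤ C := by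
    intro h hb k y
    rw [convolution_lsmul_swap, ← Real.norm_eq_abs]
    have hint : Integrable (fun t => (φ k).normed volume (y - t)) :=
      ((φ k).integrable_normed).comp_sub_left y
    calc _ ≤ ∫ t, (φ k).normed volume (y - t) * C := by
          refine norm_integral_le_of_norm_le (hint.mul_const C) ?_
          filter_upwards [hb] with t ht
          rw [norm_smul, Real.norm_of_nonneg ((φ k).nonneg_normed _)]
          exact mul_le_mul_of_nonneg_left ht ((φ k).nonneg_normed _)
      _ = C := by
          rw [integral_mul_const, integral_sub_left_eq_self (fun t => (φ k).normed volume t),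
            (φ k).integral_normed, one_mul]
  let F : ℕ → Eucl n → ℝ := fun k =>
    convolution ((φ k).normed volume) (Ω.indicator f) (ContinuousLinearMap.lsmul ℝ ℝ) volume
  have hFs : ∀ k, ContDiff ℝ ∞ (F k) := fun k =>
    HasCompactSupport.contDiff_convolution_left _ (φ k).hasCompactSupport_normed
      (φ k).contDiff_normed hfm.2.2
  have hFd : ∀ k, ∀ y ∈ K, ∀ i, partialDeriv i (F k) y =
      convolution ((φ k).normed volume) (Ω.indicator fun y => G y i)
        (ContinuousLinearMap.lsmul ℝ ℝ) volume y := by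
    intro k y hy i
    have h1 := HasCompactSupport.hasFDerivAt_convolution_left (𝕜 := ℝ)
      (ContinuousLinearMap.lsmul ℝ ℝ)
      (φ k).hasCompactSupport_normed ((φ k).contDiff_normed (μ := volume) (n := 1)) hfm.2.2 y
    have hs1 : ContDiff ℝ ∞ ((φ k).normed (volume : Measure (Eucl n))) := (φ k).contDiff_normed
    -- The derivative of the convolution falls on the mollifier. Its translate is an admissible test
    -- function, so the definition of the weak gradient moves the derivative onto `f`.
    have htest : IsTestFunction Ω (fun t => (φ k).normed volume (y - t)) := by
      have hts : tsupport (fun t => (φ k).normed volume (y - t)) ⊆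
          Metric.closedBall y (φ k).rOut := by
        refine closure_minimal ?_ Metric.isClosed_closedBall
        intro t ht
        have : y - t ∈ Function.support ((φ k).normed volume) := ht
        rw [(φ k).support_normed_eq, mem_ball_zero_iff] at this
        rw [Metric.mem_closedBall, dist_comm, dist_eq_norm]
        exact this.le
      refine ⟨hs1.comp (contDiff_const.sub contDiff_id), ?_, ?_⟩
      · exact HasCompactSupport.of_support_subset_isCompact (isCompact_closedBall y (φ k).rOut)
          ((subset_tsupport _).trans hts)
      · refine hts.trans fun t ht => hδK ?_
        rw [Metric.mem_thickening_iff]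
        exact ⟨y, hy, ht.trans_lt (hφδ k)⟩
    have hpd : ∀ t, partialDeriv i (fun t => (φ k).normed volume (y - t)) t =
        -partialDeriv i ((φ k).normed volume) (y - t) := by
      intro t
      have h2 : HasFDerivAt (fun t : Eucl n => y - t) (-ContinuousLinearMap.id ℝ (Eucl n)) t := by
        simpa using (hasFDerivAt_id t).const_sub y
      have h3 := ((hs1.differentiable (by simp)) (y - t)).hasFDerivAt.comp t h2
      have h4 : fderiv ℝ (fun t => (φ k).normed volume (y - t)) t = _ := h3.fderiv
      simp only [partialDeriv]
      rw [h4]; simp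
    have h5 := hf.integral_eq _ htest i
    simp only [hpd] at h5
    have h6 : ConvolutionExistsAt (fderiv ℝ ((φ k).normed volume)) (Ω.indicator f) y
        ((ContinuousLinearMap.lsmul ℝ ℝ).precompL (Eucl n)) volume :=
      ((φ k).hasCompactSupport_normed.fderiv ℝ).convolutionExists_left _
        (hs1.continuous_fderiv (by simp)) hfm.2.2 y
    have h7 : fderiv ℝ (F k) y = _ := h1.fderiv
    have h8 : Integrable (fun t => ((ContinuousLinearMap.lsmul ℝ ℝ).precompL (Eucl n))
        (fderiv ℝ ((φ k).normed volume) (y - t)) (Ω.indicator f t)) :=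
      ConvolutionExistsAt.integrable_swap h6
    simp only [partialDeriv]
    rw [h7, convolution_eq_swap, ContinuousLinearMap.integral_apply h8, convolution_eq_swap]
    simp only [ContinuousLinearMap.precompL_apply, ContinuousLinearMap.lsmul_apply, smul_eq_mul]
    simp only [mul_neg, integral_neg, neg_inj] at h5
    rw [← integral_indicator hΩ.measurableSet, ← integral_indicator hΩ.measurableSet] at h5
    calc _ = _ := integral_congr_ae (ae_of_all _ fun t => ?_)
      _ = _ := h5
      _ = _ := integral_congr_ae (ae_of_all _ fun t => ?_)
    · by_cases ht : t ∈ Ω <;> simp [ht, partialDeriv, mul_comm]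
    · by_cases ht : t ∈ Ω <;> simp [ht]
  refine ⟨F, C, hFs, fun k y hy => ⟨mollbd _ hfm.2.1 k y, fun i => ?_⟩, ?_⟩
  · rw [hFd k y hy i]; exact mollbd _ (hGm i).2.1 k y
  · have h1 := ContDiffBump.ae_convolution_tendsto_right_of_locallyIntegrable hφ hφ' hfm.2.2
    have h2 : ∀ᵐ y, ∀ i, _ := ae_all_iff.2 fun i =>
      ContDiffBump.ae_convolution_tendsto_right_of_locallyIntegrable hφ hφ' (hGm i).2.2
    filter_upwards [h1, h2] with y hy1 hy2 hyK
    have hyΩ := hKΩ hyK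
    refine ⟨by simpa [hyΩ] using hy1, fun i => ?_⟩
    have := hy2 i
    simp only [indicator_of_mem hyΩ] at this
    exact this.congr fun k => (hFd k y hyK i).symm

/-- The vector field with components `A i` has weak divergence `b` in `Ω`. -/
structure HasWeakDivergence (Ω : Set (Eucl n)) (A : Fin n → Eucl n → ℝ) (b : Eucl n → ℝ) :
    Prop where
  integrableOn : ∀ i, IntegrableOn (A i) Ω
  integrableOn_div : IntegrableOn b Ω
  integral_eq : ∀ ζ, IsTestFunction Ω ζ →
    ∫ y in Ω, ∑ i, A i y * partialDeriv i ζ y = -∫ y in Ω, ζ y * b y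

theorem integrableOn_mul_of_memLp_top {Ω : Set (Eucl n)} {f A : Eucl n → ℝ}
    (hf : MemLp f ⊤ (volume.restrict Ω)) (hA : IntegrableOn A Ω) :
    IntegrableOn (fun y => f y * A y) Ω :=
  hA.bdd_mul hf.1 (ae_le_lpNorm_exponent_top hf)

theorem memLp_coord {Ω : Set (Eucl n)} {G : Eucl n → Eucl n} {p : ℝ≥0∞}
    (hG : MemLp G p (volume.restrict Ω)) (i : Fin n) :
    MemLp (fun y => G y i) p (volume.restrict Ω) :=
  hG.of_le ((EuclideanSpace.proj (𝕜 := ℝ) i).continuous.comp_aestronglyMeasurable hG.1)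
    (ae_of_all _ fun y => PiLp.norm_apply_le (G y) i)

/-- Product rule for the weak divergence. -/
theorem HasWeakDivergence.mul {Ω : Set (Eucl n)} (hΩ : IsOpen Ω) {A : Fin n → Eucl n → ℝ}
    {b : Eucl n → ℝ} (h : HasWeakDivergence Ω A b) {f : Eucl n → ℝ} {G : Eucl n → Eucl n}
    (hf : HasSobolevGradient Ω ⊤ f G) :
    HasWeakDivergence Ω (fun i y => f y * A i y) (fun y => f y * b y + ∑ i, G y i * A i y) where
  integrableOn i := integrableOn_mul_of_memLp_top hf.memLp (h.integrableOn i)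
  integrableOn_div := (integrableOn_mul_of_memLp_top hf.memLp h.integrableOn_div).add
    (integrable_finsetSum _ fun i _ =>
      integrableOn_mul_of_memLp_top (memLp_coord hf.memLp_grad i) (h.integrableOn i))
  integral_eq ζ hζ := by
    obtain ⟨F, C, hFs, hFb, hFl⟩ :=
      hf.exists_smooth_approx hΩ hζ.hasCompactSupport.isCompact hζ.tsupport_subset
    -- The approximants are controlled only on the support of `ζ`; elsewhere every integrand
    -- vanishes with `ζ` and its derivatives.
    have hz : ∀ y, y ∉ tsupport ζ → ζ y = 0 ∧ ∀ i, partialDeriv i ζ y = 0 := fun y hy =>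
      ⟨image_eq_zero_of_notMem_tsupport hy, fun i => image_eq_zero_of_notMem_tsupport fun hc =>
        hy (tsupport_fderiv_apply_subset ℝ (basisVec i) hc)⟩
    obtain ⟨M, hM0, hM⟩ := hζ.exists_bound
    choose M' hM0' hM' using fun i => (hζ.partialDeriv i).exists_bound
    -- `f ζ` need not be smooth, but `F k * ζ` is an admissible test function. Dominated convergence
    -- then lets `k` tend to infinity.
    have key : ∀ k, ∫ y in Ω, (∑ i, A i y * (F k y * partialDeriv i ζ y +
        ζ y * partialDeriv i (F k) y)) = -∫ y in Ω, F k y * ζ y * b y := by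
      intro k
      rw [← h.integral_eq _ (hζ.smooth_mul (hFs k))]
      refine integral_congr_ae (ae_of_all _ fun y => Finset.sum_congr rfl fun i _ => ?_)
      rw [partialDeriv_mul ((hFs k).differentiable (by simp) y)
        (hζ.contDiff.differentiable (by simp) y)]
    have hFl' := ae_restrict_of_ae (s := Ω) hFl
    have cpd : ∀ k i, Continuous (partialDeriv i (F k)) := fun k i =>
      ((hFs k).continuous_fderiv (by simp)).clm_apply continuous_const
    have lim1 : Tendsto (fun k => ∫ y in Ω, F k y * ζ y * b y) atTop
        (𝓝 (∫ y in Ω, f y * ζ y * b y)) := by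
      refine tendsto_integral_of_dominated_convergence (fun y => |C| * M * ‖b y‖) (fun k => ?_)
        (h.integrableOn_div.norm.const_mul _) (fun k => ae_of_all _ fun y => ?_) ?_
      · exact ((hFs k).continuous.mul hζ.continuous).aestronglyMeasurable.mul
          h.integrableOn_div.1
      · rw [norm_mul, norm_mul]
        refine mul_le_mul_of_nonneg_right ?_ (norm_nonneg _)
        by_cases hy : y ∈ tsupport ζ
        · exact mul_le_mul ((hFb k y hy).1.trans (le_abs_self _)) (hM y) (norm_nonneg _)
            (abs_nonneg _)
        · rw [(hz y hy).1, norm_zero, mul_zero]; positivity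
      · filter_upwards [hFl'] with y hy
        by_cases hyK : y ∈ tsupport ζ
        · exact ((hy hyK).1.mul_const _).mul_const _
        · simp [(hz y hyK).1]
    have lim2 : Tendsto (fun k => ∫ y in Ω, ∑ i, A i y * (F k y * partialDeriv i ζ y +
        ζ y * partialDeriv i (F k) y)) atTop
        (𝓝 (∫ y in Ω, ∑ i, A i y * (f y * partialDeriv i ζ y + ζ y * G y i))) := by
      refine tendsto_integral_of_dominated_convergence
        (fun y => ∑ i, ‖A i y‖ * (|C| * M' i + M * |C|)) (fun k => ?_)
        (integrable_finsetSum _ fun i _ => (h.integrableOn i).norm.mul_const _)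
        (fun k => ae_of_all _ fun y => ?_) ?_
      · refine Finset.aestronglyMeasurable_fun_sum _ fun i _ => (h.integrableOn i).1.mul ?_
        exact (((hFs k).continuous.mul (hζ.partialDeriv i).continuous).add
          (hζ.continuous.mul (cpd k i))).aestronglyMeasurable
      · refine norm_sum_le_of_le _ fun i _ => ?_
        rw [norm_mul]
        refine mul_le_mul_of_nonneg_left ?_ (norm_nonneg _)
        by_cases hy : y ∈ tsupport ζ
        · refine (norm_add_le _ _).trans (add_le_add ?_ ?_)
          · rw [norm_mul]
            exact mul_le_mul ((hFb k y hy).1.trans (le_abs_self _)) (hM' i y) (norm_nonneg _)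
              (abs_nonneg _)
          · rw [norm_mul]
            exact mul_le_mul (hM y) (((hFb k y hy).2 i).trans (le_abs_self _)) (norm_nonneg _) hM0
        · rw [(hz y hy).1, (hz y hy).2, mul_zero, zero_mul, add_zero, norm_zero]
          have := hM0' i
          positivity
      · filter_upwards [hFl'] with y hy
        refine tendsto_finsetSum _ fun i _ => Tendsto.const_mul _ ?_
        by_cases hyK : y ∈ tsupport ζ
        · exact ((hy hyK).1.mul_const _).add (((hy hyK).2 i).const_mul _)
        · simp [(hz y hyK).1, (hz y hyK).2 i]
    have lim := tendsto_nhds_unique (lim2.congr key) lim1.neg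
    have I1 : IntegrableOn (fun y => ζ y * (f y * b y)) Ω :=
      hζ.integrable_mul (integrableOn_mul_of_memLp_top hf.memLp h.integrableOn_div)
    have I2 : IntegrableOn (fun y => ζ y * ∑ i, G y i * A i y) Ω :=
      hζ.integrable_mul (integrable_finsetSum _ fun i _ =>
        integrableOn_mul_of_memLp_top (memLp_coord hf.memLp_grad i) (h.integrableOn i))
    have I3 : IntegrableOn (fun y => ∑ i, f y * A i y * partialDeriv i ζ y) Ω := by
      refine integrable_finsetSum _ fun i _ => ?_
      have := (hζ.partialDeriv i).integrable_mul
        (integrableOn_mul_of_memLp_top hf.memLp (h.integrableOn i))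
      exact Integrable.congr this (ae_of_all _ fun y => mul_comm _ _)
    have e1 : ∫ y in Ω, ∑ i, A i y * (f y * partialDeriv i ζ y + ζ y * G y i) =
        (∫ y in Ω, ∑ i, f y * A i y * partialDeriv i ζ y) +
          ∫ y in Ω, ζ y * ∑ i, G y i * A i y := by
      rw [← integral_add I3 I2]
      refine integral_congr_ae (ae_of_all _ fun y => ?_)
      simp only [Finset.mul_sum, ← Finset.sum_add_distrib]
      exact Finset.sum_congr rfl fun i _ => by ring
    have e2 : ∫ y in Ω, f y * ζ y * b y = ∫ y in Ω, ζ y * (f y * b y) :=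
      integral_congr_ae (ae_of_all _ fun y => by ring)
    have e3 : ∫ y in Ω, ζ y * (f y * b y + ∑ i, G y i * A i y) =
        (∫ y in Ω, ζ y * (f y * b y)) + ∫ y in Ω, ζ y * ∑ i, G y i * A i y := by
      rw [← integral_add I1 I2]
      exact integral_congr_ae (ae_of_all _ fun y => by simp only; ring)
    rw [e3]
    rw [e1, e2] at lim
    linarith

theorem HasWeakDivergence.ae_eq {Ω : Set (Eucl n)} (hΩ : IsOpen Ω) {A : Fin n → Eucl n → ℝ}
    {b b' : Eucl n → ℝ} (h : HasWeakDivergence Ω A b) (h' : HasWeakDivergence Ω A b') :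
    ∀ᵐ y ∂(volume.restrict Ω), b y = b' y := by
  have h0 : ∀ᵐ y, y ∈ Ω → b y - b' y = 0 := by
    refine hΩ.ae_eq_zero_of_integral_contDiff_smul_eq_zero
      ((h.integrableOn_div.sub h'.integrableOn_div).locallyIntegrableOn) fun ζ h1 h2 h3 => ?_
    have hζ : IsTestFunction Ω ζ := ⟨h1, h2, h3⟩
    have e := (h.integral_eq ζ hζ).symm.trans (h'.integral_eq ζ hζ)
    have e1 : ∫ y, ζ y • (b y - b' y) = ∫ y in Ω, ζ y • (b y - b' y) := by
      rw [setIntegral_eq_integral_of_forall_compl_eq_zero]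
      intro y hy
      rw [image_eq_zero_of_notMem_tsupport fun hc => hy (h3 hc), zero_smul]
    rw [e1]
    simp only [smul_eq_mul, mul_sub]
    rw [integral_sub (hζ.integrable_mul h.integrableOn_div) (hζ.integrable_mul h'.integrableOn_div)]
    linarith
  rw [ae_restrict_iff' hΩ.measurableSet]
  filter_upwards [h0] with y hy hyΩ
  exact sub_eq_zero.1 (hy hyΩ)

theorem partialDeriv_comm {ζ : Eucl n → ℝ} (hζ : ContDiff ℝ ∞ ζ) (i k : Fin n) (y : Eucl n) :
    partialDeriv i (partialDeriv k ζ) y = partialDeriv k (partialDeriv i ζ) y := by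
  have hd : DifferentiableAt ℝ (fderiv ℝ ζ) y :=
    ((hζ.fderiv_right (m := ∞) (by simp)).differentiable (by simp)) y
  have hsym : IsSymmSndFDerivAt ℝ ζ y := hζ.contDiffAt.isSymmSndFDerivAt (by simp; exact WithTop.coe_le_coe.2 le_top)
  have e : ∀ v w : Eucl n, fderiv ℝ (fun z => fderiv ℝ ζ z v) y w = fderiv ℝ (fderiv ℝ ζ) y w v := by
    intro v w
    rw [fderiv_clm_apply hd (differentiableAt_const v)]
    simp
  change fderiv ℝ (fun z => fderiv ℝ ζ z (basisVec k)) y (basisVec i) =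
    fderiv ℝ (fun z => fderiv ℝ ζ z (basisVec i)) y (basisVec k)
  rw [e, e]
  exact hsym.eq _ _

theorem HasSobolevGradient.integrableOn {Ω : Set (Eucl n)} {p : ℝ≥0∞} (hp : 1 ≤ p)
    (hΩ : volume Ω ≠ ⊤) {u : Eucl n → ℝ} {G : Eucl n → Eucl n}
    (h : HasSobolevGradient Ω p u G) : IntegrableOn u Ω ∧ ∀ i, IntegrableOn (fun y => G y i) Ω := by
  have : IsFiniteMeasure (volume.restrict Ω) := isFiniteMeasure_restrict.2 hΩ
  exact ⟨h.memLp.integrable hp, fun i => (memLp_coord h.memLp_grad i).integrable hp⟩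

theorem integrableOn_of_memLp {Ω : Set (Eucl n)} {p : ℝ≥0∞} (hp : 1 ≤ p)
    (hΩ : volume Ω ≠ ⊤) {u : Eucl n → ℝ} (h : MemLp u p (volume.restrict Ω)) :
    IntegrableOn u Ω := by
  have : IsFiniteMeasure (volume.restrict Ω) := isFiniteMeasure_restrict.2 hΩ
  exact h.integrable hp

/-- `u eₖ` has weak divergence `∂ₖ u`. -/
theorem HasSobolevGradient.hasWeakDivergence {Ω : Set (Eucl n)} {p : ℝ≥0∞} (hp : 1 ≤ p)
    (hΩ : volume Ω ≠ ⊤) {u : Eucl n → ℝ} {G : Eucl n → Eucl n}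
    (h : HasSobolevGradient Ω p u G) (k : Fin n) :
    HasWeakDivergence Ω (fun i y => if i = k then u y else 0) (fun y => G y k) where
  integrableOn i := by
    by_cases hi : i = k
    · simpa [hi] using (h.integrableOn hp hΩ).1
    · simp [hi]
  integrableOn_div := (h.integrableOn hp hΩ).2 k
  integral_eq ζ hζ := by
    rw [← h.integral_eq ζ hζ k]
    simp

/-- The vector part of the main Vekua equation, in divergence form. -/
theorem IsMainVekuaSolution.hasWeakDivergence {Ω : Set (Eucl n)} {p : ℝ≥0∞} (hp : 1 ≤ p)
    (hΩ : volume Ω ≠ ⊤) {f : Eucl n → ℝ} {gradf : Eucl n → Eucl n}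
    (hf : HasSobolevGradient Ω ⊤ f gradf) (hc : ∃ c > 0, ∀ᵐ y ∂(volume.restrict Ω), c ≤ |f y|)
    {w : Eucl n → Cl n} (hw : IsMainVekuaSolution Ω p f gradf w) (k : Fin n) :
    HasWeakDivergence Ω (fun i y => bivectorDual k i (w y))
      (fun y => ∑ i, (f y)⁻¹ * gradf y i * bivectorDual i k (w y)) where
  integrableOn i := integrableOn_of_memLp hp hΩ (hw.memLp _)
  integrableOn_div := by
    obtain ⟨c, hc, hfc⟩ := hc
    refine integrable_finsetSum _ fun i _ => ?_
    have h1 : IntegrableOn (fun y => gradf y i * bivectorDual i k (w y)) Ω :=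
      integrableOn_mul_of_memLp_top (memLp_coord hf.memLp_grad i)
        (integrableOn_of_memLp hp hΩ (hw.memLp _))
    have h2 : IntegrableOn (fun y => (f y)⁻¹ * (gradf y i * bivectorDual i k (w y))) Ω := by
      refine h1.bdd_mul (c := c⁻¹) hf.memLp.1.aemeasurable.inv.aestronglyMeasurable ?_
      filter_upwards [hfc] with y hy
      rw [norm_inv]
      exact inv_anti₀ hc hy
    exact Integrable.congr h2 (ae_of_all _ fun y => (mul_assoc _ _ _).symm)
  integral_eq ζ hζ := by
    -- The functional `a ↦ Sc(eₖ a)` extracts the `k`-th vector component, up to sign, of the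
    -- equation.
    have h := hw.equation ζ hζ (scalarPartDual n ∘ₗ LinearMap.mulLeft ℝ (cliffordGen k))
    have e1 : ∀ y i, (scalarPartDual n ∘ₗ LinearMap.mulLeft ℝ (cliffordGen k))
        (cliffordGen i * w y) = bivectorDual k i (w y) := fun y i =>
      (bivectorDual_apply k i (w y)).symm
    have e2 : ∀ y, (scalarPartDual n ∘ₗ LinearMap.mulLeft ℝ (cliffordGen k))
        (cliffordVec ((f y)⁻¹ • gradf y) * star (w y)) =
        ∑ i, (f y)⁻¹ * gradf y i * bivectorDual i k (w y) := by
      intro y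
      rw [cliffordVec, Finset.sum_mul, map_sum]
      refine Finset.sum_congr rfl fun i _ => ?_
      rw [← bivectorDual_star k i, bivectorDual_apply, smul_mul_assoc, map_smul, smul_eq_mul]
      rfl
    simp only [e1, e2] at h
    rw [← h, neg_neg, integral_finsetSum]
    · simp only [mul_comm]
    · intro i _
      have := (hζ.partialDeriv i).integrable_mul
        (integrableOn_of_memLp hp hΩ (hw.memLp (bivectorDual k i)))
      exact Integrable.congr this (ae_of_all _ fun y => mul_comm _ _)

/-- The quotient `u₀ = Sc(w) / f` satisfies the conductivity equation `div(f² ∇u₀) = 0`, here in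
the form `Δu₀ = -2 (∇f / f) · ∇u₀`. -/
theorem IsMainVekuaSolution.laplacian_eq {Ω : Set (Eucl n)} {p : ℝ≥0∞} (hp : 1 ≤ p)
    (hΩo : IsOpen Ω)
    (hΩ : volume Ω ≠ ⊤) {f : Eucl n → ℝ} {gradf : Eucl n → Eucl n}
    (hf : HasSobolevGradient Ω ⊤ f gradf) (hc : ∃ c > 0, ∀ᵐ y ∂(volume.restrict Ω), c ≤ |f y|)
    {w : Eucl n → Cl n} (hw : IsMainVekuaSolution Ω p f gradf w)
    {u₀ : Eucl n → ℝ} (hu₀ : ∀ᵐ y ∂(volume.restrict Ω), u₀ y = scalarPart (w y) / f y)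
    {gradu₀ : Eucl n → Eucl n} (hgradu₀ : HasSobolevGradient Ω 1 u₀ gradu₀) {d : Eucl n → ℝ}
    (hd : HasWeakDivergence Ω (fun i y => gradu₀ y i) d) :
    ∀ᵐ y ∂(volume.restrict Ω), d y = -2 * inner ℝ ((f y)⁻¹ • gradf y) (gradu₀ y) := by
  have hf0 : ∀ᵐ y ∂(volume.restrict Ω), f y ≠ 0 := by
    obtain ⟨c, hc, hfc⟩ := hc
    filter_upwards [hfc] with y hy h0
    rw [h0, abs_zero] at hy
    linarith
  have hw0 : ∀ᵐ y ∂(volume.restrict Ω), scalarPart (w y) = f y * u₀ y := by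
    filter_upwards [hu₀, hf0] with y h1 h2
    rw [h1, mul_div_cancel₀ _ h2]
  have hV := fun k => (hw.hasWeakDivergence hp hΩ hf hc k).mul hΩo hf
  have hU := fun k => ((hgradu₀.hasWeakDivergence le_rfl hΩ k).mul hΩo hf).mul hΩo hf
  have hD := (hd.mul hΩo hf).mul hΩo hf
  -- The claim is `div(f² ∇u₀) = 0`. It is obtained by testing the first-order identities `hV k` and
  -- `hU k` with `∂ₖξ` and summing over `k`.
  have h0 : HasWeakDivergence Ω (fun i y => f y * (f y * gradu₀ y i)) (fun _ => 0) := by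
    refine ⟨hD.integrableOn, integrableOn_zero, fun ξ hξ => ?_⟩
    simp only [mul_zero, integral_zero, neg_zero]
    have hVs : ∑ k, ∫ y in Ω, ∑ i, f y * bivectorDual k i (w y) *
        partialDeriv i (partialDeriv k ξ) y =
        ∑ k, -∫ y in Ω, partialDeriv k ξ y * (-2 * gradf y k * (f y * u₀ y)) := by
      refine Finset.sum_congr rfl fun k _ => ?_
      rw [(hV k).integral_eq _ (hξ.partialDeriv k)]
      congr 1
      refine integral_congr_ae ?_
      filter_upwards [hf0, hw0] with y h1 h2
      congr 1
      -- The sum is `∂ᵢf (Bᵢₖ + Bₖᵢ)`, so antisymmetry leaves only the diagonal entry `-2 (∂ₖf) w₀`.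
      have e : ∀ i, f y * ((f y)⁻¹ * gradf y i * bivectorDual i k (w y)) +
          gradf y i * bivectorDual k i (w y) =
          if i = k then -2 * gradf y k * (f y * u₀ y) else 0 := by
        intro i
        rw [← mul_assoc, ← mul_assoc, mul_inv_cancel₀ h1, one_mul, ← mul_add]
        split_ifs with hik
        · rw [hik, bivectorDual_self, h2]; ring
        · rw [bivectorDual_comm hik]; ring
      rw [Finset.mul_sum, ← Finset.sum_add_distrib, Finset.sum_congr rfl fun i _ => e i]
      simp
    have hUs : ∑ k, ∫ y in Ω, ∑ i, f y * (f y * if i = k then u₀ y else 0) *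
        partialDeriv i (partialDeriv k ξ) y =
        ∑ k, -∫ y in Ω, partialDeriv k ξ y *
          (f y * (f y * gradu₀ y k) + 2 * gradf y k * (f y * u₀ y)) := by
      refine Finset.sum_congr rfl fun k _ => ?_
      rw [(hU k).integral_eq _ (hξ.partialDeriv k)]
      congr 1
      refine integral_congr_ae (ae_of_all _ fun y => ?_)
      simp only [mul_ite, mul_zero, Finset.sum_ite_eq', Finset.mem_univ, if_true]
      ring
    have iA : ∀ {g : Fin n → Fin n → Eucl n → ℝ}, (∀ k i, IntegrableOn (g k i) Ω) →
        ∀ k ∈ Finset.univ, Integrable (fun y => ∑ i, g k i y *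
          partialDeriv i (partialDeriv k ξ) y) (volume.restrict Ω) := by
      intro g hg k _
      refine integrable_finsetSum _ fun i _ => ?_
      exact Integrable.congr (((hξ.partialDeriv k).partialDeriv i).integrable_mul (hg k i))
        (ae_of_all _ fun y => mul_comm _ _)
    -- Since the diagonal of `B` is `-w₀ = -f u₀`, the matrix `f B + f² u₀ · Id` is antisymmetric,
    -- and its contraction with the Hessian of `ξ` vanishes.
    have hVU : ∑ k, ∫ y in Ω, ∑ i, f y * bivectorDual k i (w y) *
        partialDeriv i (partialDeriv k ξ) y =
        -∑ k, ∫ y in Ω, ∑ i, f y * (f y * if i = k then u₀ y else 0) *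
        partialDeriv i (partialDeriv k ξ) y := by
      rw [← integral_finsetSum _ (iA fun k i => (hV k).integrableOn i),
        ← integral_finsetSum _ (iA fun k i => (hU k).integrableOn i), ← integral_neg]
      refine integral_congr_ae ?_
      filter_upwards [hw0] with y h2
      have hsw : ∑ k, ∑ i, (f y * bivectorDual k i (w y) +
          f y * (f y * if i = k then u₀ y else 0)) * partialDeriv i (partialDeriv k ξ) y = 0 := by
        have hanti : ∀ k i, f y * bivectorDual k i (w y) +
            f y * (f y * if i = k then u₀ y else 0) =
            -(f y * bivectorDual i k (w y) + f y * (f y * if k = i then u₀ y else 0)) := by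
          intro k i
          by_cases hki : k = i
          · subst hki
            simp only [bivectorDual_self, h2, if_true]; ring
          · rw [bivectorDual_comm hki, if_neg hki, if_neg (Ne.symm hki)]; ring
        have : ∀ S : ℝ, S = -S → S = 0 := fun S h => by linarith
        apply this
        conv_lhs => rw [Finset.sum_comm]
        rw [← Finset.sum_neg_distrib]
        refine Finset.sum_congr rfl fun k _ => ?_
        rw [← Finset.sum_neg_distrib]
        refine Finset.sum_congr rfl fun i _ => ?_
        rw [hanti, partialDeriv_comm hξ.contDiff]; ring
      simp only [add_mul, Finset.sum_add_distrib] at hsw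
      linarith
    have hI1 : ∀ k, IntegrableOn (fun y => partialDeriv k ξ y * (f y * (f y * gradu₀ y k))) Ω :=
      fun k => (hξ.partialDeriv k).integrable_mul (hD.integrableOn k)
    have hI2 : ∀ k, IntegrableOn
        (fun y => partialDeriv k ξ y * (2 * gradf y k * (f y * u₀ y))) Ω := by
      intro k
      refine (hξ.partialDeriv k).integrable_mul ?_
      have := (integrableOn_mul_of_memLp_top (memLp_coord hf.memLp_grad k)
        (integrableOn_mul_of_memLp_top hf.memLp (hgradu₀.integrableOn le_rfl hΩ).1)).const_mul 2
      exact Integrable.congr this (ae_of_all _ fun y => (mul_assoc _ _ _).symm)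
    have fin : ∑ k, ∫ y in Ω, partialDeriv k ξ y * (f y * (f y * gradu₀ y k)) = 0 := by
      rw [hVs, hUs] at hVU
      have e1 : ∀ k, ∫ y in Ω, partialDeriv k ξ y *
          (f y * (f y * gradu₀ y k) + 2 * gradf y k * (f y * u₀ y)) =
          (∫ y in Ω, partialDeriv k ξ y * (f y * (f y * gradu₀ y k))) +
          ∫ y in Ω, partialDeriv k ξ y * (2 * gradf y k * (f y * u₀ y)) := by
        intro k
        rw [← integral_add (hI1 k) (hI2 k)]
        simp only [mul_add]
      have e2 : ∀ k, ∫ y in Ω, partialDeriv k ξ y * (-2 * gradf y k * (f y * u₀ y)) =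
          -∫ y in Ω, partialDeriv k ξ y * (2 * gradf y k * (f y * u₀ y)) := by
        intro k
        rw [← integral_neg]
        exact integral_congr_ae (ae_of_all _ fun y => by simp only; ring)
      simp only [e1, e2, neg_neg, neg_add, Finset.sum_add_distrib, Finset.sum_neg_distrib] at hVU
      linarith
    rw [← fin, ← integral_finsetSum _ fun k _ => hI1 k]
    simp only [mul_comm]
  -- `f² ∇u₀` has two weak divergences, `f² d + 2 f ∇f·∇u₀` from the product rule and `0` from the
  -- equation. Equating them and dividing by `f²` gives `d`.
  filter_upwards [hD.ae_eq hΩo h0, hf0] with y hy h1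
  have e : (inner ℝ (gradf y) (gradu₀ y) : ℝ) = ∑ i, gradf y i * gradu₀ y i := by
    rw [PiLp.inner_apply]
    exact Finset.sum_congr rfl fun i _ => by simp [mul_comm]
  have e2 : ∑ i, gradf y i * (f y * gradu₀ y i) = f y * ∑ i, gradf y i * gradu₀ y i := by
    rw [Finset.mul_sum]
    exact Finset.sum_congr rfl fun i _ => by ring
  rw [real_inner_smul_left, e]
  rw [e2] at hy
  field_simp
  have : f y * (d y * f y - -(2 * ∑ i, gradf y i * gradu₀ y i)) = 0 := by linarith
  have := (mul_eq_zero.1 this).resolve_left h1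
  linarith

/-- Controls the change of the area element when the slope moves by at most `δ`. It suffices that
both `1` and `‖b‖` are at most `√(1 + ‖b‖²)`. -/
theorem sqrt_one_add_sq_le {W : Type*} [NormedAddCommGroup W] {δ : ℝ} {a b : W} (h : ‖a - b‖ ≤ δ) :
    √(1 + ‖a‖ ^ 2) ≤ (1 + δ) * √(1 + ‖b‖ ^ 2) := by
  have hδ : 0 ≤ δ := (norm_nonneg _).trans h
  have h1 : ‖a‖ ≤ ‖b‖ + δ := by
    have := norm_le_norm_add_norm_sub b a
    rw [norm_sub_rev] at this
    linarith
  have hb : ‖b‖ ≤ √(1 + ‖b‖ ^ 2) := Real.le_sqrt_of_sq_le (by linarith)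
  have h1' : 1 ≤ √(1 + ‖b‖ ^ 2) := Real.le_sqrt_of_sq_le (by nlinarith [sq_nonneg ‖b‖])
  have hs := Real.sq_sqrt (show (0 : ℝ) ≤ 1 + ‖b‖ ^ 2 by positivity)
  set s := √(1 + ‖b‖ ^ 2)
  refine Real.sqrt_le_iff.2 ⟨by positivity, ?_⟩
  nlinarith [norm_nonneg a, norm_nonneg b, mul_nonneg hδ (sub_nonneg.2 h1'),
    mul_nonneg hδ (sub_nonneg.2 hb), mul_nonneg (mul_nonneg hδ hδ) (sub_nonneg.2 h1')]

end WeakDivergence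

/-! ### Area formula for graphs of Lipschitz functions. -/

section Area

variable {W : Type*} [NormedAddCommGroup W] [InnerProductSpace ℝ W]

/-- A linear map with `‖S v‖² = ‖v‖² + ⟪a, v⟫²`. -/
noncomputable def graphStretch (a : W) : W →L[ℝ] W :=
  ContinuousLinearMap.id ℝ W +
    (1 + √(1 + ‖a‖ ^ 2))⁻¹ • (innerSL ℝ a).smulRight a

theorem graphStretch_apply (a v : W) :
    graphStretch a v = v + ((1 + √(1 + ‖a‖ ^ 2))⁻¹ * inner ℝ a v) • a := by
  simp [graphStretch, smul_smul]

/-- The coefficient `c = (1 + √(1 + ‖a‖²))⁻¹` is chosen to satisfy `2c + c²‖a‖² = 1`. Thus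
`graphStretch a` reproduces, inside `W`, the metric of the graph of the linear function with slope
`a`. -/
theorem norm_graphStretch_sq (a v : W) :
    ‖graphStretch a v‖ ^ 2 = ‖v‖ ^ 2 + inner ℝ a v ^ 2 := by
  rw [graphStretch_apply, norm_add_sq_real, norm_smul, real_inner_smul_right, mul_pow,
    Real.norm_eq_abs, sq_abs, real_inner_comm]
  have h := Real.sq_sqrt (show (0 : ℝ) ≤ 1 + ‖a‖ ^ 2 by positivity)
  set s := √(1 + ‖a‖ ^ 2)
  have hs : 0 ≤ s := Real.sqrt_nonneg _
  have ha : ‖a‖ ^ 2 = s ^ 2 - 1 := by linarith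
  rw [ha]
  field_simp
  ring

/-- A rank-one perturbation of the identity has determinant `1` plus its trace. With `s = √(1 +
‖a‖²)` this is `1 + (s² - 1)/(1 + s) = s`. -/
theorem det_graphStretch (a : W) [FiniteDimensional ℝ W] :
    LinearMap.det (graphStretch a : W →ₗ[ℝ] W) = √(1 + ‖a‖ ^ 2) := by
  have : (graphStretch a : W →ₗ[ℝ] W) = LinearMap.transvection
      ((1 + √(1 + ‖a‖ ^ 2))⁻¹ • (innerSL ℝ a : W →ₗ[ℝ] ℝ)) a := by
    ext v
    simp [graphStretch_apply, LinearMap.transvection]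
  rw [this, LinearMap.transvection.det]
  have h := Real.sq_sqrt (show (0 : ℝ) ≤ 1 + ‖a‖ ^ 2 by positivity)
  have hs : 0 ≤ √(1 + ‖a‖ ^ 2) := Real.sqrt_nonneg _
  simp only [LinearMap.smul_apply, ContinuousLinearMap.coe_coe, innerSL_apply_apply,
    real_inner_self_eq_norm_sq, smul_eq_mul]
  field_simp
  linarith

theorem norm_le_norm_graphStretch (a v : W) : ‖v‖ ≤ ‖graphStretch a v‖ := by
  refine (sq_le_sq₀ (norm_nonneg _) (norm_nonneg _)).1 ?_
  rw [norm_graphStretch_sq]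
  nlinarith [sq_nonneg (inner ℝ a v : ℝ)]

/-- The hypothesis makes `g ∘ f⁻¹` well defined and `K`-Lipschitz on `f '' P`: points identified by
`f` are also identified by `g`. -/
theorem euclideanHausdorffMeasure_image_le {X Y Z : Type*} [MetricSpace X] [MetricSpace Y]
    [MetricSpace Z] [MeasurableSpace Y] [BorelSpace Y] [MeasurableSpace Z] [BorelSpace Z]
    (f : X → Y) (g : X → Z) (P : Set X) (K : ℝ≥0)
    (h : ∀ x ∈ P, ∀ y ∈ P, dist (g x) (g y) ≤ K * dist (f x) (f y)) (d : ℕ) :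
    Measure.euclideanHausdorffMeasure d (g '' P) ≤
      (K : ℝ≥0∞) ^ d * Measure.euclideanHausdorffMeasure d (f '' P) := by
  rcases P.eq_empty_or_nonempty with rfl | ⟨x₀, hx₀⟩
  · simp
  have : Nonempty X := ⟨x₀⟩
  have hL : LipschitzOnWith K (fun y => g (Function.invFunOn f P y)) (f '' P) := by
    refine LipschitzOnWith.of_dist_le_mul fun y hy z hz => ?_
    have h1 := Function.invFunOn_mem hy
    have h2 := Function.invFunOn_mem hz
    have h3 := h _ h1 _ h2
    rwa [Function.invFunOn_eq hy, Function.invFunOn_eq hz] at h3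
  have himg : (fun y => g (Function.invFunOn f P y)) '' (f '' P) = g '' P := by
    rw [image_image]
    refine image_congr fun x hx => ?_
    have hfx : f x ∈ f '' P := mem_image_of_mem f hx
    have h3 := h _ (Function.invFunOn_mem hfx) _ hx
    rw [Function.invFunOn_eq hfx, dist_self, mul_zero] at h3
    exact dist_le_zero.1 h3
  have := hL.hausdorffMeasure_image_le (d := d) (Nat.cast_nonneg d)
  rw [himg, ENNReal.rpow_natCast] at this
  simp only [Measure.euclideanHausdorffMeasure_def, Measure.smul_apply]
  rw [mul_smul_comm]
  exact smul_le_smul_of_nonneg_left this zero_le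

variable [FiniteDimensional ℝ W] [MeasurableSpace W] [BorelSpace W]

theorem euclideanHausdorffMeasure_graphStretch_image (a : W) (P : Set W) :
    Measure.euclideanHausdorffMeasure (Module.finrank ℝ W) (graphStretch a '' P) =
      ENNReal.ofReal √(1 + ‖a‖ ^ 2) * volume P := by
  rw [InnerProductSpace.euclideanHausdorffMeasure_eq_volume,
    Measure.addHaar_image_continuousLinearMap]
  congr 2
  change |LinearMap.det (graphStretch a : W →ₗ[ℝ] W)| = _
  rw [det_graphStretch, abs_of_nonneg (Real.sqrt_nonneg _)]

variable {E : Type*} [MetricSpace E] [MeasurableSpace E] [BorelSpace E]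

/-- `F` embeds `W` isometrically as the graph of `γ`. -/
def IsGraphMap (γ : W → ℝ) (F : W → E) : Prop :=
  ∀ x y, dist (F x) (F y) ^ 2 = ‖x - y‖ ^ 2 + (γ x - γ y) ^ 2

variable {γ : W → ℝ} {F : W → E}

/-- Where `γ` is nearly linear with slope `a`, the graph map is nearly isometric to `graphStretch
a`. The squares of the two lengths differ by `p² - q²`, where `p` and `q` are the actual and
linearised height differences. As `|p|` and `|q|` are bounded by the respective lengths, a factor `D
+ S` cancels. -/
theorem IsGraphMap.dist_stretch (hF : IsGraphMap γ F) {δ : ℝ} (hδ0 : 0 ≤ δ) {a x y : W}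
    (h : |γ x - γ y - inner ℝ a (x - y)| ≤ δ * ‖x - y‖) :
    dist (F x) (F y) ≤ (1 + δ) * ‖graphStretch a (x - y)‖ ∧
      (1 - δ) * ‖graphStretch a (x - y)‖ ≤ dist (F x) (F y) := by
  have h1 := hF x y
  have h2 := norm_graphStretch_sq a (x - y)
  have h3 := norm_le_norm_graphStretch a (x - y)
  set S := ‖graphStretch a (x - y)‖
  set D := dist (F x) (F y)
  set N := ‖x - y‖
  have hN : 0 ≤ N := norm_nonneg _
  have hD : 0 ≤ D := dist_nonneg
  have hS : 0 ≤ S := norm_nonneg _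
  set p := γ x - γ y
  set q : ℝ := inner ℝ a (x - y)
  have hpS : |p| ≤ D := abs_le_of_sq_le_sq (by nlinarith) hD
  have hqS : |q| ≤ S := abs_le_of_sq_le_sq (by nlinarith) hS
  -- |D - S| (D + S) = |p² - q²| ≤ |p - q| (|p| + |q|)
  have h4 : |D - S| * (D + S) ≤ δ * S * (D + S) := by
    have e : |D - S| * (D + S) = |p - q| * |p + q| := by
      have e' : (D - S) * (D + S) = (p - q) * (p + q) := by nlinarith
      rw [← abs_mul, ← e', abs_mul, abs_of_nonneg (add_nonneg hD hS)]
    rw [e]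
    exact mul_le_mul (h.trans (mul_le_mul_of_nonneg_left h3 hδ0))
      ((abs_add_le _ _).trans (add_le_add hpS hqS)) (abs_nonneg _) (by positivity)
  have h5 : |D - S| ≤ δ * S := by
    rcases (add_nonneg hD hS).eq_or_lt with h0 | h0
    · have hD0 : D = 0 := by linarith
      have hS0 : S = 0 := by linarith
      rw [hD0, hS0]; simp
    · exact le_of_mul_le_mul_right h4 h0
  rw [abs_le] at h5
  constructor <;> nlinarith [h5.1, h5.2]

/-- The gradient as an element of the space. -/
theorem measurable_gradient_of_real (γ : W → ℝ) : Measurable (gradient γ) :=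
  (InnerProductSpace.toDual ℝ W).symm.continuous.measurable.comp (measurable_fderiv ℝ γ)

theorem inner_gradient (γ : W → ℝ) (x v : W) : inner ℝ (gradient γ x) v = fderiv ℝ γ x v := by
  simp [gradient]

/-- Countable partition of the differentiability set of `γ` into pieces on which `γ` is almost
linear and its gradient almost constant. -/
theorem exists_partition_gradient (γ : W → ℝ) {δ : ℝ} (hδ : 0 < δ) :
    ∃ (P : ℕ × ℕ → Set W) (a : ℕ × ℕ → W), (∀ i, MeasurableSet (P i)) ∧
      Pairwise (Function.onFun Disjoint P) ∧ {x | DifferentiableAt ℝ γ x} ⊆ ⋃ i, P i ∧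
      (∀ i, ∀ x ∈ P i, ∀ y ∈ P i, |γ x - γ y - inner ℝ (a i) (x - y)| ≤ δ * ‖x - y‖) ∧
      ∀ i, ∀ x ∈ P i, ‖gradient γ x - a i‖ ≤ δ := by
  let c := TopologicalSpace.denseSeq W
  let D₀ : ℕ → Set W := fun j => {x | ‖gradient γ x - c j‖ < δ / 2}
  let D : ℕ → Set W := disjointed D₀
  have hDm : ∀ j, MeasurableSet (D j) := MeasurableSet.disjointed fun j =>
    measurableSet_lt ((measurable_gradient_of_real γ).sub_const _).norm measurable_const
  have hDc : ⋃ j, D j = univ := by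
    rw [iUnion_disjointed, eq_univ_iff_forall]
    intro x
    obtain ⟨y, hy, j, rfl⟩ := Metric.dense_iff.1 (TopologicalSpace.denseRange_denseSeq W)
      (gradient γ x) (δ / 2) (by positivity)
    refine mem_iUnion.2 ⟨j, ?_⟩
    rw [Metric.mem_ball, dist_comm, dist_eq_norm] at hy
    exact hy
  let s : ℕ → Set W := fun j => {x | DifferentiableAt ℝ γ x} ∩ D j
  have hsm : ∀ j, MeasurableSet (s j) := fun j =>
    (measurableSet_of_differentiableAt ℝ γ).inter (hDm j)
  have hr : (⟨δ / 2, by positivity⟩ : ℝ≥0) ≠ 0 := by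
    intro h
    have : δ / 2 = 0 := congrArg NNReal.toReal h
    linarith
  -- One half of `δ` pays for approximating `γ` by its derivative at some point of `s j`, the other
  -- half for replacing that derivative by the fixed slope `c j`.
  choose t A ht1 ht2 ht3 ht4 ht5 using fun j =>
    exists_partition_approximatesLinearOn_of_hasFDerivWithinAt γ (s j) (fderiv ℝ γ)
      (fun x hx => (DifferentiableAt.hasFDerivAt hx.1).hasFDerivWithinAt)
      (fun _ => ⟨δ / 2, by positivity⟩) (fun _ => hr)
  have hDlt : ∀ j, ∀ x ∈ s j, ‖gradient γ x - c j‖ < δ / 2 := fun j x hx =>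
    disjointed_subset D₀ j hx.2
  refine ⟨fun i => s i.1 ∩ t i.1 i.2, fun i => c i.1, fun i => (hsm _).inter (ht2 _ _), ?_, ?_, ?_,
    ?_⟩
  · rintro ⟨j, m⟩ ⟨j', m'⟩ hne
    by_cases hj : j = j'
    · subst hj
      have hm : m ≠ m' := fun h => hne (by rw [h])
      exact (ht1 j hm).mono inter_subset_right inter_subset_right
    · exact (disjoint_disjointed _ hj).mono (inter_subset_left.trans inter_subset_right)
        (inter_subset_left.trans inter_subset_right)
  · intro x hx
    obtain ⟨j, hj⟩ := mem_iUnion.1 (hDc.symm ▸ mem_univ x : x ∈ ⋃ j, D j)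
    obtain ⟨m, hm⟩ := mem_iUnion.1 (ht3 j ⟨hx, hj⟩)
    exact mem_iUnion.2 ⟨(j, m), ⟨hx, hj⟩, hm⟩
  · rintro ⟨j, m⟩ x hx y hy
    have h1 := ht4 j m x hx y hy
    obtain ⟨z, hz, hAz⟩ := ht5 j ⟨x, hx.1⟩ m
    have h2 : A j m (x - y) = inner ℝ (gradient γ z) (x - y) := by rw [hAz, inner_gradient]
    have h3 : |inner ℝ (gradient γ z - c j) (x - y)| ≤ δ / 2 * ‖x - y‖ :=
      (abs_real_inner_le_norm _ _).trans
        (mul_le_mul_of_nonneg_right (hDlt j z hz).le (norm_nonneg _))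
    rw [inner_sub_left] at h3
    rw [h2, Real.norm_eq_abs] at h1
    have h1' : |γ x - γ y - inner ℝ (gradient γ z) (x - y)| ≤ δ / 2 * ‖x - y‖ := h1
    rw [abs_le] at *
    constructor <;> linarith [h1'.1, h1'.2, h3.1, h3.2]
  · rintro ⟨j, m⟩ x hx
    linarith [hDlt j x hx.1]

theorem IsGraphMap.lipschitzWith {K : ℝ≥0} (hF : IsGraphMap γ F) (hγ : LipschitzWith K γ) :
    LipschitzWith (1 + K) F := by
  refine LipschitzWith.of_dist_le_mul fun x y => abs_le_of_sq_le_sq' ?_ (by positivity) |>.2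
  rw [hF x y]
  have h := hγ.dist_le_mul x y
  rw [Real.dist_eq] at h
  have h1 : (γ x - γ y) ^ 2 ≤ (K * dist x y) ^ 2 := sq_le_sq.2 (h.trans (le_abs_self _))
  rw [← dist_eq_norm]
  push_cast
  nlinarith [mul_nonneg (NNReal.coe_nonneg K) (sq_nonneg (dist x y))]

theorem IsGraphMap.injective (hF : IsGraphMap γ F) : Function.Injective F := by
  intro x y hxy
  have := hF x y
  rw [hxy, dist_self] at this
  have h : ‖x - y‖ ^ 2 = 0 := by nlinarith [sq_nonneg (γ x - γ y), sq_nonneg ‖x - y‖]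
  exact sub_eq_zero.1 (norm_eq_zero.1 (pow_eq_zero_iff two_ne_zero |>.1 h))

theorem IsGraphMap.measurableEmbedding {K : ℝ≥0} (hF : IsGraphMap γ F) (hγ : LipschitzWith K γ) :
    MeasurableEmbedding F :=
  (hF.lipschitzWith hγ).continuous.measurableEmbedding hF.injective

/-- The area element of the graph of `γ`. -/
noncomputable def areaElement (γ : W → ℝ) (x : W) : ℝ≥0∞ :=
  ENNReal.ofReal √(1 + ‖gradient γ x‖ ^ 2)

theorem measurable_areaElement (γ : W → ℝ) : Measurable (areaElement γ) :=
  (((measurable_gradient_of_real γ).norm.pow_const 2).const_add 1).sqrt.ennreal_ofReal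

/-- Comparison with `graphStretch a '' P`, whose measure is known from the determinant. The
distortion of distances costs `(1 + 2δ)^d` and freezing the slope costs one more factor, hence the
exponent `d + 1`. The bound `δ ≤ 1/2` gives `(1 - δ)(1 + 2δ) ≥ 1`. -/
theorem IsGraphMap.piece_estimate (hF : IsGraphMap γ F) {δ : ℝ}
    (hδ : 0 < δ) (hδ' : δ ≤ 1 / 2) {P : Set W} {a : W}
    (h1 : ∀ x ∈ P, ∀ y ∈ P, |γ x - γ y - inner ℝ a (x - y)| ≤ δ * ‖x - y‖)
    (h2 : ∀ x ∈ P, ‖gradient γ x - a‖ ≤ δ) :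
    Measure.euclideanHausdorffMeasure (Module.finrank ℝ W) (F '' P) ≤
        ENNReal.ofReal ((1 + 2 * δ) ^ (Module.finrank ℝ W + 1)) * ∫⁻ x in P, areaElement γ x ∧
      ∫⁻ x in P, areaElement γ x ≤ ENNReal.ofReal ((1 + 2 * δ) ^ (Module.finrank ℝ W + 1)) *
        Measure.euclideanHausdorffMeasure (Module.finrank ℝ W) (F '' P) := by
  set d := Module.finrank ℝ W
  have hκ : ENNReal.ofReal ((1 + 2 * δ) ^ (d + 1)) =
      ((1 + 2 * δ).toNNReal : ℝ≥0∞) ^ d * ENNReal.ofReal (1 + 2 * δ) := by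
    rw [ENNReal.ofReal_pow (by positivity), pow_succ]; rfl
  have hcoe : ((1 + 2 * δ).toNNReal : ℝ) = 1 + 2 * δ := Real.coe_toNNReal _ (by positivity)
  have hS := euclideanHausdorffMeasure_graphStretch_image a P
  have hup := euclideanHausdorffMeasure_image_le (graphStretch a) F P (1 + 2 * δ).toNNReal
    (fun x hx y hy => by
      rw [hcoe, dist_eq_norm, ← map_sub]
      refine (hF.dist_stretch hδ.le (h1 x hx y hy)).1.trans ?_
      exact mul_le_mul_of_nonneg_right (by linarith) (norm_nonneg _)) d
  have hlow := euclideanHausdorffMeasure_image_le F (graphStretch a) P (1 + 2 * δ).toNNReal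
    (fun x hx y hy => by
      rw [hcoe, dist_eq_norm, ← map_sub]
      have := (hF.dist_stretch hδ.le (h1 x hx y hy)).2
      have h0 := norm_nonneg (graphStretch a (x - y))
      nlinarith [mul_nonneg hδ.le h0, mul_nonneg (mul_nonneg hδ.le h0) (sub_nonneg.2 hδ')]) d
  rw [hS] at hup hlow
  constructor
  · rw [hκ, mul_assoc]
    refine hup.trans (mul_le_mul_right ?_ _)
    rw [← lintegral_const_mul _ (measurable_areaElement γ), ← setLIntegral_const]
    refine setLIntegral_mono ((measurable_areaElement γ).const_mul _) fun x hx => ?_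
    rw [areaElement, ← ENNReal.ofReal_mul (by positivity)]
    refine ENNReal.ofReal_le_ofReal ((sqrt_one_add_sq_le (δ := δ) (b := gradient γ x) ?_).trans ?_)
    · rw [norm_sub_rev]; exact h2 x hx
    · exact mul_le_mul_of_nonneg_right (by linarith) (Real.sqrt_nonneg _)
  · rw [hκ, mul_comm (_ ^ d), mul_assoc]
    refine le_trans ?_ (mul_le_mul_right hlow _)
    rw [← mul_assoc, ← ENNReal.ofReal_mul (by positivity), ← setLIntegral_const]
    refine setLIntegral_mono measurable_const fun x hx => ?_
    refine ENNReal.ofReal_le_ofReal ((sqrt_one_add_sq_le (h2 x hx)).trans ?_)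
    exact mul_le_mul_of_nonneg_right (by linarith) (Real.sqrt_nonneg _)

/-- Area formula for the graph of a Lipschitz function. -/
theorem IsGraphMap.euclideanHausdorffMeasure_image {K : ℝ≥0} (hF : IsGraphMap γ F)
    (hγ : LipschitzWith K γ) {A : Set W} (hA : MeasurableSet A) :
    Measure.euclideanHausdorffMeasure (Module.finrank ℝ W) (F '' A) =
      ∫⁻ x in A, areaElement γ x := by
  set d := Module.finrank ℝ W
  have hemb := hF.measurableEmbedding hγ
  -- By Rademacher's theorem the exceptional set is null, and its image under the Lipschitz map `F`
  -- is Hausdorff null.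
  have hN : volume {x | DifferentiableAt ℝ γ x}ᶜ = 0 := hγ.ae_differentiableAt
  have hFN : Measure.euclideanHausdorffMeasure d (F '' {x | DifferentiableAt ℝ γ x}ᶜ) = 0 := by
    refine le_antisymm ?_ zero_le
    refine (euclideanHausdorffMeasure_image_le id F _ (1 + K)
      (fun x _ y _ => (hF.lipschitzWith hγ).dist_le_mul x y) d).trans ?_
    rw [image_id, InnerProductSpace.euclideanHausdorffMeasure_eq_volume, hN, mul_zero]
  -- The constant does not depend on the piece, so the estimates sum over the countable partition.
  -- The two-sided bound becomes an equality as `δ` tends to zero.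
  have main : ∀ δ : ℝ, 0 < δ → δ ≤ 1 / 2 →
      Measure.euclideanHausdorffMeasure d (F '' A) ≤
        ENNReal.ofReal ((1 + 2 * δ) ^ (d + 1)) * ∫⁻ x in A, areaElement γ x ∧
      ∫⁻ x in A, areaElement γ x ≤ ENNReal.ofReal ((1 + 2 * δ) ^ (d + 1)) *
        Measure.euclideanHausdorffMeasure d (F '' A) := by
    intro δ hδ hδ'
    obtain ⟨P, a, hPm, hPd, hPc, hP1, hP2⟩ := exists_partition_gradient γ hδ
    have hpiece := fun i => hF.piece_estimate hδ hδ' (P := A ∩ P i)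
      (fun x hx y hy => hP1 i x hx.2 y hy.2) (fun x hx => hP2 i x hx.2)
    have hAP : A \ ⋃ i, P i ⊆ {x | DifferentiableAt ℝ γ x}ᶜ := fun x hx hd => hx.2 (hPc hd)
    have hdis : Pairwise (Function.onFun Disjoint fun i => A ∩ P i) := fun i j hij =>
      (hPd hij).mono inter_subset_right inter_subset_right
    have e1 : Measure.euclideanHausdorffMeasure d (F '' A) =
        ∑' i, Measure.euclideanHausdorffMeasure d (F '' (A ∩ P i)) := by
      rw [← measure_iUnion (fun i j hij => (disjoint_image_iff hF.injective).2 (hdis hij))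
        (fun i => hemb.measurableSet_image.2 (hA.inter (hPm i))), ← image_iUnion, ← inter_iUnion]
      refine le_antisymm ?_ (measure_mono (image_mono inter_subset_left))
      calc _ ≤ Measure.euclideanHausdorffMeasure d (F '' (A ∩ ⋃ i, P i) ∪
            F '' {x | DifferentiableAt ℝ γ x}ᶜ) := by
            rw [← image_union]
            refine measure_mono (image_mono fun x hx => ?_)
            by_cases hxP : x ∈ ⋃ i, P i
            · exact Or.inl ⟨hx, hxP⟩
            · exact Or.inr (hAP ⟨hx, hxP⟩)
        _ ≤ _ := (measure_union_le _ _).trans_eq (by rw [hFN, add_zero])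
    have e2 : ∫⁻ x in A, areaElement γ x = ∑' i, ∫⁻ x in A ∩ P i, areaElement γ x := by
      rw [← lintegral_iUnion (fun i => hA.inter (hPm i)) hdis, ← inter_iUnion]
      refine setLIntegral_congr ?_
      refine (inter_ae_eq_left_of_ae_eq_univ ?_).symm
      rw [ae_eq_univ]
      exact measure_mono_null (compl_subset_compl.2 hPc) hN
    rw [e1, e2, ← ENNReal.tsum_mul_left, ← ENNReal.tsum_mul_left]
    exact ⟨ENNReal.tsum_le_tsum fun i => (hpiece i).1, ENNReal.tsum_le_tsum fun i => (hpiece i).2⟩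
  have hlim : ∀ z : ℝ≥0∞, Tendsto (fun δ : ℝ => ENNReal.ofReal ((1 + 2 * δ) ^ (d + 1)) * z)
      (𝓝[>] 0) (𝓝 z) := by
    intro z
    have h1 : Tendsto (fun δ : ℝ => ENNReal.ofReal ((1 + 2 * δ) ^ (d + 1))) (𝓝[>] 0) (𝓝 1) := by
      have : Continuous fun δ : ℝ => ENNReal.ofReal ((1 + 2 * δ) ^ (d + 1)) :=
        ENNReal.continuous_ofReal.comp (by fun_prop)
      simpa using (this.tendsto 0).mono_left nhdsWithin_le_nhds
    simpa using ENNReal.Tendsto.mul_const h1 (Or.inl one_ne_zero)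
  have hev : ∀ᶠ δ : ℝ in 𝓝[>] 0, 0 < δ ∧ δ ≤ 1 / 2 := by
    filter_upwards [Ioc_mem_nhdsGT (show (0 : ℝ) < 1 / 2 by norm_num)] with δ hδ using hδ
  refine le_antisymm ?_ ?_
  · exact ge_of_tendsto (hlim _) (hev.mono fun δ hδ => (main δ hδ.1 hδ.2).1)
  · exact ge_of_tendsto (hlim _) (hev.mono fun δ hδ => (main δ hδ.1 hδ.2).2)

theorem IsGraphMap.map_withDensity {K : ℝ≥0} (hF : IsGraphMap γ F) (hγ : LipschitzWith K γ) :
    (volume.withDensity (areaElement γ)).map F =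
      (Measure.euclideanHausdorffMeasure (Module.finrank ℝ W)).restrict (range F) := by
  have hemb := hF.measurableEmbedding hγ
  ext B hB
  rw [hemb.map_apply, withDensity_apply _ (hemb.measurable hB), Measure.restrict_apply hB,
    ← hF.euclideanHausdorffMeasure_image hγ (hemb.measurable hB), image_preimage_eq_inter_range]

end Area

/-! ### Graph charts of a Lipschitz domain and the outward normal. -/

section Chart

variable {n : ℕ}

/-- The hyperplane orthogonal to `ν`. -/
abbrev Hyp (ν : Eucl n) : Type := ((ℝ ∙ ν)ᗮ : Submodule ℝ (Eucl n))

theorem inner_coe_hyp {ν : Eucl n} (x : Hyp ν) : inner ℝ ν (x : Eucl n) = 0 :=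
  Submodule.mem_orthogonal_singleton_iff_inner_right.1 x.2

theorem inner_self_unit {ν : Eucl n} (hν : ‖ν‖ = 1) : inner ℝ ν ν = (1 : ℝ) := by
  rw [real_inner_self_eq_norm_sq, hν, one_pow]

/-- The component orthogonal to the unit vector `ν`. -/
noncomputable def hypProj {ν : Eucl n} (hν : ‖ν‖ = 1) (z : Eucl n) : Hyp ν :=
  ⟨z - inner ℝ ν z • ν, Submodule.mem_orthogonal_singleton_iff_inner_right.2 (by
    rw [inner_sub_right, real_inner_smul_right, inner_self_unit hν]; ring)⟩

theorem coe_hypProj {ν : Eucl n} (hν : ‖ν‖ = 1) (z : Eucl n) :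
    (hypProj hν z : Eucl n) = z - inner ℝ ν z • ν := rfl

theorem continuous_hypProj {ν : Eucl n} (hν : ‖ν‖ = 1) : Continuous (hypProj hν) :=
  Continuous.subtype_mk (by fun_prop) _

theorem hypProj_add_smul {ν : Eucl n} (hν : ‖ν‖ = 1) (z : Eucl n) :
    (hypProj hν z : Eucl n) + (inner ℝ ν z : ℝ) • ν = z := by
  rw [coe_hypProj]; abel

theorem inner_hyp_add {ν : Eucl n} (hν : ‖ν‖ = 1) (x : Hyp ν) (t : ℝ) :
    inner ℝ ν ((x : Eucl n) + t • ν) = t := by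
  rw [inner_add_right, inner_coe_hyp, real_inner_smul_right, inner_self_unit hν]; ring

theorem hypProj_hyp_add {ν : Eucl n} (hν : ‖ν‖ = 1) (x : Hyp ν) (t : ℝ) :
    hypProj hν ((x : Eucl n) + t • ν) = x := by
  apply Subtype.ext
  rw [coe_hypProj, inner_hyp_add hν]; abel

theorem norm_hyp_add_sq {ν : Eucl n} (hν : ‖ν‖ = 1) (x : Hyp ν) (t : ℝ) :
    ‖(x : Eucl n) + t • ν‖ ^ 2 = ‖x‖ ^ 2 + t ^ 2 := by
  rw [norm_add_sq_real, real_inner_smul_right, real_inner_comm, inner_coe_hyp, norm_smul, hν]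
  simp

theorem finrank_hyp {ν : Eucl n} (hν : ‖ν‖ = 1) : Module.finrank ℝ (Hyp ν) = n - 1 := by
  have h := Submodule.finrank_add_finrank_orthogonal (ℝ ∙ ν : Submodule ℝ (Eucl n))
  rw [finrank_span_singleton (by rintro rfl; simp at hν), finrank_euclideanSpace_fin] at h
  have h' : 1 + Module.finrank ℝ (Hyp ν) = n := h
  omega

/-- The coordinates `(x, t) ↦ x + tν` as a linear isometry. -/
noncomputable def hypIsometry {ν : Eucl n} (hν : ‖ν‖ = 1) : WithLp 2 (Hyp ν × ℝ) ≃ₗᵢ[ℝ] Eucl n where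
  toFun p := (p.fst : Eucl n) + p.snd • ν
  map_add' p q := by simp only [WithLp.add_fst, WithLp.add_snd, Submodule.coe_add, add_smul]; abel
  map_smul' c p := by simp [smul_smul]
  invFun z := WithLp.toLp 2 (hypProj hν z, inner ℝ ν z)
  left_inv p := by
    simp only [hypProj_hyp_add, inner_hyp_add hν]
    rfl
  right_inv z := hypProj_add_smul hν z
  norm_map' p := by
    refine (sq_eq_sq₀ (norm_nonneg _) (norm_nonneg _)).1 ?_
    refine (norm_hyp_add_sq hν p.fst p.snd).trans ?_
    rw [WithLp.prod_norm_sq_eq_of_L2]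
    simp

theorem measurePreserving_hyp {ν : Eucl n} (hν : ‖ν‖ = 1) :
    MeasurePreserving (fun p : Hyp ν × ℝ => (p.1 : Eucl n) + p.2 • ν) :=
  (hypIsometry hν).measurePreserving.comp (WithLp.volume_preserving_toLp (Hyp ν) ℝ)

/-- The parametrisation of the graph of `γ` in direction `ν`. -/
def graphMap (ν : Eucl n) (γ : Eucl n → ℝ) (x : Hyp ν) : Eucl n := (x : Eucl n) + γ x • ν

theorem isGraphMap_graphMap {ν : Eucl n} (hν : ‖ν‖ = 1) (γ : Eucl n → ℝ) :
    IsGraphMap (fun x : Hyp ν => γ x) (graphMap ν γ) := by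
  intro x y
  rw [dist_eq_norm, ← norm_hyp_add_sq hν (x - y) (γ x - γ y)]
  congr 2
  simp only [graphMap, Submodule.coe_sub, sub_smul]
  abel

theorem lipschitzWith_comp_coe {ν : Eucl n} {γ : Eucl n → ℝ} {K : ℝ≥0} (hγ : LipschitzWith K γ) :
    LipschitzWith K (fun x : Hyp ν => γ x) := by
  have := hγ.comp (LipschitzWith.subtype_val (((ℝ ∙ ν)ᗮ : Submodule ℝ (Eucl n)) : Set (Eucl n)))
  rw [mul_one] at this
  exact this

/-- `Ω` is, in the ball `B(p, r)`, the part of space above the graph of `γ`. -/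
structure IsGraphChart (Ω : Set (Eucl n)) (p : Eucl n) (r : ℝ) (ν : Eucl n) (K : ℝ≥0)
    (γ : Eucl n → ℝ) : Prop where
  unit : ‖ν‖ = 1
  lipschitz : LipschitzWith K γ
  mem_iff : ∀ z ∈ Metric.ball p r, (z ∈ Ω ↔ γ (z - inner ℝ ν z • ν) < inner ℝ ν z)

variable {Ω : Set (Eucl n)} {p : Eucl n} {r : ℝ} {ν : Eucl n} {K : ℝ≥0} {γ : Eucl n → ℝ}

theorem IsGraphChart.mem_frontier_iff (h : IsGraphChart Ω p r ν K γ) (hΩ : IsOpen Ω) {z : Eucl n}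
    (hz : z ∈ Metric.ball p r) : z ∈ frontier Ω ↔ z ∈ range (graphMap ν γ) := by
  have hcont : Continuous fun z : Eucl n => inner ℝ ν z - γ (z - inner ℝ ν z • ν) := by
    have := h.lipschitz.continuous
    fun_prop
  have hnhds : Metric.ball p r ∈ 𝓝 z := Metric.isOpen_ball.mem_nhds hz
  have hrange : z ∈ range (graphMap ν γ) ↔ γ (z - inner ℝ ν z • ν) = inner ℝ ν z := by
    constructor
    · rintro ⟨x, rfl⟩
      rw [graphMap, inner_hyp_add h.unit]
      simp
    · intro hz
      refine ⟨hypProj h.unit z, ?_⟩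
      rw [graphMap, coe_hypProj, hz]; abel
  rw [hrange, hΩ.frontier_eq]
  constructor
  · rintro ⟨hcl, hnot⟩
    refine le_antisymm ?_ (not_lt.1 fun hlt => hnot ((h.mem_iff z hz).2 hlt))
    by_contra! hlt
    have hev : ∀ᶠ z' in 𝓝 z, inner ℝ ν z' - γ (z' - (inner ℝ ν z' : ℝ) • ν) < 0 :=
      hcont.continuousAt.eventually_lt_const (by linarith)
    obtain ⟨z', ⟨h1, h2⟩, h3⟩ := mem_closure_iff_nhds.1 hcl _ (inter_mem hev hnhds)
    have := (h.mem_iff z' h2).1 h3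
    have h1' : inner ℝ ν z' - γ (z' - (inner ℝ ν z' : ℝ) • ν) < 0 := h1
    linarith
  · intro heq
    refine ⟨?_, fun hz' => absurd ((h.mem_iff z hz).1 hz') (by linarith)⟩
    -- Moving up from a point of the graph enters `Ω`, so the point lies in the closure.
    have htend : Tendsto (fun t : ℝ => z + t • ν) (𝓝[>] 0) (𝓝 z) := by
      have : Continuous fun t : ℝ => z + t • ν := by fun_prop
      simpa using (this.tendsto 0).mono_left nhdsWithin_le_nhds
    refine mem_closure_of_tendsto htend ?_
    filter_upwards [htend hnhds, self_mem_nhdsWithin] with t ht1 ht2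
    refine (h.mem_iff _ ht1).2 ?_
    have e : inner ℝ ν (z + t • ν) = inner ℝ ν z + t := by
      rw [inner_add_right, real_inner_smul_right, inner_self_unit h.unit, mul_one]
    rw [e]
    have e2 : z + t • ν - (inner ℝ ν z + t) • ν = z - inner ℝ ν z • ν := by
      rw [add_smul]; abel
    rw [e2, heq]
    have : (0 : ℝ) < t := ht2
    linarith

/-- The outward unit normal of the region above the graph. -/
noncomputable def graphNormal (ν : Eucl n) (γ : Eucl n → ℝ) (x : Hyp ν) : Eucl n :=
  (√(1 + ‖gradient (fun x : Hyp ν => γ x) x‖ ^ 2))⁻¹ •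
    (((gradient (fun x : Hyp ν => γ x) x : Hyp ν) : Eucl n) - ν)

/-- If the normals differed, a small step along `v = ν₂ - ν₁` would lie inside `Ω` by the first and
outside by the second. The components of `v` along them are `∓‖v‖²/2`, so the opening `‖v‖/4` is
small enough. -/
theorem IsOutwardNormal.unique {y ν₁ ν₂ : Eucl n} (h₁ : IsOutwardNormal Ω y ν₁)
    (h₂ : IsOutwardNormal Ω y ν₂) : ν₁ = ν₂ := by
  by_contra hne
  set v := ν₂ - ν₁ with hv
  have hvne : v ≠ 0 := sub_ne_zero.2 (Ne.symm hne)
  have hvpos : 0 < ‖v‖ := norm_pos_iff.2 hvne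
  have e1 : inner ℝ v ν₁ = -(‖v‖ ^ 2 / 2) := by
    rw [← real_inner_self_eq_norm_sq, hv, inner_sub_left, inner_sub_left, inner_sub_right,
      inner_sub_right, real_inner_self_eq_norm_sq, real_inner_self_eq_norm_sq, h₁.1, h₂.1,
      real_inner_comm]
    ring
  have e2 : inner ℝ v ν₂ = ‖v‖ ^ 2 / 2 := by
    rw [← real_inner_self_eq_norm_sq, hv, inner_sub_left, inner_sub_left, inner_sub_right,
      inner_sub_right, real_inner_self_eq_norm_sq, real_inner_self_eq_norm_sq, h₁.1, h₂.1,
      real_inner_comm ν₁ ν₂]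
    ring
  have hε : 0 < ‖v‖ / 4 := by positivity
  have htend : Tendsto (fun t : ℝ => y + t • v) (𝓝[>] 0) (𝓝 y) := by
    have : Continuous fun t : ℝ => y + t • v := by fun_prop
    simpa using (this.tendsto 0).mono_left nhdsWithin_le_nhds
  obtain ⟨t, ⟨h3, h4⟩, ht⟩ :=
    (((htend.eventually (h₁.2 _ hε)).and (htend.eventually (h₂.2 _ hε))).and
      self_mem_nhdsWithin).exists
  have ht0 : (0 : ℝ) < t := ht
  rw [add_sub_cancel_left, real_inner_smul_left, norm_smul, Real.norm_of_nonneg ht0.le] at h3 h4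
  refine h4.2 ?_ (h3.1 ?_)
  · rw [e2]; nlinarith [mul_pos ht0 (pow_pos hvpos 2)]
  · rw [e1]; nlinarith [mul_pos ht0 (pow_pos hvpos 2)]

theorem IsOutwardNormal.outwardNormal_eq {y ν : Eucl n} (h : IsOutwardNormal Ω y ν) :
    outwardNormal Ω y = ν := by
  have hex : ∃ ν, IsOutwardNormal Ω y ν := ⟨ν, h⟩
  rw [outwardNormal, dif_pos hex]
  exact hex.choose_spec.unique h

/-- Differentiability of `γ` at `x` gives a linearisation error of at most `ε‖x' - x‖`. It is
absorbed by the cone condition because horizontal distances do not exceed distances in space and the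
normalising factor `J` is at least `1`. -/
theorem IsGraphChart.isOutwardNormal (h : IsGraphChart Ω p r ν K γ) {x : Hyp ν}
    (hx : DifferentiableAt ℝ (fun x : Hyp ν => γ x) x) (hp : graphMap ν γ x ∈ Metric.ball p r) :
    IsOutwardNormal Ω (graphMap ν γ x) (graphNormal ν γ x) := by
  set a := gradient (fun x : Hyp ν => γ x) x with ha
  have hJ1 : 1 ≤ √(1 + ‖a‖ ^ 2) := Real.le_sqrt_of_sq_le (by nlinarith [sq_nonneg ‖a‖])
  have hJ0 : 0 < √(1 + ‖a‖ ^ 2) := by linarith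
  have hJsq := Real.sq_sqrt (show (0 : ℝ) ≤ 1 + ‖a‖ ^ 2 by positivity)
  set J := √(1 + ‖a‖ ^ 2) with hJ
  have hη : graphNormal ν γ x = J⁻¹ • ((a : Eucl n) - ν) := rfl
  refine ⟨?_, fun ε hε => ?_⟩
  · rw [hη, norm_smul, norm_inv, Real.norm_of_nonneg hJ0.le]
    have : ‖(a : Eucl n) - ν‖ ^ 2 = J ^ 2 := by
      have := norm_hyp_add_sq h.unit a (-1)
      rw [neg_one_smul, ← sub_eq_add_neg] at this
      rw [this, hJsq]; ring
    rw [(sq_eq_sq₀ (norm_nonneg _) hJ0.le).1 this, inv_mul_cancel₀ hJ0.ne']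
  · have hlit := hx.hasFDerivAt.isLittleO.def hε
    have hproj : Tendsto (hypProj h.unit) (𝓝 (graphMap ν γ x)) (𝓝 x) := by
      have := (continuous_hypProj h.unit).tendsto (graphMap ν γ x)
      rwa [graphMap, hypProj_hyp_add] at this
    filter_upwards [hproj.eventually hlit, Metric.isOpen_ball.mem_nhds hp] with z hz hzb
    set x' := hypProj h.unit z with hx'
    set t : ℝ := inner ℝ ν z with ht
    have hzd : z = (x' : Eucl n) + t • ν := (hypProj_add_smul h.unit z).symm
    have hzy : z - graphMap ν γ x = ((x' - x : Hyp ν) : Eucl n) + (t - γ x) • ν := by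
      conv_lhs => rw [hzd]
      simp only [graphMap, Submodule.coe_sub, sub_smul]; abel
    have hn : ‖x' - x‖ ≤ ‖z - graphMap ν γ x‖ := by
      refine (sq_le_sq₀ (norm_nonneg _) (norm_nonneg _)).1 ?_
      rw [hzy, norm_hyp_add_sq h.unit]
      nlinarith [sq_nonneg (t - γ x)]
    have hin : inner ℝ (z - graphMap ν γ x) ((a : Eucl n) - ν) =
        inner ℝ a (x' - x) - (t - γ x) := by
      have e1 : inner ℝ (((x' - x : Hyp ν) : Eucl n)) (a : Eucl n) = inner ℝ a (x' - x) := by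
        rw [real_inner_comm]; rfl
      have e2 : inner ℝ (((x' - x : Hyp ν) : Eucl n)) ν = (0 : ℝ) := by
        rw [real_inner_comm]; exact inner_coe_hyp _
      have e3 : inner ℝ ν (a : Eucl n) = (0 : ℝ) := inner_coe_hyp _
      rw [hzy, inner_add_left, inner_sub_right, inner_sub_right, e1, e2, real_inner_smul_left,
        real_inner_smul_left, e3, inner_self_unit h.unit]
      ring
    rw [← inner_gradient, ← ha, Real.norm_eq_abs, abs_le] at hz
    have hmem := h.mem_iff z hzb
    have hcoe : z - inner ℝ ν z • ν = (x' : Eucl n) := rfl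
    rw [hcoe, ← ht] at hmem
    rw [hη, real_inner_smul_right, hin]
    set N := ‖z - graphMap ν γ x‖
    have hN : 0 ≤ N := norm_nonneg _
    set q : ℝ := inner ℝ a (x' - x) - (t - γ x) with hq
    have hεN : ε * ‖x' - x‖ ≤ ε * N := mul_le_mul_of_nonneg_left hn hε.le
    have hNJ : ε * N ≤ J * (ε * N) := le_mul_of_one_le_left (by positivity) hJ1
    have hJq : J * (J⁻¹ * q) = q := by rw [← mul_assoc, mul_inv_cancel₀ hJ0.ne', one_mul]
    constructor
    · intro hlt
      have := mul_lt_mul_of_pos_left hlt hJ0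
      rw [hJq] at this
      refine hmem.2 ?_
      linarith [hz.2]
    · intro hlt hzΩ
      have := mul_lt_mul_of_pos_left hlt hJ0
      rw [hJq] at this
      have := hmem.1 hzΩ
      linarith [hz.1]

end Chart

/-! ### Divergence theorem above a Lipschitz graph. -/

section Epigraph

variable {n : ℕ} {ν : Eucl n} {K : ℝ≥0} {γ : Eucl n → ℝ}

theorem continuous_graphMap (hγ : LipschitzWith K γ) :
    Continuous (graphMap ν γ) := by
  have := hγ.continuous
  unfold graphMap
  fun_prop

/-- Flattening is a vertical shear followed by an isometry. It preserves volume by translation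
invariance on each vertical line, with no derivative of `γ` needed. -/
theorem measurePreserving_graphMap_add (hν : ‖ν‖ = 1) (hγ : LipschitzWith K γ) :
    MeasurePreserving (fun q : Hyp ν × ℝ => graphMap ν γ q.1 + q.2 • ν) := by
  have h1 : MeasurePreserving (fun q : Hyp ν × ℝ => (q.1, γ q.1 + q.2))
      (volume.prod volume) (volume.prod volume) := by
    refine (MeasurePreserving.id volume).skew_product (g := fun (x : Hyp ν) s => γ x + s) ?_
      (ae_of_all _ fun x => map_add_left_eq_self volume (γ x))
    have := hγ.continuous
    exact (by fun_prop : Continuous fun q : Hyp ν × ℝ => γ q.1 + q.2).measurable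
  convert (measurePreserving_hyp hν).comp h1 using 2 with q
  · simp only [Function.comp, graphMap, add_smul]
    abel
  · rfl

theorem measurableEmbedding_graphMap_add (hν : ‖ν‖ = 1) (hγ : LipschitzWith K γ) :
    MeasurableEmbedding (fun q : Hyp ν × ℝ => graphMap ν γ q.1 + q.2 • ν) := by
  have hc := continuous_graphMap (ν := ν) hγ
  refine (by fun_prop : Continuous fun q : Hyp ν × ℝ => graphMap ν γ q.1 + q.2 • ν).measurableEmbedding ?_
  intro q q' hqq
  have e : ∀ q : Hyp ν × ℝ, graphMap ν γ q.1 + q.2 • ν = (q.1 : Eucl n) + (γ q.1 + q.2) • ν := by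
    intro q; simp only [graphMap, add_smul]; abel
  simp only [e] at hqq
  have h1 := congrArg (hypProj hν) hqq
  rw [hypProj_hyp_add, hypProj_hyp_add] at h1
  have h2 := congrArg (fun z : Eucl n => (inner ℝ ν z : ℝ)) hqq
  simp only [inner_hyp_add hν, h1] at h2
  exact Prod.ext h1 (add_left_cancel h2)

theorem measurableEmbedding_graphMap (hν : ‖ν‖ = 1) (hγ : LipschitzWith K γ) :
    MeasurableEmbedding (graphMap ν γ) :=
  (isGraphMap_graphMap hν γ).measurableEmbedding (lipschitzWith_comp_coe hγ)

theorem norm_gradient_le (hγ : LipschitzWith K γ) (x : Hyp ν) :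
    ‖gradient (fun x : Hyp ν => γ x) x‖ ≤ K := by
  rw [gradient, LinearIsometryEquiv.norm_map]
  exact norm_fderiv_le_of_lipschitz ℝ (lipschitzWith_comp_coe hγ)

/-- The divergence theorem in the region above the graph of a Lipschitz function. -/
theorem integral_epigraph_fderiv (hν : ‖ν‖ = 1) (hγ : LipschitzWith K γ) {g : Eucl n → ℝ}
    (hg : ContDiff ℝ 1 g) (hgc : HasCompactSupport g) (e : Eucl n) :
    ∫ z in {z | γ (z - inner ℝ ν z • ν) < inner ℝ ν z}, fderiv ℝ g z e =
      ∫ x : Hyp ν, (inner ℝ e ((gradient (fun x : Hyp ν => γ x) x : Hyp ν) : Eucl n) -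
        inner ℝ e ν) * g (graphMap ν γ x) := by
  let Φ : Hyp ν × ℝ → Eucl n := fun q => graphMap ν γ q.1 + q.2 • ν
  have hΦ : MeasurePreserving Φ := measurePreserving_graphMap_add hν hγ
  have hΦe : MeasurableEmbedding Φ := measurableEmbedding_graphMap_add hν hγ
  have hFc := continuous_graphMap (ν := ν) hγ
  have hΦc : Continuous Φ := by fun_prop
  let μ : Measure (Hyp ν × ℝ) := (volume : Measure (Hyp ν)).prod (volume.restrict (Ioi (0 : ℝ)))
  have hμ : volume.restrict (Φ ⁻¹' {z | γ (z - inner ℝ ν z • ν) < inner ℝ ν z}) = μ := by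
    have : Φ ⁻¹' {z | γ (z - inner ℝ ν z • ν) < inner ℝ ν z} = univ ×ˢ Ioi 0 := by
      ext q
      have e : Φ q = (q.1 : Eucl n) + (γ q.1 + q.2) • ν := by
        simp only [Φ, graphMap, add_smul]; abel
      simp [e, inner_hyp_add hν]
    rw [this, Measure.volume_eq_prod, ← Measure.prod_restrict, Measure.restrict_univ]
  set a : Hyp ν → Hyp ν := gradient (fun x : Hyp ν => γ x) with ha
  set e' : Hyp ν := hypProj hν e with he'
  set τ : ℝ := inner ℝ ν e with hτ
  have hee : (e' : Eucl n) + τ • ν = e := hypProj_add_smul hν e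
  have hcoef : ∀ x, inner ℝ e (a x : Eucl n) - inner ℝ e ν = inner ℝ (a x) e' - τ := by
    intro x
    have h1 : (inner ℝ ((a x : Hyp ν) : Eucl n) (e' : Eucl n) : ℝ) = inner ℝ (a x) e' := rfl
    have h2 : (inner ℝ ((a x : Hyp ν) : Eucl n) ν : ℝ) = 0 := by
      rw [real_inner_comm]; exact inner_coe_hyp _
    rw [real_inner_comm, real_inner_comm ν e, ← hτ]
    conv_lhs => rw [← hee]
    rw [inner_add_right, real_inner_smul_right, h1, h2, mul_zero, add_zero]
  have hdg : ∀ v, Continuous fun z => fderiv ℝ g z v := fun v =>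
    (hg.continuous_fderiv one_ne_zero).clm_apply continuous_const
  have hint : ∀ v, Integrable (fun q => fderiv ℝ g (Φ q) v) μ := by
    intro v
    have h1 : Integrable (fun z => fderiv ℝ g z v) :=
      (hdg v).integrable_of_hasCompactSupport (hgc.fderiv_apply ℝ v)
    rw [← hμ]
    exact ((hΦ.integrable_comp_emb hΦe).2 h1).restrict
  -- The direction splits as `e = (e' + ⟪a x, e'⟫ ν) + c x ν`. The first summand is tangent to the
  -- translated graphs and the second is vertical, with a coefficient constant along vertical lines.
  let c : Hyp ν → ℝ := fun x => τ - inner ℝ (a x) e'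
  have hcm : Measurable c := by
    have := measurable_gradient_of_real (fun x : Hyp ν => γ x)
    exact measurable_const.sub (this.inner measurable_const)
  have hcb : ∀ x, ‖c x‖ ≤ |τ| + K * ‖e'‖ := fun x =>
    (norm_sub_le _ _).trans (add_le_add le_rfl ((norm_inner_le_norm _ _).trans
      (mul_le_mul_of_nonneg_right (norm_gradient_le hγ x) (norm_nonneg _))))
  have hintB : Integrable (fun q => c q.1 * fderiv ℝ g (Φ q) ν) μ :=
    (hint ν).bdd_mul (hcm.comp measurable_fst).aestronglyMeasurable
      (ae_of_all _ fun q => hcb q.1)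
  have hintL : Integrable (fun q => fderiv ℝ g (Φ q) e - c q.1 * fderiv ℝ g (Φ q) ν) μ :=
    (hint e).sub hintB
  have hsplit : ∫ z in {z | γ (z - inner ℝ ν z • ν) < inner ℝ ν z}, fderiv ℝ g z e =
      (∫ q, (fderiv ℝ g (Φ q) e - c q.1 * fderiv ℝ g (Φ q) ν) ∂μ) +
        ∫ q, c q.1 * fderiv ℝ g (Φ q) ν ∂μ := by
    rw [← integral_add hintL hintB, ← hΦ.setIntegral_preimage_emb hΦe, hμ]
    simp only [sub_add_cancel]
  -- On each slice of constant `s` the integrand is the derivative along `e'` of `x ↦ g(Φ(x, s))`.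
  -- That function is Lipschitz with compact support, so the integral is zero.
  have htan : ∫ q, (fderiv ℝ g (Φ q) e - c q.1 * fderiv ℝ g (Φ q) ν) ∂μ = 0 := by
    rw [integral_prod_symm _ hintL]
    refine integral_eq_zero_of_ae (ae_of_all _ fun s => ?_)
    let H : Hyp ν → ℝ := fun x => g (Φ (x, s))
    obtain ⟨Cg, hCg⟩ := hg.lipschitzWith_of_hasCompactSupport hgc one_ne_zero
    have hFL := (isGraphMap_graphMap hν γ).lipschitzWith (lipschitzWith_comp_coe hγ)
    have hHL : LipschitzWith (Cg * (1 + K)) H := by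
      have h2 : LipschitzWith (1 + K) fun x => Φ (x, s) := by
        refine LipschitzWith.of_dist_le_mul fun x y => ?_
        simp only [Φ, dist_add_right]
        exact hFL.dist_le_mul x y
      exact hCg.comp h2
    have hHc : HasCompactSupport H := by
      have hsub : tsupport H ⊆ hypProj hν '' tsupport g := by
        refine closure_minimal (fun x hx => ⟨Φ (x, s), subset_tsupport _ hx, ?_⟩)
          (hgc.isCompact.image (continuous_hypProj hν)).isClosed
        have e : Φ (x, s) = (x : Eucl n) + (γ x + s) • ν := by
          simp only [Φ, graphMap, add_smul]; abel
        rw [e, hypProj_hyp_add]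
      exact HasCompactSupport.of_support_subset_isCompact
        (hgc.isCompact.image (continuous_hypProj hν)) ((subset_tsupport _).trans hsub)
    have h0 := LipschitzWith.integral_lineDeriv_mul_eq (μ := (volume : Measure (Hyp ν)))
      (LipschitzWith.const (1 : ℝ)) hHL hHc (-e')
    have hlc : ∀ x : Hyp ν, lineDeriv ℝ (fun _ : Hyp ν => (1 : ℝ)) x (-e') = 0 := fun x => by
      simp [lineDeriv]
    simp only [neg_neg, mul_one, hlc, zero_mul, integral_zero] at h0
    change ∫ x, (fderiv ℝ g (Φ (x, s)) e - c x * fderiv ℝ g (Φ (x, s)) ν) = 0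
    rw [h0]
    refine integral_congr_ae ?_
    filter_upwards [(lipschitzWith_comp_coe (ν := ν) hγ).ae_differentiableAt] with x hx
    have hF' : HasFDerivAt (fun x => Φ (x, s)) ((Submodule.subtypeL _ : Hyp ν →L[ℝ] Eucl n) +
        (fderiv ℝ (fun x : Hyp ν => γ x) x).smulRight ν) x :=
      (((Submodule.subtypeL _ : Hyp ν →L[ℝ] Eucl n).hasFDerivAt.add
        (hx.hasFDerivAt.smul_const ν)).add_const (s • ν) :)
    have hH' : HasFDerivAt H _ x :=
      ((hg.differentiable one_ne_zero) (Φ (x, s))).hasFDerivAt.comp x hF'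
    rw [(hH'.hasLineDerivAt e').lineDeriv]
    have h5 : fderiv ℝ (fun x : Hyp ν => γ x) x e' = inner ℝ (a x) e' := (inner_gradient _ _ _).symm
    simp only [ContinuousLinearMap.comp_apply, add_apply,
      ContinuousLinearMap.smulRight_apply, Submodule.subtypeL_apply, h5, map_add, map_smul, c]
    conv_lhs => rw [← hee]
    simp only [map_add, map_smul, smul_eq_mul]
    ring
  rw [hsplit, htan, zero_add, integral_prod _ hintB]
  refine integral_congr_ae (ae_of_all _ fun x => ?_)
  simp only [hcoef]
  rw [integral_const_mul]
  -- The vertical part is evaluated on each half-line by the fundamental theorem of calculus,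
  -- leaving minus the value on the graph.
  let G : ℝ → ℝ := fun s => g (Φ (x, s))
  have hline : ContDiff ℝ 1 fun s : ℝ => Φ (x, s) := by
    simp only [Φ]
    exact contDiff_const.add (contDiff_id.smul contDiff_const)
  have hG : ContDiff ℝ 1 G := hg.comp hline
  have hGc : HasCompactSupport G := by
    have hcl : Topology.IsClosedEmbedding fun s : ℝ => Φ (x, s) := by
      have : Isometry fun s : ℝ => Φ (x, s) := by
        refine Isometry.of_dist_eq fun s t => ?_
        rw [dist_add_left, dist_eq_norm, ← sub_smul, norm_smul, hν, mul_one, dist_eq_norm]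
      exact this.isClosedEmbedding
    exact hgc.comp_isClosedEmbedding hcl
  have hGd : ∀ s, deriv G s = fderiv ℝ g (Φ (x, s)) ν := by
    intro s
    have h1 : HasDerivAt (fun s : ℝ => Φ (x, s)) ν s := by
      simpa [Φ] using ((hasDerivAt_id s).smul_const ν).const_add (graphMap ν γ x)
    exact (((hg.differentiable one_ne_zero) (Φ (x, s))).hasFDerivAt.comp_hasDerivAt s h1).deriv
  have := hGc.integral_Ioi_deriv_eq hG 0
  simp only [hGd] at this
  change c x * (∫ s in Ioi 0, fderiv ℝ g (Φ (x, s)) ν) = _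
  rw [this]
  simp only [G, Φ, zero_smul, add_zero, c]
  ring

end Epigraph

/-! ### Divergence theorem on a bounded Lipschitz domain. -/

section Divergence

variable {n : ℕ} {Ω : Set (Eucl n)} {p : Eucl n} {r : ℝ} {ν : Eucl n} {K : ℝ≥0} {γ : Eucl n → ℝ}

theorem IsLipschitzDomain.exists_chart (hΩ : IsLipschitzDomain Ω) {p : Eucl n}
    (hp : p ∈ frontier Ω) : ∃ r > 0, ∃ ν K γ, IsGraphChart Ω p r ν K γ := by
  obtain ⟨r, hr, ν, hν, K, γ, hγ, h⟩ := hΩ.lipschitz_frontier p hp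
  exact ⟨r, hr, ν, K, γ, hν, hγ, h⟩

theorem map_withDensity_graphMap (hν : ‖ν‖ = 1) (hγ : LipschitzWith K γ) :
    (volume.withDensity (areaElement fun x : Hyp ν => γ x)).map (graphMap ν γ) =
      (Measure.euclideanHausdorffMeasure (n - 1)).restrict (range (graphMap ν γ)) := by
  rw [(isGraphMap_graphMap hν γ).map_withDensity (lipschitzWith_comp_coe hγ), finrank_hyp hν]

/-- Near the centre of a chart the surface measure is carried by the graph. -/
theorem IsGraphChart.restrict_surfaceMeasure (h : IsGraphChart Ω p r ν K γ) (hΩ : IsOpen Ω) :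
    (surfaceMeasure Ω).restrict (Metric.ball p r) =
      ((volume.withDensity (areaElement fun x : Hyp ν => γ x)).map (graphMap ν γ)).restrict
        (Metric.ball p r) := by
  rw [map_withDensity_graphMap h.unit h.lipschitz, surfaceMeasure,
    Measure.restrict_restrict Metric.isOpen_ball.measurableSet,
    Measure.restrict_restrict Metric.isOpen_ball.measurableSet]
  congr 1
  ext z
  exact and_congr_right fun hz => h.mem_frontier_iff hΩ hz

theorem IsGraphChart.outwardNormal_ae (h : IsGraphChart Ω p r ν K γ) :
    ∀ᵐ x : Hyp ν, graphMap ν γ x ∈ Metric.ball p r →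
      outwardNormal Ω (graphMap ν γ x) = graphNormal ν γ x := by
  filter_upwards [(lipschitzWith_comp_coe (ν := ν) h.lipschitz).ae_differentiableAt] with x hx hp
  exact (h.isOutwardNormal hx hp).outwardNormal_eq

theorem measurable_graphNormal : Measurable (graphNormal ν γ) := by
  have h1 := measurable_gradient_of_real (fun x : Hyp ν => γ x)
  exact ((h1.norm.pow_const 2).const_add 1).sqrt.inv.smul
    ((measurable_subtype_coe.comp h1).sub_const ν)

theorem IsGraphChart.aemeasurable_outwardNormal (h : IsGraphChart Ω p r ν K γ) (hΩ : IsOpen Ω) :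
    AEMeasurable (outwardNormal Ω) ((surfaceMeasure Ω).restrict (Metric.ball p r)) := by
  have hemb := measurableEmbedding_graphMap h.unit h.lipschitz
  rw [h.restrict_surfaceMeasure hΩ, hemb.restrict_map, hemb.aemeasurable_map_iff]
  refine ⟨graphNormal ν γ, measurable_graphNormal, ?_⟩
  rw [EventuallyEq, ae_restrict_iff' (hemb.measurable Metric.isOpen_ball.measurableSet)]
  exact (withDensity_absolutelyContinuous _ _).ae_le h.outwardNormal_ae

theorem IsGraphChart.surfaceMeasure_ball_lt_top (h : IsGraphChart Ω p r ν K γ) (hΩ : IsOpen Ω) :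
    surfaceMeasure Ω (Metric.ball p r) < ⊤ := by
  have hemb := measurableEmbedding_graphMap h.unit h.lipschitz
  have e := congrArg (fun μ => μ univ) (h.restrict_surfaceMeasure hΩ)
  simp only [Measure.restrict_apply_univ] at e
  rw [e, hemb.map_apply, withDensity_apply _ (hemb.measurable Metric.isOpen_ball.measurableSet)]
  have hsub : graphMap ν γ ⁻¹' Metric.ball p r ⊆ Metric.closedBall (hypProj h.unit p) r := by
    intro x hx
    rw [mem_preimage, Metric.mem_ball, dist_eq_norm] at hx
    rw [Metric.mem_closedBall, dist_eq_norm]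
    refine le_trans ?_ hx.le
    refine (sq_le_sq₀ (norm_nonneg _) (norm_nonneg _)).1 ?_
    have : graphMap ν γ x - p = ((x - hypProj h.unit p : Hyp ν) : Eucl n) +
        (γ x - inner ℝ ν p) • ν := by
      conv_lhs => rw [← hypProj_add_smul h.unit p]
      simp only [graphMap, Submodule.coe_sub, sub_smul]; abel
    rw [this, norm_hyp_add_sq h.unit]
    nlinarith [sq_nonneg (γ x - inner ℝ ν p)]
  calc _ ≤ ∫⁻ _ in graphMap ν γ ⁻¹' Metric.ball p r, ENNReal.ofReal √(1 + K ^ 2) := by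
        refine lintegral_mono fun x => ENNReal.ofReal_le_ofReal (Real.sqrt_le_sqrt ?_)
        have := norm_gradient_le (ν := ν) h.lipschitz x
        gcongr
    _ < ⊤ := by
        rw [setLIntegral_const]
        refine ENNReal.mul_lt_top ENNReal.ofReal_lt_top ((measure_mono hsub).trans_lt ?_)
        exact (isCompact_closedBall _ _).measure_lt_top

theorem IsLipschitzDomain.isCompact_frontier (hΩ : IsLipschitzDomain Ω) :
    IsCompact (frontier Ω) :=
  Metric.isCompact_of_isClosed_isBounded isClosed_frontier
    (hΩ.isBounded.closure.subset frontier_subset_closure)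

theorem IsLipschitzDomain.isFiniteMeasure (hΩ : IsLipschitzDomain Ω) :
    IsFiniteMeasure (surfaceMeasure Ω) := by
  have h1 : surfaceMeasure Ω (frontier Ω) < ⊤ := by
    refine hΩ.isCompact_frontier.measure_lt_top_of_nhdsWithin fun p hp => ?_
    obtain ⟨r, hr, ν, K, γ, h⟩ := hΩ.exists_chart hp
    exact ⟨Metric.ball p r, mem_nhdsWithin_of_mem_nhds (Metric.ball_mem_nhds p hr),
      h.surfaceMeasure_ball_lt_top hΩ.isOpen⟩
  refine ⟨?_⟩
  rwa [surfaceMeasure, Measure.restrict_apply_univ,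
    ← Measure.restrict_apply_self]

theorem IsLipschitzDomain.aemeasurable_outwardNormal (hΩ : IsLipschitzDomain Ω) :
    AEMeasurable (outwardNormal Ω) (surfaceMeasure Ω) := by
  have h1 : AEMeasurable (outwardNormal Ω) ((surfaceMeasure Ω).restrict (frontier Ω)) := by
    refine hΩ.isCompact_frontier.induction_on
      (p := fun s => AEMeasurable (outwardNormal Ω) ((surfaceMeasure Ω).restrict s)) (by simp)
      (fun s t hst ht => ht.mono_set hst) (fun s t hs ht => aemeasurable_union_iff.2 ⟨hs, ht⟩)
      fun p hp => ?_
    obtain ⟨r, hr, ν, K, γ, h⟩ := hΩ.exists_chart hp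
    exact ⟨Metric.ball p r, mem_nhdsWithin_of_mem_nhds (Metric.ball_mem_nhds p hr),
      h.aemeasurable_outwardNormal hΩ.isOpen⟩
  rwa [surfaceMeasure, Measure.restrict_restrict isClosed_frontier.measurableSet, inter_self] at h1

theorem norm_outwardNormal_le (Ω : Set (Eucl n)) (y : Eucl n) : ‖outwardNormal Ω y‖ ≤ 1 := by
  rw [outwardNormal]
  split_ifs with h
  · exact h.choose_spec.1.le
  · simp

/-- The divergence theorem for functions supported in a chart. -/
theorem IsGraphChart.integral_fderiv (h : IsGraphChart Ω p r ν K γ) (hΩ : IsOpen Ω)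
    {g : Eucl n → ℝ} (hg : ContDiff ℝ 1 g) (hgc : HasCompactSupport g)
    (hgs : tsupport g ⊆ Metric.ball p r) (e : Eucl n) :
    ∫ z in Ω, fderiv ℝ g z e = ∫ y, g y * inner ℝ e (outwardNormal Ω y) ∂(surfaceMeasure Ω) := by
  have hemb := measurableEmbedding_graphMap h.unit h.lipschitz
  have hepi : MeasurableSet {z : Eucl n | γ (z - inner ℝ ν z • ν) < inner ℝ ν z} := by
    have := h.lipschitz.continuous
    exact (isOpen_lt (by fun_prop) (by fun_prop)).measurableSet
  have hl : ∫ z in Ω, fderiv ℝ g z e =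
      ∫ z in {z | γ (z - inner ℝ ν z • ν) < inner ℝ ν z}, fderiv ℝ g z e := by
    rw [← integral_indicator hΩ.measurableSet, ← integral_indicator hepi]
    congr 1
    ext z
    by_cases hz : z ∈ Metric.ball p r
    · have := h.mem_iff z hz
      by_cases hzΩ : z ∈ Ω
      · have h1 : z ∈ {z : Eucl n | γ (z - inner ℝ ν z • ν) < inner ℝ ν z} := this.1 hzΩ
        rw [indicator_of_mem hzΩ, indicator_of_mem h1]
      · have h1 : z ∉ {z : Eucl n | γ (z - inner ℝ ν z • ν) < inner ℝ ν z} :=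
          fun hc => hzΩ (this.2 hc)
        rw [indicator_of_notMem hzΩ, indicator_of_notMem h1]
    · have h0 : fderiv ℝ g z = 0 := image_eq_zero_of_notMem_tsupport fun hc =>
        hz (hgs (tsupport_fderiv_subset ℝ hc))
      simp [indicator_apply, h0]
  have hr : ∫ y, g y * inner ℝ e (outwardNormal Ω y) ∂(surfaceMeasure Ω) =
      ∫ y in Metric.ball p r, g y * inner ℝ e (outwardNormal Ω y) ∂(surfaceMeasure Ω) := by
    rw [setIntegral_eq_integral_of_forall_compl_eq_zero]
    intro y hy
    rw [image_eq_zero_of_notMem_tsupport fun hc => hy (hgs hc), zero_mul]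
  have hr2 : ∫ y in Metric.ball p r, g y * inner ℝ e (outwardNormal Ω y)
      ∂((volume.withDensity (areaElement fun x : Hyp ν => γ x)).map (graphMap ν γ)) =
      ∫ y, g y * inner ℝ e (outwardNormal Ω y)
      ∂((volume.withDensity (areaElement fun x : Hyp ν => γ x)).map (graphMap ν γ)) := by
    rw [setIntegral_eq_integral_of_forall_compl_eq_zero]
    intro y hy
    rw [image_eq_zero_of_notMem_tsupport fun hc => hy (hgs hc), zero_mul]
  rw [hl, integral_epigraph_fderiv h.unit h.lipschitz hg hgc, hr, h.restrict_surfaceMeasure hΩ, hr2,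
    hemb.integral_map, integral_withDensity_eq_integral_toReal_smul (measurable_areaElement _)
      (ae_of_all _ fun x => ENNReal.ofReal_lt_top)]
  refine integral_congr_ae ?_
  filter_upwards [h.outwardNormal_ae] with x hx
  by_cases hxb : graphMap ν γ x ∈ Metric.ball p r
  -- The area element cancels the normalisation of `graphNormal`, leaving the coefficient of
  -- `integral_epigraph_fderiv`.
  · have hJ1 : 0 < √(1 + ‖gradient (fun x : Hyp ν => γ x) x‖ ^ 2) :=
      Real.sqrt_pos.2 (by positivity)
    rw [hx hxb, graphNormal, areaElement, ENNReal.toReal_ofReal hJ1.le, real_inner_smul_right,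
      inner_sub_right, smul_eq_mul]
    field_simp
  · rw [image_eq_zero_of_notMem_tsupport fun hc => hxb (hgs hc)]
    simp

theorem integral_fderiv_of_compact_subset (hΩ : IsOpen Ω) {g : Eucl n → ℝ} (hg : ContDiff ℝ 1 g)
    (hgc : HasCompactSupport g) (hgs : tsupport g ⊆ Ω) (e : Eucl n) :
    ∫ z in Ω, fderiv ℝ g z e = ∫ y, g y * inner ℝ e (outwardNormal Ω y) ∂(surfaceMeasure Ω) := by
  have h1 : ∫ y, g y * inner ℝ e (outwardNormal Ω y) ∂(surfaceMeasure Ω) = 0 := by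
    refine setIntegral_eq_zero_of_forall_eq_zero fun y hy => ?_
    rw [hΩ.frontier_eq] at hy
    rw [image_eq_zero_of_notMem_tsupport fun hc => hy.2 (hgs hc), zero_mul]
  rw [h1, setIntegral_eq_integral_of_forall_compl_eq_zero]
  · have := integral_mul_fderiv_eq_neg_fderiv_mul_of_integrable (μ := (volume : Measure (Eucl n)))
      (f := fun _ => (1 : ℝ)) (g := g) (v := e) ?_ ?_ ?_ (by fun_prop)
      (fun x _ => hg.differentiable one_ne_zero x)
    · simpa using this
    · simp
    · simpa using ((hg.continuous_fderiv one_ne_zero).clm_apply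
        continuous_const).integrable_of_hasCompactSupport (hgc.fderiv_apply ℝ e)
    · simpa using hg.continuous.integrable_of_hasCompactSupport hgc
  · intro y hy
    have h0 : fderiv ℝ g y = 0 := image_eq_zero_of_notMem_tsupport fun hc =>
      hy (hgs (tsupport_fderiv_subset ℝ hc))
    rw [h0]; rfl

/-- The divergence theorem on a bounded Lipschitz domain. -/
theorem IsLipschitzDomain.integral_fderiv (hΩ : IsLipschitzDomain Ω) {g : Eucl n → ℝ}
    (hg : ContDiff ℝ 1 g) (e : Eucl n) :
    ∫ z in Ω, fderiv ℝ g z e = ∫ y, g y * inner ℝ e (outwardNormal Ω y) ∂(surfaceMeasure Ω) := by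
  have := hΩ.isFiniteMeasure
  -- Each point of the closure has either a boundary chart or a ball inside `Ω`. A finite subcover
  -- and a subordinate partition of unity reduce the theorem to these two cases.
  have hloc : ∀ p : closure Ω, ∃ r > 0, (∃ ν K γ, IsGraphChart Ω p r ν K γ) ∨
      Metric.ball (p : Eucl n) r ⊆ Ω := by
    rintro ⟨p, hp⟩
    by_cases hpΩ : p ∈ Ω
    · obtain ⟨r, hr, hb⟩ := Metric.isOpen_iff.1 hΩ.isOpen p hpΩ
      exact ⟨r, hr, Or.inr hb⟩
    · obtain ⟨r, hr, h⟩ := hΩ.exists_chart (p := p) (by rw [hΩ.isOpen.frontier_eq]; exact ⟨hp, hpΩ⟩)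
      exact ⟨r, hr, Or.inl h⟩
  choose r hr hcase using hloc
  have hcomp : IsCompact (closure Ω) := hΩ.isBounded.isCompact_closure
  obtain ⟨t, ht⟩ := hcomp.elim_finite_subcover (fun p : closure Ω => Metric.ball (p : Eucl n) (r p))
    (fun _ => Metric.isOpen_ball) fun p hp => mem_iUnion.2 ⟨⟨p, hp⟩, Metric.mem_ball_self (hr _)⟩
  obtain ⟨ρ, hρ⟩ := SmoothPartitionOfUnity.exists_isSubordinate 𝓘(ℝ, Eucl n) isClosed_closure
    (fun p : t => Metric.ball ((p : closure Ω) : Eucl n) (r p)) (fun _ => Metric.isOpen_ball)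
    (by intro x hx; simpa using ht hx)
  have hρs : ∀ i, ContDiff ℝ 1 (ρ i) := fun i =>
    ((ρ i).contMDiff.contDiff).of_le (by exact_mod_cast le_top)
  have hρc : ∀ i, HasCompactSupport (ρ i) := fun i =>
    HasCompactSupport.of_support_subset_isCompact (isCompact_closedBall ((i : closure Ω) : Eucl n) (r i))
      ((subset_tsupport _).trans ((hρ i).trans Metric.ball_subset_closedBall))
  have hsum : ∀ y ∈ closure Ω, ∑ i, ρ i y = 1 := fun y hy => by
    rw [← finsum_eq_sum_of_fintype]; exact ρ.sum_eq_one hy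
  have hpart : ∀ i, ∫ z in Ω, fderiv ℝ (fun y => ρ i y * g y) z e =
      ∫ y, (ρ i y * g y) * inner ℝ e (outwardNormal Ω y) ∂(surfaceMeasure Ω) := by
    intro i
    have hs : tsupport (fun y => ρ i y * g y) ⊆ Metric.ball ((i : closure Ω) : Eucl n) (r i) :=
      (tsupport_mul_subset_left).trans (hρ i)
    have hc : HasCompactSupport (fun y => ρ i y * g y) := (hρc i).mul_right
    rcases hcase i with ⟨ν, K, γ, h⟩ | h
    · exact h.integral_fderiv hΩ.isOpen ((hρs i).mul hg) hc hs e
    · exact integral_fderiv_of_compact_subset hΩ.isOpen ((hρs i).mul hg) hc (hs.trans h) e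
  have hη := hΩ.aemeasurable_outwardNormal
  have hleft : ∫ z in Ω, fderiv ℝ g z e =
      ∑ i, ∫ z in Ω, fderiv ℝ (fun y => ρ i y * g y) z e := by
    rw [← integral_finsetSum]
    · refine setIntegral_congr_fun hΩ.isOpen.measurableSet fun z hz => ?_
      rw [← sum_apply, ← fderiv_fun_sum fun i _ =>
        (((hρs i).mul hg).differentiable one_ne_zero) z]
      congr 1
      -- The partition sums to `1` only on the closure of `Ω`. Openness of `Ω` gives the equality
      -- near `z` needed to compare derivatives.
      refine Filter.EventuallyEq.fderiv_eq ?_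
      filter_upwards [hΩ.isOpen.mem_nhds hz] with y hy
      rw [← Finset.sum_mul, hsum y (subset_closure hy), one_mul]
    · intro i _
      exact ((((hρs i).mul hg).continuous_fderiv one_ne_zero).clm_apply
        continuous_const).integrable_of_hasCompactSupport
          (HasCompactSupport.fderiv_apply ℝ (hρc i).mul_right e) |>.integrableOn
  have hright : ∫ y, g y * inner ℝ e (outwardNormal Ω y) ∂(surfaceMeasure Ω) =
      ∑ i, ∫ y, (ρ i y * g y) * inner ℝ e (outwardNormal Ω y) ∂(surfaceMeasure Ω) := by
    rw [← integral_finsetSum]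
    · refine setIntegral_congr_fun isClosed_frontier.measurableSet fun z hz => ?_
      rw [← Finset.sum_mul, ← Finset.sum_mul, hsum z (frontier_subset_closure hz), one_mul]
    · intro i _
      have hc : Continuous fun y => ρ i y * g y := (hρs i).continuous.mul hg.continuous
      obtain ⟨C, hC⟩ := HasCompactSupport.exists_bound_of_continuous
        (f := fun y => ρ i y * g y) (hρc i).mul_right hc
      refine Integrable.bdd_mul (c := C) ?_ hc.aestronglyMeasurable (ae_of_all _ hC)
      refine Integrable.of_bound (aemeasurable_const.inner hη).aestronglyMeasurable ‖e‖
        (ae_of_all _ fun y => (norm_inner_le_norm _ _).trans ?_)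
      exact mul_le_of_le_one_right (norm_nonneg _) (norm_outwardNormal_le Ω y)
  rw [hleft, hright]
  exact Finset.sum_congr rfl fun i _ => hpart i

end Divergence

/-! ### The truncated Newtonian kernel and the associated approximate identity. -/

section Kernel

variable {n : ℕ}

/-- The Laplacian `Δζ = ∑ᵢ ∂ᵢ∂ᵢζ`. -/
noncomputable def laplace (ζ : Eucl n → ℝ) (y : Eucl n) : ℝ :=
  ∑ i, partialDeriv i (partialDeriv i ζ) y

theorem partialDeriv_comp_normSq {H : ℝ → ℝ} {y : Eucl n} (hH : DifferentiableAt ℝ H (‖y‖ ^ 2))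
    (i : Fin n) :
    partialDeriv i (fun y : Eucl n => H (‖y‖ ^ 2)) y = 2 * y i * deriv H (‖y‖ ^ 2) := by
  have h1 := hH.hasDerivAt.comp_hasFDerivAt y (hasStrictFDerivAt_norm_sq y).hasFDerivAt
  have h2 : fderiv ℝ (fun y : Eucl n => H (‖y‖ ^ 2)) y = _ := h1.fderiv
  rw [partialDeriv, h2]
  have : (inner ℝ y (basisVec i) : ℝ) = y i := by
    simp [basisVec, EuclideanSpace.inner_single_right]
  simp [this]
  ring

theorem partialDeriv_coord_mul {g : Eucl n → ℝ} {y : Eucl n} (hg : DifferentiableAt ℝ g y)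
    (i : Fin n) :
    partialDeriv i (fun y : Eucl n => 2 * y i * g y) y = 2 * g y + 2 * y i * partialDeriv i g y := by
  have hd : HasFDerivAt (fun y : Eucl n => 2 * y i)
      ((2 : ℝ) • (EuclideanSpace.proj (𝕜 := ℝ) i : Eucl n →L[ℝ] ℝ)) y :=
    (EuclideanSpace.proj (𝕜 := ℝ) i : Eucl n →L[ℝ] ℝ).hasFDerivAt.const_mul 2
  rw [partialDeriv_mul hd.differentiableAt hg]
  rw [partialDeriv, partialDeriv, hd.fderiv]
  simp [basisVec]
  ring

theorem laplace_comp_normSq {H : ℝ → ℝ} (hH : ContDiff ℝ ∞ H) (y : Eucl n) :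
    laplace (fun y : Eucl n => H (‖y‖ ^ 2)) y =
      2 * n * deriv H (‖y‖ ^ 2) + 4 * ‖y‖ ^ 2 * deriv (deriv H) (‖y‖ ^ 2) := by
  have hd : Differentiable ℝ H := hH.differentiable (by simp)
  have hd' : Differentiable ℝ (deriv H) :=
    ((contDiff_infty_iff_deriv.1 hH).2).differentiable (by simp)
  have hdd : Differentiable ℝ fun y : Eucl n => deriv H (‖y‖ ^ 2) := by
    intro y
    exact (hd' _).comp y (hasStrictFDerivAt_norm_sq y).differentiableAt
  have e : ∀ i, partialDeriv i (fun y : Eucl n => H (‖y‖ ^ 2)) =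
      fun y => 2 * y i * deriv H (‖y‖ ^ 2) := fun i =>
    funext fun y => partialDeriv_comp_normSq (hd _) i
  simp only [laplace, e]
  have e2 : ∀ i, partialDeriv i (fun y : Eucl n => 2 * y i * deriv H (‖y‖ ^ 2)) y =
      2 * deriv H (‖y‖ ^ 2) + 4 * deriv (deriv H) (‖y‖ ^ 2) * (y i) ^ 2 := by
    intro i
    rw [partialDeriv_coord_mul (hdd y), partialDeriv_comp_normSq (hd' _)]
    ring
  simp only [e2, Finset.sum_add_distrib, ← Finset.mul_sum, Finset.sum_const, Finset.card_univ,
    Fintype.card_fin, nsmul_eq_mul]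
  rw [EuclideanSpace.real_norm_sq_eq]
  ring

theorem sphereArea_eq (n : ℕ) :
    sphereArea n = n * (volume : Measure (Eucl n)).real (Metric.ball 0 1) := by
  rw [sphereArea, Measure.toSphere_apply_univ]
  simp [Measure.real]

theorem sphereArea_pos (hn : 3 ≤ n) : 0 < sphereArea n := by
  rw [sphereArea_eq]
  have : 0 < (volume : Measure (Eucl n)).real (Metric.ball 0 1) :=
    ENNReal.toReal_pos (Metric.measure_ball_pos _ _ one_pos).ne' measure_ball_lt_top.ne
  have : 0 < (n : ℝ) := by positivity
  positivity

/-- A smooth function of `t` that is `0` for `t ≤ 1/2` and `t^{1-n/2}` for `t ≥ 1`. -/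
noncomputable def cutProfile (n : ℕ) (t : ℝ) : ℝ :=
  Real.smoothTransition (2 * t - 1) * t ^ (1 - (n : ℝ) / 2)

theorem cutProfile_of_le {t : ℝ} (ht : t ≤ 1 / 2) : cutProfile n t = 0 := by
  rw [cutProfile, Real.smoothTransition.zero_of_nonpos (by linarith), zero_mul]

theorem cutProfile_of_ge {t : ℝ} (ht : 1 ≤ t) : cutProfile n t = t ^ (1 - (n : ℝ) / 2) := by
  rw [cutProfile, Real.smoothTransition.one_of_one_le (by linarith), one_mul]

theorem abs_cutProfile_le {t : ℝ} (ht : 0 ≤ t) : |cutProfile n t| ≤ t ^ (1 - (n : ℝ) / 2) := by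
  have h0 : 0 ≤ t ^ (1 - (n : ℝ) / 2) := Real.rpow_nonneg ht _
  rw [cutProfile, abs_mul, abs_of_nonneg (Real.smoothTransition.nonneg _), abs_of_nonneg h0]
  exact mul_le_of_le_one_left h0 (Real.smoothTransition.le_one _)

theorem contDiff_cutProfile (n : ℕ) : ContDiff ℝ ∞ (cutProfile n) := by
  rw [contDiff_iff_contDiffAt]
  intro t
  rcases lt_or_ge t (1 / 2) with ht | ht
  · refine (contDiffAt_const (c := (0 : ℝ))).congr_of_eventuallyEq ?_
    filter_upwards [Iio_mem_nhds ht] with s hs using cutProfile_of_le (le_of_lt hs)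
  · refine ContDiffAt.mul ?_ (Real.contDiffAt_rpow_const_of_ne (by linarith))
    exact (Real.smoothTransition.contDiffAt).comp t (by fun_prop)

theorem deriv_cutProfile_of_lt {t : ℝ} (ht : t < 1 / 2) : deriv (cutProfile n) t = 0 := by
  have : cutProfile n =ᶠ[𝓝 t] fun _ => 0 := by
    filter_upwards [Iio_mem_nhds ht] with s hs using cutProfile_of_le (le_of_lt hs)
  rw [this.deriv_eq, deriv_const]

theorem deriv_cutProfile_of_gt {t : ℝ} (ht : 1 < t) :
    deriv (cutProfile n) t = (1 - (n : ℝ) / 2) * t ^ (-((n : ℝ) / 2)) := by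
  have : cutProfile n =ᶠ[𝓝 t] fun t => t ^ (1 - (n : ℝ) / 2) := by
    filter_upwards [Ioi_mem_nhds ht] with s hs using cutProfile_of_ge (le_of_lt hs)
  rw [this.deriv_eq, Real.deriv_rpow_const]
  congr 2
  ring

/-- The derivative vanishes below `1/2`, is explicit above `1`, and in between is bounded while
`t^{-n/2} ≥ 1`. After scaling this yields kernel bounds uniform in `ε`. -/
theorem exists_bound_deriv_cutProfile (n : ℕ) :
    ∃ C, 0 ≤ C ∧ ∀ t, 0 < t → |deriv (cutProfile n) t| ≤ C * t ^ (-((n : ℝ) / 2)) := by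
  have hcont : Continuous (deriv (cutProfile n)) :=
    (contDiff_infty_iff_deriv.1 (contDiff_cutProfile n)).2.continuous
  obtain ⟨M, hM⟩ := (isCompact_Icc (a := (1 / 2 : ℝ)) (b := 1)).exists_bound_of_continuousOn
    hcont.continuousOn
  have hM0 : 0 ≤ M := (norm_nonneg _).trans (hM 1 ⟨by norm_num, le_rfl⟩)
  refine ⟨M + |1 - (n : ℝ) / 2|, by positivity, fun t ht => ?_⟩
  have hp : 0 ≤ t ^ (-((n : ℝ) / 2)) := Real.rpow_nonneg ht.le _
  rcases lt_or_ge t (1 / 2) with h1 | h1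
  · rw [deriv_cutProfile_of_lt h1, abs_zero]; positivity
  rcases lt_or_ge 1 t with h2 | h2
  · rw [deriv_cutProfile_of_gt h2, abs_mul, abs_of_nonneg hp]
    exact mul_le_mul_of_nonneg_right (by linarith) hp
  · refine (hM t ⟨h1, h2⟩).trans ?_
    have : 1 ≤ t ^ (-((n : ℝ) / 2)) :=
      Real.one_le_rpow_of_pos_of_le_one_of_nonpos ht h2 (neg_nonpos.2 (by positivity))
    have h3 : M * 1 ≤ M * t ^ (-((n : ℝ) / 2)) := mul_le_mul_of_nonneg_left this hM0
    nlinarith [abs_nonneg (1 - (n : ℝ) / 2)]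

/-- The constant `1 / (σₙ (n-2))`. -/
noncomputable def newtonConst (n : ℕ) : ℝ := 1 / (sphereArea n * ((n : ℝ) - 2))

theorem newtonConst_pos (hn : 3 ≤ n) : 0 < newtonConst n := by
  have h1 := sphereArea_pos hn
  have h2 : (3 : ℝ) ≤ n := by exact_mod_cast hn
  have : 0 < (n : ℝ) - 2 := by linarith
  unfold newtonConst
  positivity

theorem newtonConst_mul (hn : 3 ≤ n) : newtonConst n * (2 - n) = -(sphereArea n)⁻¹ := by
  have h1 := (sphereArea_pos hn).ne'
  have h2 : (3 : ℝ) ≤ n := by exact_mod_cast hn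
  have : (n : ℝ) - 2 ≠ 0 := by linarith
  unfold newtonConst
  field_simp
  ring

/-- The radial profile of the truncated Newtonian kernel. -/
noncomputable def kernelProfile (n : ℕ) (ε t : ℝ) : ℝ :=
  newtonConst n * (ε ^ (n - 2))⁻¹ * cutProfile n (t / ε ^ 2)

/-- The Newtonian kernel `|y|^{2-n} / (σₙ (n-2))`, smoothly truncated inside the ball of
radius `ε`. -/
noncomputable def cutKernel (n : ℕ) (ε : ℝ) (y : Eucl n) : ℝ := kernelProfile n ε (‖y‖ ^ 2)

theorem contDiff_kernelProfile (n : ℕ) (ε : ℝ) : ContDiff ℝ ∞ (kernelProfile n ε) :=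
  contDiff_const.mul ((contDiff_cutProfile n).comp (contDiff_id.div_const _))

theorem contDiff_cutKernel (n : ℕ) (ε : ℝ) : ContDiff ℝ ∞ (cutKernel n ε) :=
  (contDiff_kernelProfile n ε).comp (contDiff_norm_sq ℝ)

theorem rpow_scale (hn : 3 ≤ n) {ε r : ℝ} (hε : 0 < ε) (hr : 0 ≤ r) :
    (ε ^ (n - 2))⁻¹ * (r ^ 2 / ε ^ 2) ^ (1 - (n : ℝ) / 2) = 1 / r ^ (n - 2) := by
  have e1 : ∀ s : ℝ, 0 ≤ s → (s ^ 2) ^ (1 - (n : ℝ) / 2) = (s ^ (n - 2))⁻¹ := by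
    intro s hs
    rw [← Real.rpow_natCast s (n - 2), ← Real.rpow_neg hs, ← Real.rpow_two, ← Real.rpow_mul hs,
      Nat.cast_sub (by omega)]
    congr 1
    push_cast
    ring
  rw [Real.div_rpow (by positivity) (by positivity), e1 r hr, e1 ε hε.le]
  field_simp

theorem cutKernel_of_ge (hn : 3 ≤ n) {ε : ℝ} (hε : 0 < ε) {y : Eucl n} (hy : ε ≤ ‖y‖) :
    cutKernel n ε y = newtonConst n * (1 / ‖y‖ ^ (n - 2)) := by
  rw [cutKernel, kernelProfile, cutProfile_of_ge, mul_assoc, rpow_scale hn hε (norm_nonneg _)]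
  rw [le_div_iff₀ (by positivity), one_mul]
  exact pow_le_pow_left₀ hε.le hy 2

/-- The bound includes `y = 0`, where both sides are zero: the kernel is cut off there, and the
right side is a division by zero. -/
theorem abs_cutKernel_le (hn : 3 ≤ n) {ε : ℝ} (hε : 0 < ε) (y : Eucl n) :
    |cutKernel n ε y| ≤ newtonConst n * (1 / ‖y‖ ^ (n - 2)) := by
  have hc := newtonConst_pos hn
  rw [← rpow_scale hn hε (norm_nonneg y), cutKernel, kernelProfile, abs_mul, abs_mul,
    abs_of_pos hc, abs_of_pos (by positivity : 0 < (ε ^ (n - 2))⁻¹), mul_assoc]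
  refine mul_le_mul_of_nonneg_left (mul_le_mul_of_nonneg_left ?_ (by positivity)) hc.le
  exact abs_cutProfile_le (by positivity)

theorem cutKernel_eventuallyEq (hn : 3 ≤ n) {ε δ : ℝ} (hε : 0 < ε) (hδ : 0 < δ) {y : Eucl n}
    (hεy : ε < ‖y‖) (hδy : δ < ‖y‖) : cutKernel n ε =ᶠ[𝓝 y] cutKernel n δ := by
  filter_upwards [continuous_norm.continuousAt.eventually (Ioi_mem_nhds hεy),
    continuous_norm.continuousAt.eventually (Ioi_mem_nhds hδy)] with z hz1 hz2
  rw [cutKernel_of_ge hn hε (le_of_lt hz1), cutKernel_of_ge hn hδ (le_of_lt hz2)]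

theorem deriv_kernelProfile {ε : ℝ} (t : ℝ) :
    deriv (kernelProfile n ε) t =
      newtonConst n * (ε ^ (n - 2))⁻¹ * ((ε ^ 2)⁻¹ * deriv (cutProfile n) (t / ε ^ 2)) := by
  have h1 : HasDerivAt (fun t : ℝ => t / ε ^ 2) (1 / ε ^ 2) t := (hasDerivAt_id t).div_const _
  have h2 := ((contDiff_cutProfile n).differentiable (by simp) (t / ε ^ 2)).hasDerivAt.comp t h1
  have h3 : deriv (kernelProfile n ε) t = _ :=
    (h2.const_mul (newtonConst n * (ε ^ (n - 2))⁻¹)).deriv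
  rw [h3]
  ring

theorem partialDeriv_cutKernel {ε : ℝ} (y : Eucl n) (i : Fin n) :
    partialDeriv i (cutKernel n ε) y = 2 * y i * deriv (kernelProfile n ε) (‖y‖ ^ 2) :=
  partialDeriv_comp_normSq ((contDiff_kernelProfile n ε).differentiable (by simp) _) i

theorem rpow_scale' (hn : 3 ≤ n) {ε r : ℝ} (hε : 0 < ε) (hr : 0 < r) :
    (ε ^ (n - 2))⁻¹ * ((ε ^ 2)⁻¹ * (r ^ 2 / ε ^ 2) ^ (-((n : ℝ) / 2))) = (r ^ n)⁻¹ := by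
  have e1 : ∀ s : ℝ, 0 ≤ s → (s ^ 2) ^ (-((n : ℝ) / 2)) = (s ^ n)⁻¹ := by
    intro s hs
    rw [← Real.rpow_natCast s n, ← Real.rpow_neg hs, ← Real.rpow_two, ← Real.rpow_mul hs]
    congr 1
    ring
  have e2 : ε ^ n = ε ^ (n - 2) * ε ^ 2 := by rw [← pow_add]; congr 1; omega
  rw [Real.div_rpow (by positivity) (by positivity), e1 r hr.le, e1 ε hε.le, e2]
  field_simp

theorem partialDeriv_cutKernel_of_gt (hn : 3 ≤ n) {ε : ℝ} (hε : 0 < ε) {y : Eucl n}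
    (hy : ε < ‖y‖) (i : Fin n) : partialDeriv i (cutKernel n ε) y = cauchyKernel y i := by
  have hy0 : 0 < ‖y‖ := hε.trans hy
  have h1 : 1 < ‖y‖ ^ 2 / ε ^ 2 := by
    rw [lt_div_iff₀ (by positivity), one_mul]
    exact pow_lt_pow_left₀ hy hε.le two_ne_zero
  rw [partialDeriv_cutKernel, deriv_kernelProfile, deriv_cutProfile_of_gt h1]
  have e := rpow_scale' hn hε hy0
  have e3 := newtonConst_mul hn
  calc _ = y i * (newtonConst n * (2 - n)) *
      ((ε ^ (n - 2))⁻¹ * ((ε ^ 2)⁻¹ * (‖y‖ ^ 2 / ε ^ 2) ^ (-((n : ℝ) / 2)))) := by ring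
    _ = _ := by
      rw [e, e3, cauchyKernel]
      simp only [PiLp.neg_apply, PiLp.smul_apply, smul_eq_mul, mul_inv]
      ring

/-- The powers of `ε` combine through `rpow_scale'` to exactly `‖y‖^{-n}`, and the factor `y i`
gives back one power. Hence the constant is independent of `ε`. -/
theorem exists_bound_partialDeriv_cutKernel (hn : 3 ≤ n) :
    ∃ C, 0 ≤ C ∧ ∀ ε : ℝ, 0 < ε → ∀ (y : Eucl n) (i : Fin n),
      |partialDeriv i (cutKernel n ε) y| ≤ C * (‖y‖ ^ (n - 1))⁻¹ := by
  obtain ⟨C, hC0, hC⟩ := exists_bound_deriv_cutProfile n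
  have hc := newtonConst_pos hn
  refine ⟨2 * newtonConst n * C, by positivity, fun ε hε y i => ?_⟩
  rcases eq_or_ne y 0 with rfl | hy
  · rw [partialDeriv_cutKernel]
    simp
    positivity
  have hy0 : 0 < ‖y‖ := norm_pos_iff.2 hy
  rw [partialDeriv_cutKernel, deriv_kernelProfile]
  simp only [abs_mul, abs_of_pos hc, abs_of_pos (by positivity : 0 < (ε ^ (n - 2))⁻¹),
    abs_of_pos (by positivity : 0 < (ε ^ 2)⁻¹), abs_two]
  have h2 := hC (‖y‖ ^ 2 / ε ^ 2) (by positivity)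
  have e := rpow_scale' hn hε hy0
  have hyi : |y i| ≤ ‖y‖ := PiLp.norm_apply_le y i
  have epow : ‖y‖ ^ n = ‖y‖ ^ (n - 1) * ‖y‖ := by rw [← pow_succ]; congr 1; omega
  calc _ ≤ 2 * ‖y‖ * (newtonConst n * (ε ^ (n - 2))⁻¹ * ((ε ^ 2)⁻¹ *
        (C * (‖y‖ ^ 2 / ε ^ 2) ^ (-((n : ℝ) / 2))))) := by gcongr
    _ = 2 * ‖y‖ * newtonConst n * C *
        ((ε ^ (n - 2))⁻¹ * ((ε ^ 2)⁻¹ * (‖y‖ ^ 2 / ε ^ 2) ^ (-((n : ℝ) / 2)))) := by ring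
    _ = _ := by
      rw [e, epow]
      field_simp

/-- The approximate identity `-Δ Γ_ε`. -/
noncomputable def cutBump (n : ℕ) (ε : ℝ) (y : Eucl n) : ℝ := -laplace (cutKernel n ε) y

theorem cutBump_eq (ε : ℝ) (y : Eucl n) :
    cutBump n ε y = -(2 * n * deriv (kernelProfile n ε) (‖y‖ ^ 2) +
      4 * ‖y‖ ^ 2 * deriv (deriv (kernelProfile n ε)) (‖y‖ ^ 2)) := by
  rw [cutBump]
  congr 1
  exact laplace_comp_normSq (contDiff_kernelProfile n ε) y

theorem deriv_deriv_kernelProfile {ε : ℝ} (t : ℝ) :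
    deriv (deriv (kernelProfile n ε)) t = newtonConst n * (ε ^ (n - 2))⁻¹ *
      ((ε ^ 2)⁻¹ * ((ε ^ 2)⁻¹ * deriv (deriv (cutProfile n)) (t / ε ^ 2))) := by
  have h0 : deriv (kernelProfile n ε) = fun t => newtonConst n * (ε ^ (n - 2))⁻¹ *
      ((ε ^ 2)⁻¹ * deriv (cutProfile n) (t / ε ^ 2)) := funext fun t => deriv_kernelProfile t
  have h1 : HasDerivAt (fun t : ℝ => t / ε ^ 2) (1 / ε ^ 2) t := (hasDerivAt_id t).div_const _
  have h2 := ((contDiff_infty_iff_deriv.1 (contDiff_cutProfile n)).2.differentiable (by simp)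
    (t / ε ^ 2)).hasDerivAt.comp t h1
  rw [h0]
  refine (((h2.const_mul ((ε ^ 2)⁻¹)).const_mul (newtonConst n * (ε ^ (n - 2))⁻¹)).deriv).trans ?_
  ring

theorem deriv_deriv_cutProfile_of_gt {t : ℝ} (ht : 1 < t) :
    deriv (deriv (cutProfile n)) t =
      (1 - (n : ℝ) / 2) * (-((n : ℝ) / 2) * t ^ (-((n : ℝ) / 2) - 1)) := by
  have : deriv (cutProfile n) =ᶠ[𝓝 t] fun t => (1 - (n : ℝ) / 2) * t ^ (-((n : ℝ) / 2)) := by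
    filter_upwards [Ioi_mem_nhds ht] with s hs using deriv_cutProfile_of_gt hs
  rw [this.deriv_eq, deriv_const_mul_field, Real.deriv_rpow_const]

/-- The profile of `cutBump`. -/
noncomputable def bumpProfile (n : ℕ) (t : ℝ) : ℝ :=
  -(newtonConst n * (2 * n * deriv (cutProfile n) t + 4 * t * deriv (deriv (cutProfile n)) t))

theorem cutBump_eq_scale (hn : 3 ≤ n) {ε : ℝ} (hε : 0 < ε) (y : Eucl n) :
    cutBump n ε y = (ε ^ n)⁻¹ * bumpProfile n (‖y‖ ^ 2 / ε ^ 2) := by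
  have e2 : ε ^ n = ε ^ (n - 2) * ε ^ 2 := by rw [← pow_add]; congr 1; omega
  rw [cutBump_eq, deriv_deriv_kernelProfile, deriv_kernelProfile, bumpProfile, e2]
  field_simp

/-- This is the harmonicity of `|y|^{2-n}` away from the origin, written in the variable `t = |y|²`.
-/
theorem bumpProfile_of_gt {t : ℝ} (ht : 1 < t) : bumpProfile n t = 0 := by
  have ht0 : t ≠ 0 := by positivity
  rw [bumpProfile, deriv_cutProfile_of_gt ht, deriv_deriv_cutProfile_of_gt ht,
    Real.rpow_sub_one ht0]
  field_simp
  ring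

theorem continuous_bumpProfile (n : ℕ) : Continuous (bumpProfile n) := by
  have h1 := (contDiff_infty_iff_deriv.1 (contDiff_cutProfile n)).2
  have h2 := (contDiff_infty_iff_deriv.1 h1).2.continuous
  have h3 := h1.continuous
  unfold bumpProfile
  fun_prop

theorem cutBump_of_gt (hn : 3 ≤ n) {ε : ℝ} (hε : 0 < ε) {y : Eucl n} (hy : ε < ‖y‖) :
    cutBump n ε y = 0 := by
  rw [cutBump_eq_scale hn hε, bumpProfile_of_gt, mul_zero]
  rw [lt_div_iff₀ (by positivity), one_mul]
  exact pow_lt_pow_left₀ hy hε.le two_ne_zero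

theorem continuous_cutBump (hn : 3 ≤ n) {ε : ℝ} (hε : 0 < ε) : Continuous (cutBump n ε) := by
  have : cutBump n ε = fun y => (ε ^ n)⁻¹ * bumpProfile n (‖y‖ ^ 2 / ε ^ 2) :=
    funext fun y => cutBump_eq_scale hn hε y
  rw [this]
  have := continuous_bumpProfile n
  fun_prop

theorem exists_bound_cutBump (hn : 3 ≤ n) :
    ∃ C, 0 ≤ C ∧ ∀ ε : ℝ, 0 < ε → ∀ y : Eucl n, |cutBump n ε y| ≤ C * (ε ^ n)⁻¹ := by
  obtain ⟨M, hM⟩ := (isCompact_Icc (a := (0 : ℝ)) (b := 1)).exists_bound_of_continuousOn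
    (continuous_bumpProfile n).continuousOn
  have hM0 : 0 ≤ M := (norm_nonneg _).trans (hM 1 ⟨by norm_num, le_rfl⟩)
  refine ⟨M, hM0, fun ε hε y => ?_⟩
  have hp : 0 < (ε ^ n)⁻¹ := by positivity
  rw [cutBump_eq_scale hn hε, abs_mul, abs_of_pos hp, mul_comm]
  refine mul_le_mul_of_nonneg_right ?_ hp.le
  rcases lt_or_ge 1 (‖y‖ ^ 2 / ε ^ 2) with h | h
  · rw [bumpProfile_of_gt h, abs_zero]; exact hM0
  · exact hM _ ⟨by positivity, h⟩

/-- In polar coordinates the integrand is the derivative of the flux density `P(r) = -r^{n-1}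
∂ᵣΓ_ε`. It is `0` at the origin and `1/σₙ` beyond `ε`, and the angular integration contributes `σₙ`.
-/
theorem integral_cutBump (hn : 3 ≤ n) {ε : ℝ} (hε : 0 < ε) :
    ∫ y : Eucl n, cutBump n ε y = 1 := by
  let h : ℝ → ℝ := fun r => -(2 * n * deriv (kernelProfile n ε) (r ^ 2) +
      4 * r ^ 2 * deriv (deriv (kernelProfile n ε)) (r ^ 2))
  have hnt : Nontrivial (Eucl n) := by
    refine Module.nontrivial_of_finrank_pos (R := ℝ) ?_
    rw [finrank_euclideanSpace_fin]
    omega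
  have hpol := integral_fun_norm_addHaar (volume : Measure (Eucl n)) h
  have e0 : ∀ y : Eucl n, cutBump n ε y = h ‖y‖ := fun y => cutBump_eq ε y
  have hd1 := (contDiff_infty_iff_deriv.1 (contDiff_kernelProfile n ε)).2
  have hd2 := (contDiff_infty_iff_deriv.1 hd1).2
  have c1 := hd1.continuous
  have c2 := hd2.continuous
  let P : ℝ → ℝ := fun r => -(2 * r ^ n * deriv (kernelProfile n ε) (r ^ 2))
  have hP : ∀ r, HasDerivAt P (r ^ (n - 1) * h r) r := by
    intro r
    have h1 : HasDerivAt (fun r : ℝ => r ^ 2) (2 * r) r := by simpa using hasDerivAt_pow 2 r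
    have h2 := ((hd1.differentiable (by simp)) (r ^ 2)).hasDerivAt.comp r h1
    have h3 := (((hasDerivAt_pow n r).const_mul 2).mul h2).neg
    refine h3.congr_deriv ?_
    have epow : r ^ n = r ^ (n - 1) * r := by rw [← pow_succ]; congr 1; omega
    simp only [h, Function.comp, epow]
    ring
  have hP0 : P 0 = 0 := by simp [P, show n ≠ 0 by omega]
  have hPε : ∀ r, ε < r → P r = (sphereArea n)⁻¹ := by
    intro r hr
    have hr0 : 0 < r := hε.trans hr
    have h1 : 1 < r ^ 2 / ε ^ 2 := by
      rw [lt_div_iff₀ (by positivity), one_mul]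
      exact pow_lt_pow_left₀ hr hε.le two_ne_zero
    simp only [P]
    rw [deriv_kernelProfile, deriv_cutProfile_of_gt h1]
    have e := rpow_scale' hn hε hr0
    have e3 := newtonConst_mul hn
    calc _ = -(newtonConst n * (2 - n)) * r ^ n *
        ((ε ^ (n - 2))⁻¹ * ((ε ^ 2)⁻¹ * (r ^ 2 / ε ^ 2) ^ (-((n : ℝ) / 2)))) := by ring
      _ = _ := by
        rw [e, e3, neg_neg, mul_assoc, mul_inv_cancel₀ (by positivity), mul_one]
  have hPlim : Tendsto P atTop (𝓝 (sphereArea n)⁻¹) := by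
    refine tendsto_const_nhds.congr' ?_
    filter_upwards [eventually_gt_atTop ε] with r hr using (hPε r hr).symm
  have hzero : ∀ r, ε < r → r ^ (n - 1) * h r = 0 := by
    intro r hr
    have : P =ᶠ[𝓝 r] fun _ => (sphereArea n)⁻¹ := by
      filter_upwards [Ioi_mem_nhds hr] with s hs using hPε s hs
    rw [← (hP r).deriv, this.deriv_eq, deriv_const]
  have hcont : Continuous fun r => r ^ (n - 1) * h r := by
    simp only [h]; fun_prop
  have hint : IntegrableOn (fun r => r ^ (n - 1) * h r) (Ioi 0) := by
    have : Integrable fun r => (Icc (0 : ℝ) ε).indicator (fun r => r ^ (n - 1) * h r) r :=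
      (hcont.continuousOn.integrableOn_compact isCompact_Icc).integrable_indicator measurableSet_Icc
    refine this.integrableOn.congr_fun ?_ measurableSet_Ioi
    intro r hr
    by_cases hrε : r ≤ ε
    · exact indicator_of_mem (show r ∈ Icc 0 ε from ⟨le_of_lt hr, hrε⟩) _
    · refine (indicator_of_notMem (fun hc => hrε hc.2) _).trans ?_
      exact (hzero r (not_le.1 hrε)).symm
  have hI := integral_Ioi_of_hasDerivAt_of_tendsto (hP 0).continuousAt.continuousWithinAt
    (fun r _ => hP r) hint hPlim
  simp only [e0]
  rw [hpol]
  simp only [finrank_euclideanSpace_fin, smul_eq_mul, nsmul_eq_mul]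
  rw [hI, hP0, sub_zero, ← mul_assoc, ← sphereArea_eq, mul_inv_cancel₀ (sphereArea_pos hn).ne']

end Kernel

/-! ### Integration by parts for traces and normal traces. -/

section Green

theorem tendsto_integral_mul_of_L1 {α : Type*} [MeasurableSpace α] {μ : Measure α} {b a : α → ℝ}
    {F : ℕ → α → ℝ} {C : ℝ} (hb : AEStronglyMeasurable b μ) (hbC : ∀ᵐ x ∂μ, ‖b x‖ ≤ C)
    (ha : Integrable a μ) (hF : ∀ k, Integrable (F k) μ)
    (h : Tendsto (fun k => ∫⁻ x, ‖F k x - a x‖ₑ ∂μ) atTop (𝓝 0)) :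
    Tendsto (fun k => ∫ x, b x * F k x ∂μ) atTop (𝓝 (∫ x, b x * a x ∂μ)) := by
  refine tendsto_integral_of_L1 _ (ha.bdd_mul hb hbC).1
    (Eventually.of_forall fun k => (hF k).bdd_mul hb hbC) ?_
  have h2 : Tendsto (fun k => ENNReal.ofReal C * ∫⁻ x, ‖F k x - a x‖ₑ ∂μ) atTop (𝓝 0) := by
    simpa using ENNReal.Tendsto.const_mul h (Or.inr ENNReal.ofReal_ne_top)
  refine tendsto_of_tendsto_of_tendsto_of_le_of_le tendsto_const_nhds h2 (fun _ => zero_le)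
    fun k => ?_
  rw [← lintegral_const_mul' _ _ ENNReal.ofReal_ne_top]
  refine lintegral_mono_ae ?_
  filter_upwards [hbC] with x hx
  rw [← mul_sub, enorm_mul]
  refine mul_le_mul_left ?_ _
  rw [← ofReal_norm]
  exact ENNReal.ofReal_le_ofReal hx

theorem tendsto_L1_of_norm_le {α V : Type*} [MeasurableSpace α] {μ : Measure α}
    [NormedAddCommGroup V] {F : ℕ → α → V} {a : α → V} {f : ℕ → α → ℝ} {b : α → ℝ}
    (h : Tendsto (fun k => ∫⁻ x, ‖F k x - a x‖ₑ ∂μ) atTop (𝓝 0))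
    (hle : ∀ k x, ‖f k x - b x‖ ≤ ‖F k x - a x‖) :
    Tendsto (fun k => ∫⁻ x, ‖f k x - b x‖ₑ ∂μ) atTop (𝓝 0) :=
  tendsto_of_tendsto_of_tendsto_of_le_of_le tendsto_const_nhds h (fun _ => zero_le)
    fun k => lintegral_mono fun x => enorm_le_iff_norm_le.2 (hle k x)

variable {n : ℕ} {Ω : Set (Eucl n)}

theorem continuous_partialDeriv {v : Eucl n → ℝ} (hv : ContDiff ℝ 1 v) (i : Fin n) :
    Continuous (partialDeriv i v) :=
  (hv.continuous_fderiv one_ne_zero).clm_apply continuous_const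

theorem contDiff_partialDeriv {v : Eucl n → ℝ} (hv : ContDiff ℝ ∞ v) (i : Fin n) :
    ContDiff ℝ ∞ (partialDeriv i v) :=
  (hv.fderiv_right (m := ∞) (by simp)).clm_apply contDiff_const

theorem gradient_apply (v : Eucl n → ℝ) (y : Eucl n) (i : Fin n) :
    gradient v y i = partialDeriv i v y := by
  rw [partialDeriv, ← inner_gradient, basisVec, EuclideanSpace.inner_single_right]
  simp

theorem partialDeriv_coord {V : Eucl n → Eucl n} (hV : ContDiff ℝ 1 V) (i j : Fin n) (y : Eucl n) :
    partialDeriv i (fun z => V z j) y = fderiv ℝ V y (basisVec i) j := by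
  have h := (EuclideanSpace.proj (𝕜 := ℝ) j : Eucl n →L[ℝ] ℝ).hasFDerivAt.comp y
    ((hV.differentiable one_ne_zero) y).hasFDerivAt
  have h2 : fderiv ℝ (fun z => V z j) y = _ := h.fderiv
  rw [partialDeriv, h2]
  rfl

theorem divergence_eq {V : Eucl n → Eucl n} (hV : ContDiff ℝ 1 V) (y : Eucl n) :
    divergence V y = ∑ i, partialDeriv i (fun z => V z i) y :=
  Finset.sum_congr rfl fun i _ => (partialDeriv_coord hV i i y).symm

theorem contDiff_coord {V : Eucl n → Eucl n} (hV : ContDiff ℝ 1 V) (i : Fin n) :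
    ContDiff ℝ 1 fun z => V z i :=
  (EuclideanSpace.proj (𝕜 := ℝ) i : Eucl n →L[ℝ] ℝ).contDiff.comp hV

theorem inner_basisVec_left (i : Fin n) (y : Eucl n) : inner ℝ (basisVec i) y = y i := by
  rw [basisVec, EuclideanSpace.inner_single_left]
  simp

theorem inner_eq_sum (a b : Eucl n) : inner ℝ a b = ∑ i, a i * b i := by
  rw [PiLp.inner_apply]
  exact Finset.sum_congr rfl fun i _ => by simp [mul_comm]

theorem integrableOn_of_continuous (hΩ : IsLipschitzDomain Ω) {g : Eucl n → ℝ}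
    (hg : Continuous g) : IntegrableOn g Ω :=
  (hg.continuousOn.integrableOn_compact hΩ.isBounded.isCompact_closure).mono_set subset_closure

theorem integrableOn_mul_of_continuous (hΩ : IsLipschitzDomain Ω) {g h : Eucl n → ℝ}
    (hg : Continuous g) (hh : Continuous h) : IntegrableOn (fun y => g y * h y) Ω :=
  integrableOn_of_continuous hΩ (hg.mul hh)

theorem exists_bound_of_continuous (hΩ : IsLipschitzDomain Ω) {g : Eucl n → ℝ}
    (hg : Continuous g) : ∃ C, ∀ y ∈ closure Ω, ‖g y‖ ≤ C :=
  hΩ.isBounded.isCompact_closure.exists_bound_of_continuousOn hg.continuousOn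

theorem integrable_surface_of_continuous (hΩ : IsLipschitzDomain Ω) {g : Eucl n → ℝ}
    (hg : Continuous g) : Integrable g (surfaceMeasure Ω) := by
  have := hΩ.isFiniteMeasure
  obtain ⟨C, hC⟩ := exists_bound_of_continuous hΩ hg
  refine Integrable.of_bound hg.aestronglyMeasurable C ?_
  exact (ae_restrict_mem isClosed_frontier.measurableSet).mono fun y hy =>
    hC y (frontier_subset_closure hy)

theorem aestronglyMeasurable_outwardNormal_coord (hΩ : IsLipschitzDomain Ω) (i : Fin n) :
    AEStronglyMeasurable (fun y => outwardNormal Ω y i) (surfaceMeasure Ω) :=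
  (EuclideanSpace.proj (𝕜 := ℝ) i).continuous.comp_aestronglyMeasurable
    hΩ.aemeasurable_outwardNormal.aestronglyMeasurable

theorem norm_outwardNormal_coord_le (Ω : Set (Eucl n)) (y : Eucl n) (i : Fin n) :
    ‖outwardNormal Ω y i‖ ≤ 1 :=
  (PiLp.norm_apply_le _ i).trans (norm_outwardNormal_le Ω y)

theorem integrable_mul_outwardNormal (hΩ : IsLipschitzDomain Ω) {g : Eucl n → ℝ}
    (hg : Integrable g (surfaceMeasure Ω)) (i : Fin n) :
    Integrable (fun y => g y * outwardNormal Ω y i) (surfaceMeasure Ω) :=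
  (hg.bdd_mul (aestronglyMeasurable_outwardNormal_coord hΩ i)
    (ae_of_all _ fun y => norm_outwardNormal_coord_le Ω y i)).congr
      (ae_of_all _ fun _ => mul_comm _ _)

/-- Divergence theorem for a product. -/
theorem IsLipschitzDomain.integral_mul_add (hΩ : IsLipschitzDomain Ω) {g h : Eucl n → ℝ}
    (hg : ContDiff ℝ 1 g) (hh : ContDiff ℝ 1 h) (i : Fin n) :
    (∫ y in Ω, g y * partialDeriv i h y) + ∫ y in Ω, partialDeriv i g y * h y =
      ∫ y, g y * (h y * outwardNormal Ω y i) ∂(surfaceMeasure Ω) := by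
  have h1 := hΩ.integral_fderiv (hg.mul hh) (basisVec i)
  rw [← integral_add (integrableOn_mul_of_continuous hΩ hg.continuous
      (continuous_partialDeriv hh i))
    (integrableOn_mul_of_continuous hΩ (continuous_partialDeriv hg i) hh.continuous)]
  calc _ = _ := integral_congr_ae (ae_of_all _ fun y => ?_)
    _ = _ := h1
    _ = _ := integral_congr_ae (ae_of_all _ fun y => ?_)
  · have := partialDeriv_mul ((hg.differentiable one_ne_zero) y)
      ((hh.differentiable one_ne_zero) y) i
    rw [partialDeriv] at this
    rw [this]
    ring
  · simp only [inner_basisVec_left]; ring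

/-- The integration by parts formula for the normal trace. -/
theorem integral_mul_normalTrace (hΩ : IsLipschitzDomain Ω) {G : Eucl n → Eucl n}
    (hG : ∀ i, IntegrableOn (fun y => G y i) Ω) {ψ d : Eucl n → ℝ}
    {V : ℕ → Eucl n → Eucl n} (hψ : Integrable ψ (surfaceMeasure Ω)) (hd : IntegrableOn d Ω)
    (hV : ∀ k, ContDiff ℝ 1 (V k))
    (h1 : Tendsto (fun k => ∫⁻ y in Ω, ‖V k y - G y‖ₑ) atTop (𝓝 0))
    (h2 : Tendsto (fun k => ∫⁻ y in Ω, ‖divergence (V k) y - d y‖ₑ) atTop (𝓝 0))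
    (h3 : Tendsto (fun k => ∫⁻ y, ‖inner ℝ (V k y) (outwardNormal Ω y) - ψ y‖ₑ
      ∂(surfaceMeasure Ω)) atTop (𝓝 0)) {Θ : Eucl n → ℝ} (hΘ : ContDiff ℝ 1 Θ) :
    (∫ y in Ω, Θ y * d y) + ∑ i, ∫ y in Ω, partialDeriv i Θ y * G y i =
      ∫ y, Θ y * ψ y ∂(surfaceMeasure Ω) := by
  have := hΩ.isFiniteMeasure
  obtain ⟨C, hC⟩ := exists_bound_of_continuous hΩ hΘ.continuous
  have hCΩ : ∀ᵐ y ∂(volume.restrict Ω), ‖Θ y‖ ≤ C :=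
    (ae_restrict_mem hΩ.isOpen.measurableSet).mono fun y hy => hC y (subset_closure hy)
  have hCS : ∀ᵐ y ∂(surfaceMeasure Ω), ‖Θ y‖ ≤ C :=
    (ae_restrict_mem isClosed_frontier.measurableSet).mono fun y hy =>
      hC y (frontier_subset_closure hy)
  have hVc : ∀ k i, ContDiff ℝ 1 fun z => V k z i := fun k i => contDiff_coord (hV k) i
  have hdivc : ∀ k, Continuous (divergence (V k)) := fun k => by
    rw [funext (divergence_eq (hV k))]
    exact continuous_finsetSum _ fun i _ => continuous_partialDeriv (hVc k i) i
  have hnorm : ∀ k, Integrable (fun y => inner ℝ (V k y) (outwardNormal Ω y)) (surfaceMeasure Ω) := by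
    intro k
    simp only [inner_eq_sum]
    exact integrable_finsetSum _ fun i _ => integrable_mul_outwardNormal hΩ
      (integrable_surface_of_continuous hΩ (hVc k i).continuous) i
  have key : ∀ k, (∫ y in Ω, Θ y * divergence (V k) y) +
      ∑ i, ∫ y in Ω, partialDeriv i Θ y * V k y i =
      ∫ y, Θ y * inner ℝ (V k y) (outwardNormal Ω y) ∂(surfaceMeasure Ω) := by
    intro k
    simp only [divergence_eq (hV k), inner_eq_sum, Finset.mul_sum]
    rw [integral_finsetSum _ fun i _ => integrableOn_mul_of_continuous hΩ
        hΘ.continuous (continuous_partialDeriv (hVc k i) i),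
      integral_finsetSum _ fun i _ => ?_, ← Finset.sum_add_distrib]
    · exact Finset.sum_congr rfl fun i _ => hΩ.integral_mul_add hΘ (hVc k i) i
    · exact (integrable_mul_outwardNormal hΩ
        (integrable_surface_of_continuous hΩ (hVc k i).continuous) i).bdd_mul
          hΘ.continuous.aestronglyMeasurable hCS
  refine tendsto_nhds_unique (Tendsto.congr key ?_)
    (tendsto_integral_mul_of_L1 hΘ.continuous.aestronglyMeasurable hCS hψ hnorm h3)
  refine (tendsto_integral_mul_of_L1 hΘ.continuous.aestronglyMeasurable hCΩ hd
    (fun k => integrableOn_of_continuous hΩ (hdivc k)) h2).add (tendsto_finsetSum _ fun i _ => ?_)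
  obtain ⟨C', hC'⟩ := exists_bound_of_continuous hΩ (continuous_partialDeriv hΘ i)
  exact tendsto_integral_mul_of_L1 (continuous_partialDeriv hΘ i).aestronglyMeasurable
    ((ae_restrict_mem hΩ.isOpen.measurableSet).mono fun y hy => hC' y (subset_closure hy))
    (hG i) (fun k => integrableOn_of_continuous hΩ (hVc k i).continuous)
    (tendsto_L1_of_norm_le h1 fun k y => by
      simpa using PiLp.norm_apply_le (V k y - G y) i)

/-- The integration by parts formula for the trace. -/
theorem HasTrace.integral_mul (hΩ : IsLipschitzDomain Ω) {u φ : Eucl n → ℝ} {G : Eucl n → Eucl n}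
    (hu : IntegrableOn u Ω) (hG : ∀ i, IntegrableOn (fun y => G y i) Ω) (h : HasTrace Ω u G φ)
    {g : Eucl n → ℝ} (hg : ContDiff ℝ 1 g) (i : Fin n) :
    (∫ y in Ω, g y * G y i) + ∫ y in Ω, partialDeriv i g y * u y =
      ∫ y, g y * (φ y * outwardNormal Ω y i) ∂(surfaceMeasure Ω) := by
  have := hΩ.isFiniteMeasure
  obtain ⟨hφ, v, hv, h1, h2, h3⟩ := h
  obtain ⟨C, hC⟩ := exists_bound_of_continuous hΩ hg.continuous
  have hCΩ : ∀ᵐ y ∂(volume.restrict Ω), ‖g y‖ ≤ C :=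
    (ae_restrict_mem hΩ.isOpen.measurableSet).mono fun y hy => hC y (subset_closure hy)
  have hCS : ∀ᵐ y ∂(surfaceMeasure Ω), ‖g y‖ ≤ C :=
    (ae_restrict_mem isClosed_frontier.measurableSet).mono fun y hy =>
      hC y (frontier_subset_closure hy)
  obtain ⟨C', hC'⟩ := exists_bound_of_continuous hΩ (continuous_partialDeriv hg i)
  refine tendsto_nhds_unique (Tendsto.congr (fun k => hΩ.integral_mul_add hg (hv k) i) ?_)
    (tendsto_integral_mul_of_L1 hg.continuous.aestronglyMeasurable hCS
      (integrable_mul_outwardNormal hΩ hφ i) (fun k => integrable_mul_outwardNormal hΩ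
        (integrable_surface_of_continuous hΩ (hv k).continuous) i)
      (tendsto_L1_of_norm_le h3 fun k y => ?_))
  · refine Tendsto.add ?_ ?_
    · exact tendsto_integral_mul_of_L1 hg.continuous.aestronglyMeasurable hCΩ (hG i)
        (fun k => integrableOn_of_continuous hΩ (continuous_partialDeriv (hv k) i))
        (tendsto_L1_of_norm_le h2 fun k y => by
          simpa [gradient_apply] using PiLp.norm_apply_le (gradient (v k) y - G y) i)
    · exact tendsto_integral_mul_of_L1 (continuous_partialDeriv hg i).aestronglyMeasurable
        ((ae_restrict_mem hΩ.isOpen.measurableSet).mono fun y hy => hC' y (subset_closure hy))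
        hu (fun k => integrableOn_of_continuous hΩ (hv k).continuous) h1
  · rw [← sub_mul, norm_mul]
    exact mul_le_of_le_one_right (norm_nonneg _) (norm_outwardNormal_coord_le Ω y i)

/-- The limit of the divergences in the definition of the normal trace is the weak divergence. -/
theorem hasWeakDivergence_of_tendsto (hΩ : IsLipschitzDomain Ω) {G : Eucl n → Eucl n}
    (hG : ∀ i, IntegrableOn (fun y => G y i) Ω) {ψ d : Eucl n → ℝ}
    {V : ℕ → Eucl n → Eucl n} (hψ : Integrable ψ (surfaceMeasure Ω)) (hd : IntegrableOn d Ω)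
    (hV : ∀ k, ContDiff ℝ 1 (V k))
    (h1 : Tendsto (fun k => ∫⁻ y in Ω, ‖V k y - G y‖ₑ) atTop (𝓝 0))
    (h2 : Tendsto (fun k => ∫⁻ y in Ω, ‖divergence (V k) y - d y‖ₑ) atTop (𝓝 0))
    (h3 : Tendsto (fun k => ∫⁻ y, ‖inner ℝ (V k y) (outwardNormal Ω y) - ψ y‖ₑ
      ∂(surfaceMeasure Ω)) atTop (𝓝 0)) :
    HasWeakDivergence Ω (fun i y => G y i) d where
  integrableOn := hG
  integrableOn_div := hd
  integral_eq ζ hζ := by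
    have h := integral_mul_normalTrace hΩ hG hψ hd hV h1 h2 h3
      (hζ.contDiff.of_le (by exact_mod_cast le_top))
    have h0 : ∫ y, ζ y * ψ y ∂(surfaceMeasure Ω) = 0 := by
      refine setIntegral_eq_zero_of_forall_eq_zero fun y hy => ?_
      rw [hΩ.isOpen.frontier_eq] at hy
      rw [image_eq_zero_of_notMem_tsupport fun hc => hy.2 (hζ.tsupport_subset hc), zero_mul]
    rw [h0, ← integral_finsetSum _ fun i _ => (hζ.partialDeriv i).integrable_mul (hG i)] at h
    simp only [mul_comm (partialDeriv _ _ _)] at h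
    linarith

end Green

/-! ### Green's identity and the formula with the truncated kernel. -/

section Representation

variable {n : ℕ} {Ω : Set (Eucl n)}

/-- Green's second identity. -/
theorem green_identity (hΩ : IsLipschitzDomain Ω) {u φ : Eucl n → ℝ} {G : Eucl n → Eucl n}
    (hu : IntegrableOn u Ω) (hG : ∀ i, IntegrableOn (fun y => G y i) Ω) (hφ : HasTrace Ω u G φ)
    {ψ d : Eucl n → ℝ} {V : ℕ → Eucl n → Eucl n} (hψ : Integrable ψ (surfaceMeasure Ω))
    (hd : IntegrableOn d Ω) (hV : ∀ k, ContDiff ℝ 1 (V k))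
    (h1 : Tendsto (fun k => ∫⁻ y in Ω, ‖V k y - G y‖ₑ) atTop (𝓝 0))
    (h2 : Tendsto (fun k => ∫⁻ y in Ω, ‖divergence (V k) y - d y‖ₑ) atTop (𝓝 0))
    (h3 : Tendsto (fun k => ∫⁻ y, ‖inner ℝ (V k y) (outwardNormal Ω y) - ψ y‖ₑ
      ∂(surfaceMeasure Ω)) atTop (𝓝 0)) {Θ : Eucl n → ℝ} (hΘ : ContDiff ℝ ∞ Θ) :
    Integrable (fun y => Θ y * ψ y - ∑ i, partialDeriv i Θ y * (φ y * outwardNormal Ω y i))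
      (surfaceMeasure Ω) ∧
    ∫ y, (Θ y * ψ y - ∑ i, partialDeriv i Θ y * (φ y * outwardNormal Ω y i)) ∂(surfaceMeasure Ω) =
      (∫ y in Ω, Θ y * d y) - ∫ y in Ω, laplace Θ y * u y := by
  have hΘ1 : ContDiff ℝ 1 Θ := hΘ.of_le (by exact_mod_cast le_top)
  have hpd : ∀ i, ContDiff ℝ ∞ (partialDeriv i Θ) := fun i => contDiff_partialDeriv hΘ i
  have hpd1 : ∀ i, ContDiff ℝ 1 (partialDeriv i Θ) := fun i =>
    (hpd i).of_le (by exact_mod_cast le_top)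
  have bddS : ∀ {g h : Eucl n → ℝ}, Continuous g → Integrable h (surfaceMeasure Ω) →
      Integrable (fun y => g y * h y) (surfaceMeasure Ω) := by
    intro g h hg hh
    obtain ⟨C, hC⟩ := exists_bound_of_continuous hΩ hg
    exact hh.bdd_mul hg.aestronglyMeasurable
      ((ae_restrict_mem isClosed_frontier.measurableSet).mono fun y hy =>
        hC y (frontier_subset_closure hy))
  have bddΩ : ∀ {g h : Eucl n → ℝ}, Continuous g → IntegrableOn h Ω →
      IntegrableOn (fun y => g y * h y) Ω := by
    intro g h hg hh
    obtain ⟨C, hC⟩ := exists_bound_of_continuous hΩ hg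
    exact hh.bdd_mul hg.aestronglyMeasurable
      ((ae_restrict_mem hΩ.isOpen.measurableSet).mono fun y hy => hC y (subset_closure hy))
  have iψ := bddS hΘ.continuous hψ
  have iφ := fun i => bddS (hpd i).continuous (integrable_mul_outwardNormal hΩ hφ.1 i)
  refine ⟨iψ.sub (integrable_finsetSum _ fun i _ => iφ i), ?_⟩
  have hl : ∫ y in Ω, laplace Θ y * u y = ∑ i, ∫ y in Ω, partialDeriv i (partialDeriv i Θ) y * u y := by
    simp only [laplace, Finset.sum_mul]
    exact integral_finsetSum _ fun i _ => bddΩ (contDiff_partialDeriv (hpd i) i).continuous hu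
  -- The normal-trace formula is used with `Θ` and the trace formula with each `∂ᵢΘ`. The integrals
  -- of `∇Θ·∇u` then cancel.
  rw [integral_sub iψ (integrable_finsetSum _ fun i _ => iφ i), integral_finsetSum _ fun i _ => iφ i,
    ← integral_mul_normalTrace hΩ hG hψ hd hV h1 h2 h3 hΘ1, hl]
  simp only [← hφ.integral_mul hΩ hu hG (hpd1 _), Finset.sum_add_distrib]
  ring

theorem partialDeriv_comp_sub (F : Eucl n → ℝ) (x y : Eucl n) (i : Fin n) :
    partialDeriv i (fun y => F (y - x)) y = partialDeriv i F (y - x) := by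
  rw [partialDeriv, fderiv_comp_sub]; rfl

theorem laplace_comp_sub (F : Eucl n → ℝ) (x y : Eucl n) :
    laplace (fun y => F (y - x)) y = laplace F (y - x) := by
  simp only [laplace]
  refine Finset.sum_congr rfl fun i _ => ?_
  have : partialDeriv i (fun y => F (y - x)) = fun y => partialDeriv i F (y - x) :=
    funext fun y => partialDeriv_comp_sub F x y i
  rw [this, partialDeriv_comp_sub]

theorem contDiff_comp_sub {F : Eucl n → ℝ} (hF : ContDiff ℝ ∞ F) (x : Eucl n) :
    ContDiff ℝ ∞ fun y => F (y - x) :=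
  hF.comp (contDiff_id.sub contDiff_const)

/-- The representation formula with the truncated kernel. -/
theorem boundaryIntegrand_integral (hn : 3 ≤ n) (hΩ : IsLipschitzDomain Ω) {u φ : Eucl n → ℝ}
    {G : Eucl n → Eucl n}
    (hu : IntegrableOn u Ω) (hG : ∀ i, IntegrableOn (fun y => G y i) Ω) (hφ : HasTrace Ω u G φ)
    {ψ d : Eucl n → ℝ} {V : ℕ → Eucl n → Eucl n} (hψ : Integrable ψ (surfaceMeasure Ω))
    (hd : IntegrableOn d Ω) (hV : ∀ k, ContDiff ℝ 1 (V k))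
    (h1 : Tendsto (fun k => ∫⁻ y in Ω, ‖V k y - G y‖ₑ) atTop (𝓝 0))
    (h2 : Tendsto (fun k => ∫⁻ y in Ω, ‖divergence (V k) y - d y‖ₑ) atTop (𝓝 0))
    (h3 : Tendsto (fun k => ∫⁻ y, ‖inner ℝ (V k y) (outwardNormal Ω y) - ψ y‖ₑ
      ∂(surfaceMeasure Ω)) atTop (𝓝 0)) {x : Eucl n} {ε : ℝ} (hε : 0 < ε)
    (hx : ∀ y ∈ frontier Ω, ε < ‖y - x‖) :
    Integrable (boundaryIntegrand Ω φ ψ x) (surfaceMeasure Ω) ∧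
    ∫ y, boundaryIntegrand Ω φ ψ x y ∂(surfaceMeasure Ω) =
      (∫ y in Ω, cutKernel n ε (y - x) * d y) + ∫ y in Ω, cutBump n ε (y - x) * u y := by
  have h := green_identity hΩ hu hG hφ hψ hd hV h1 h2 h3
    (contDiff_comp_sub (contDiff_cutKernel n ε) x)
  -- All boundary points are farther than `ε` from `x`, where `Γ_ε` is the Newtonian kernel and its
  -- gradient is the Cauchy kernel.
  have hae : (fun y => cutKernel n ε (y - x) * ψ y -
      ∑ i, partialDeriv i (fun y => cutKernel n ε (y - x)) y * (φ y * outwardNormal Ω y i))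
      =ᵐ[surfaceMeasure Ω] boundaryIntegrand Ω φ ψ x := by
    filter_upwards [ae_restrict_mem isClosed_frontier.measurableSet] with y hy
    have hy' := hx y hy
    simp only [partialDeriv_comp_sub, partialDeriv_cutKernel_of_gt hn hε hy',
      cutKernel_of_ge hn hε hy'.le, boundaryIntegrand, inner_eq_sum, newtonConst, norm_sub_rev x y]
    have : ∑ i, cauchyKernel (y - x) i * (φ y * outwardNormal Ω y i) =
        (∑ i, cauchyKernel (y - x) i * outwardNormal Ω y i) * φ y := by
      rw [Finset.sum_mul]
      exact Finset.sum_congr rfl fun i _ => by ring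
    rw [this]
    ring
  refine ⟨h.1.congr hae, ?_⟩
  rw [← integral_congr_ae hae, h.2, sub_eq_add_neg, ← integral_neg]
  simp only [laplace_comp_sub, cutBump, neg_mul]

/-- The mollifications `∫ ρ_ε(y - x) u(y) dy` converge to `u(x)` at almost every `x`. -/
theorem ae_tendsto_integral_cutBump (hn : 3 ≤ n) {u : Eucl n → ℝ} (hu : LocallyIntegrable u) :
    ∀ᵐ x, Tendsto (fun ε => ∫ y, cutBump n ε (y - x) * u y) (𝓝[>] 0) (𝓝 (u x)) := by
  obtain ⟨C, hC0, hC⟩ := exists_bound_cutBump hn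
  filter_upwards [(Besicovitch.vitaliFamily (volume : Measure (Eucl n))).ae_tendsto_average_norm_sub
    hu] with x hx
  have h1 := hx.comp (Besicovitch.tendsto_filterAt volume x)
  have hpos : ∀ᶠ ε : ℝ in 𝓝[>] 0, 0 < ε := self_mem_nhdsWithin
  -- Convergence at Lebesgue points. Positivity of the bump is not needed: mass one, support in the
  -- closed `ε`-ball and a bound by a multiple of the inverse volume of that ball suffice.
  refine tendsto_integral_smul_of_tendsto_average_norm_sub
    (C * (volume : Measure (Eucl n)).real (Metric.ball 0 1)) h1 ?_ ?_ ?_ ?_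
  · exact Eventually.of_forall fun ε => hu.integrableOn_isCompact (isCompact_closedBall _ _)
  · refine tendsto_const_nhds.congr' ?_
    filter_upwards [hpos] with ε hε
    rw [integral_sub_right_eq_self (fun y => cutBump n ε y), integral_cutBump hn hε]
  · filter_upwards [hpos] with ε hε y hy
    rw [Metric.mem_closedBall, dist_eq_norm]
    by_contra! hlt
    exact hy (cutBump_of_gt hn hε hlt)
  · filter_upwards [hpos] with ε hε y
    refine (hC ε hε _).trans_eq ?_
    have hv : (volume : Measure (Eucl n)).real (Metric.closedBall x ε) =
        ε ^ n * (volume : Measure (Eucl n)).real (Metric.ball 0 1) := by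
      rw [Measure.addHaar_real_closedBall _ _ hε.le, finrank_euclideanSpace_fin]
    have hb : 0 < (volume : Measure (Eucl n)).real (Metric.ball 0 1) :=
      ENNReal.toReal_pos (Metric.measure_ball_pos _ _ one_pos).ne' measure_ball_lt_top.ne
    rw [hv]
    field_simp

theorem ae_tendsto_setIntegral_cutBump (hn : 3 ≤ n) (hΩ : IsOpen Ω) {u : Eucl n → ℝ}
    (hu : IntegrableOn u Ω) :
    ∀ᵐ x ∂(volume.restrict Ω),
      Tendsto (fun ε => ∫ y in Ω, cutBump n ε (y - x) * u y) (𝓝[>] 0) (𝓝 (u x)) := by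
  rw [ae_restrict_iff' hΩ.measurableSet]
  filter_upwards [ae_tendsto_integral_cutBump hn
    (hu.integrable_indicator hΩ.measurableSet).locallyIntegrable] with x hx hxΩ
  rw [indicator_of_mem hxΩ] at hx
  refine hx.congr fun ε => ?_
  rw [← integral_indicator hΩ.measurableSet]
  refine integral_congr_ae (ae_of_all _ fun y => ?_)
  by_cases hy : y ∈ Ω <;> simp [hy]

end Representation

/-! ### Distributional Laplacians and the localisation error. -/

section InteriorEstimate

variable {n : ℕ} {Ω : Set (Eucl n)}

theorem partialDeriv_add {F ζ : Eucl n → ℝ} {y : Eucl n} (hF : DifferentiableAt ℝ F y)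
    (hζ : DifferentiableAt ℝ ζ y) (i : Fin n) :
    partialDeriv i (fun y => F y + ζ y) y = partialDeriv i F y + partialDeriv i ζ y := by
  simp only [partialDeriv]
  rw [fderiv_fun_add hF hζ]
  rfl

theorem laplace_mul {F g : Eucl n → ℝ} (hF : ContDiff ℝ ∞ F) (hg : ContDiff ℝ ∞ g) (y : Eucl n) :
    laplace (fun y => F y * g y) y = F y * laplace g y +
      ((∑ j, 2 * partialDeriv j F y * partialDeriv j g y) + g y * laplace F y) := by
  have d : ∀ {F : Eucl n → ℝ}, ContDiff ℝ ∞ F → Differentiable ℝ F := fun h =>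
    h.differentiable (by simp)
  have e : ∀ j, partialDeriv j (fun y => F y * g y) =
      fun y => F y * partialDeriv j g y + g y * partialDeriv j F y := fun j =>
    funext fun y => partialDeriv_mul (d hF y) (d hg y) j
  simp only [laplace, e, Finset.mul_sum, ← Finset.sum_add_distrib]
  refine Finset.sum_congr rfl fun j _ => ?_
  have hFj := d (contDiff_partialDeriv hF j)
  have hgj := d (contDiff_partialDeriv hg j)
  rw [partialDeriv_add ((d hF y).fun_mul (hgj y)) ((d hg y).fun_mul (hFj y)),
    partialDeriv_mul (d hF y) (hgj y), partialDeriv_mul (d hg y) (hFj y)]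
  ring

theorem contDiff_laplace {v : Eucl n → ℝ} (hv : ContDiff ℝ ∞ v) : ContDiff ℝ ∞ (laplace v) :=
  ContDiff.sum fun i _ => contDiff_partialDeriv (contDiff_partialDeriv hv i) i

theorem laplace_partialDeriv {v : Eucl n → ℝ} (hv : ContDiff ℝ ∞ v) (i : Fin n) (y : Eucl n) :
    laplace (partialDeriv i v) y = partialDeriv i (laplace v) y := by
  have h : partialDeriv i (laplace v) y =
      ∑ j, partialDeriv i (partialDeriv j (partialDeriv j v)) y := by
    change fderiv ℝ (fun y => ∑ j, partialDeriv j (partialDeriv j v) y) y (basisVec i) = _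
    rw [fderiv_fun_sum fun j _ => ((contDiff_partialDeriv (contDiff_partialDeriv hv j)
      j).differentiable (by simp)) y]
    rw [sum_apply]
    rfl
  rw [h, laplace]
  refine Finset.sum_congr rfl fun j _ => ?_
  have : partialDeriv j (partialDeriv i v) = partialDeriv i (partialDeriv j v) :=
    funext fun y => partialDeriv_comm hv j i y
  rw [this, partialDeriv_comm (contDiff_partialDeriv hv j)]

/-- `Δu = d` in the sense of distributions. -/
theorem HasSobolevGradient.integral_mul_laplace (hΩ : volume Ω ≠ ⊤) {u d : Eucl n → ℝ}
    {G : Eucl n → Eucl n} (h : HasSobolevGradient Ω 1 u G)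
    (hd : HasWeakDivergence Ω (fun i y => G y i) d) {ζ : Eucl n → ℝ} (hζ : IsTestFunction Ω ζ) :
    ∫ y in Ω, laplace ζ y * u y = ∫ y in Ω, ζ y * d y := by
  obtain ⟨hu, hG⟩ := h.integrableOn le_rfl hΩ
  simp only [laplace, Finset.sum_mul]
  rw [integral_finsetSum _ fun i _ => ((hζ.partialDeriv i).partialDeriv i).integrable_mul hu]
  have h1 : ∀ i, ∫ y in Ω, partialDeriv i (partialDeriv i ζ) y * u y =
      -∫ y in Ω, G y i * partialDeriv i ζ y := by
    intro i
    simpa only [mul_comm] using h.integral_eq _ (hζ.partialDeriv i) i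
  have h2 := hd.integral_eq ζ hζ
  have h3 : ∀ i, Integrable (fun y => G y i * partialDeriv i ζ y) (volume.restrict Ω) := fun i =>
    Integrable.congr ((hζ.partialDeriv i).integrable_mul (hG i))
      (ae_of_all _ fun y => mul_comm _ _)
  rw [integral_finsetSum _ fun i _ => h3 i] at h2
  rw [Finset.sum_congr rfl fun i _ => h1 i, Finset.sum_neg_distrib, h2, neg_neg]

theorem contDiff_cutBump (n : ℕ) (ε : ℝ) : ContDiff ℝ ∞ (cutBump n ε) :=
  (contDiff_laplace (contDiff_cutKernel n ε)).neg

theorem tsupport_cutBump_subset (hn : 3 ≤ n) {ε : ℝ} (hε : 0 < ε) (x : Eucl n) :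
    tsupport (fun y => cutBump n ε (y - x)) ⊆ Metric.closedBall x ε := by
  refine closure_minimal (fun y hy => ?_) Metric.isClosed_closedBall
  rw [Metric.mem_closedBall, dist_eq_norm]
  by_contra! hlt
  exact hy (cutBump_of_gt hn hε hlt)

theorem isTestFunction_cutBump (hn : 3 ≤ n) {ε : ℝ} (hε : 0 < ε) {x : Eucl n}
    (hx : Metric.closedBall x ε ⊆ Ω) : IsTestFunction Ω fun y => cutBump n ε (y - x) where
  contDiff := contDiff_comp_sub (contDiff_cutBump n ε) x
  hasCompactSupport := (isCompact_closedBall x ε).of_isClosed_subset (isClosed_tsupport _)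
    (tsupport_cutBump_subset hn hε x)
  tsupport_subset := (tsupport_cutBump_subset hn hε x).trans hx

theorem partialDeriv_eq_zero_of_notMem_tsupport {F : Eucl n → ℝ} {y : Eucl n}
    (h : y ∉ tsupport F) (i : Fin n) : partialDeriv i F y = 0 := by
  have : F =ᶠ[𝓝 y] fun _ => 0 := notMem_tsupport_iff_eventuallyEq.1 h
  rw [partialDeriv, this.fderiv_eq]
  simp

theorem partialDeriv_congr {F H : Eucl n → ℝ} {y : Eucl n} (h : F =ᶠ[𝓝 y] H) (i : Fin n) :
    partialDeriv i F =ᶠ[𝓝 y] partialDeriv i H := by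
  filter_upwards [h.eventuallyEq_nhds] with z hz
  rw [partialDeriv, partialDeriv, hz.fderiv_eq]

theorem laplace_congr {F H : Eucl n → ℝ} {y : Eucl n} (h : F =ᶠ[𝓝 y] H) :
    laplace F y = laplace H y :=
  Finset.sum_congr rfl fun i _ => (partialDeriv_congr (partialDeriv_congr h i) i).self_of_nhds

theorem partialDeriv_const (c : ℝ) (i : Fin n) :
    partialDeriv i (fun _ : Eucl n => c) = fun _ => 0 := by
  funext y
  simp [partialDeriv]

theorem laplace_const (c : ℝ) (y : Eucl n) : laplace (fun _ : Eucl n => c) y = 0 := by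
  simp [laplace, partialDeriv_const]

/-- There is a bound, uniform in `ε` and in `x` near `x₀`, of the commutator terms in
`Δ(χ ∂ᵢΓ_ε(· - x))`. -/
theorem exists_bound_commutator (hn : 3 ≤ n) {x₀ : Eucl n} {R : ℝ} (hR : 0 < R)
    {χ : Eucl n → ℝ} (hχ : IsTestFunction (Metric.ball x₀ R) χ)
    (hχ1 : ∀ y ∈ Metric.ball x₀ (R / 2), χ y = 1) :
    ∃ C, 0 ≤ C ∧ ∀ x ∈ Metric.ball x₀ (R / 4), ∀ ε : ℝ, 0 < ε → ε ≤ R / 8 → ∀ i y,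
      |(∑ j, 2 * partialDeriv j χ y *
        partialDeriv j (fun y => partialDeriv i (cutKernel n ε) (y - x)) y) +
        partialDeriv i (cutKernel n ε) (y - x) * laplace χ y| ≤ C := by
  -- The derivatives of `χ` vanish within `R/2` of `x₀`, so where they matter `y` is at least `R/4`
  -- away from `x`. There every truncation with `ε ≤ R/8` coincides with this fixed one, which is
  -- bounded by compactness.
  have hK := contDiff_cutKernel n (R / 8)
  have hKi := fun i => contDiff_partialDeriv hK i
  have hb : ∀ g : Eucl n → ℝ, Continuous g → ∃ C, ∀ z ∈ Metric.closedBall (0 : Eucl n) (2 * R),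
      |g z| ≤ C := fun g hg =>
    (isCompact_closedBall (0 : Eucl n) (2 * R)).exists_bound_of_continuousOn hg.continuousOn
  choose B hB using fun i => hb _ (hKi i).continuous
  choose B' hB' using fun i => fun j => hb _ (contDiff_partialDeriv (hKi i) j).continuous
  choose D hD0 hD using fun j => (hχ.partialDeriv j).exists_bound
  obtain ⟨D', hD'⟩ : ∃ C, ∀ z, |laplace χ z| ≤ C := by
    choose A hA0 hA using fun j => ((hχ.partialDeriv j).partialDeriv j).exists_bound
    exact ⟨∑ j, A j, fun z => (Finset.abs_sum_le_sum_abs _ _).trans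
      (Finset.sum_le_sum fun j _ => hA j z)⟩
  have hD'0 : 0 ≤ D' := (abs_nonneg _).trans (hD' 0)
  have hz0 : (0 : Eucl n) ∈ Metric.closedBall (0 : Eucl n) (2 * R) :=
    Metric.mem_closedBall_self (by positivity)
  have hB0 : ∀ i, 0 ≤ B i := fun i => (abs_nonneg _).trans (hB i 0 hz0)
  have hB'0 : ∀ i j, 0 ≤ B' i j := fun i j => (abs_nonneg _).trans (hB' i j 0 hz0)
  have hterm0 : ∀ i, 0 ≤ (∑ j, 2 * D j * B' i j) + B i * D' := fun i =>
    add_nonneg (Finset.sum_nonneg fun j _ => by have := hD0 j; have := hB'0 i j; positivity)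
      (mul_nonneg (hB0 i) hD'0)
  refine ⟨∑ i, ((∑ j, 2 * D j * B' i j) + B i * D'),
    Finset.sum_nonneg fun i _ => hterm0 i, fun x hx ε hε hεR i y => ?_⟩
  refine le_trans ?_ (Finset.single_le_sum (fun i _ => hterm0 i) (Finset.mem_univ i))
  by_cases hy : y ∈ Metric.ball x₀ (R / 2)
  · have h1 : χ =ᶠ[𝓝 y] fun _ => 1 := by
      filter_upwards [Metric.isOpen_ball.mem_nhds hy] with z hz using hχ1 z hz
    have h2 : ∀ j, partialDeriv j χ y = 0 := fun j => by
      rw [(partialDeriv_congr h1 j).self_of_nhds, partialDeriv_const]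
    simp only [h2, laplace_congr h1, laplace_const]
    simpa using hterm0 i
  by_cases hyR : y ∈ Metric.ball x₀ R
  · have h1 : dist x x₀ < R / 4 := hx
    have h2 : R / 2 ≤ dist y x₀ := by simpa using hy
    have h3 : dist y x₀ < R := hyR
    have h4 : R / 4 < ‖y - x‖ := by
      rw [← dist_eq_norm]
      linarith [dist_triangle y x x₀]
    have h5 : y - x ∈ Metric.closedBall (0 : Eucl n) (2 * R) := by
      rw [mem_closedBall_zero_iff, ← dist_eq_norm]
      linarith [dist_triangle y x₀ x, dist_comm x x₀]
    have h6 : cutKernel n ε =ᶠ[𝓝 (y - x)] cutKernel n (R / 8) :=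
      cutKernel_eventuallyEq hn hε (by positivity) (by linarith) (by linarith)
    have h7 := partialDeriv_congr h6 i
    refine (abs_add_le _ _).trans (add_le_add ((Finset.abs_sum_le_sum_abs _ _).trans
      (Finset.sum_le_sum fun j _ => ?_)) ?_)
    · rw [partialDeriv_comp_sub, (partialDeriv_congr h7 j).self_of_nhds, abs_mul, abs_mul, abs_two]
      have := hD0 j
      have a1 := hD j y
      have a2 := hB' i j _ h5
      gcongr
    · rw [h7.self_of_nhds, abs_mul]
      have a1 := hD' y
      have a2 := hB i _ h5
      have := hB0 i
      gcongr
  · have h1 : y ∉ tsupport χ := fun hc => hyR (hχ.tsupport_subset hc)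
    have h2 : laplace χ y = 0 := by
      rw [laplace_congr (notMem_tsupport_iff_eventuallyEq.1 h1)]
      exact laplace_const 0 y
    simp only [partialDeriv_eq_zero_of_notMem_tsupport h1, h2]
    simpa using hterm0 i

end InteriorEstimate

/-! ### Bounding the gradient by its own Riesz potential. -/

section GradientEstimate

variable {n : ℕ} {Ω : Set (Eucl n)}

/-- The Riesz kernel `|z|^{-s}`. -/
noncomputable def rieszKernel (s : ℝ) (z : Eucl n) : ℝ≥0∞ := ENNReal.ofReal (‖z‖ ^ (-s))

theorem rieszKernel_sub_one (hn : 3 ≤ n) (x y : Eucl n) :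
    rieszKernel ((n : ℝ) - 1) (x - y) = ENNReal.ofReal ((‖y - x‖ ^ (n - 1))⁻¹) := by
  rw [rieszKernel, norm_sub_rev, Real.rpow_neg (norm_nonneg _), ← Real.rpow_natCast,
    Nat.cast_sub (by omega), Nat.cast_one]

theorem lintegral_restrict_le_of_support {S : Set (Eucl n)} (hS : MeasurableSet S)
    {g h : Eucl n → ℝ≥0∞} (h1 : ∀ᵐ y ∂(volume.restrict Ω), g y ≤ S.indicator h y) :
    ∫⁻ y in Ω, g y ≤ ∫⁻ y in S, h y := by
  refine (lintegral_mono_ae h1).trans ?_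
  rw [lintegral_indicator hS]
  exact lintegral_mono' (Measure.restrict_mono_measure Measure.restrict_le_self _) le_rfl

/-- A bound for the mollified gradient of a solution of `Δu = d`, `|d| ≤ M |∇u|`. -/
theorem exists_bound_integral_cutBump_grad (hn : 3 ≤ n) (hΩ : volume Ω ≠ ⊤)
    {u d : Eucl n → ℝ}
    {G : Eucl n → Eucl n} (h : HasSobolevGradient Ω 1 u G)
    (hd : HasWeakDivergence Ω (fun i y => G y i) d) {M : ℝ} (hM : 0 ≤ M)
    (hdM : ∀ᵐ y ∂(volume.restrict Ω), |d y| ≤ M * ‖G y‖) {x₀ : Eucl n} {R : ℝ} (hR : 0 < R)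
    (hball : Metric.ball x₀ R ⊆ Ω) :
    ∃ C : ℝ≥0∞, C ≠ ⊤ ∧ ∀ x ∈ Metric.ball x₀ (R / 4), ∀ ε : ℝ, 0 < ε → ε ≤ R / 8 → ∀ i,
      ‖∫ y in Ω, cutBump n ε (y - x) * G y i‖ₑ ≤
        C + C * ∫⁻ y in Metric.ball x₀ R, rieszKernel ((n : ℝ) - 1) (x - y) * ‖G y‖ₑ := by
  obtain ⟨hu, hG⟩ := h.integrableOn le_rfl hΩ
  let χ : ContDiffBump x₀ := ⟨R / 2, 3 * R / 4, by positivity, by linarith⟩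
  have hsupp : tsupport χ ⊆ Metric.ball x₀ R := by
    rw [χ.tsupport_eq]
    exact Metric.closedBall_subset_ball (by change 3 * R / 4 < R; linarith)
  have hχR : IsTestFunction (Metric.ball x₀ R) χ := ⟨χ.contDiff, χ.hasCompactSupport, hsupp⟩
  have hχ : IsTestFunction Ω χ := ⟨χ.contDiff, χ.hasCompactSupport, hsupp.trans hball⟩
  have hχ1 : ∀ y ∈ Metric.ball x₀ (R / 2), χ y = 1 := fun y hy =>
    χ.one_of_mem_closedBall (Metric.ball_subset_closedBall hy)
  obtain ⟨C₁, hC₁0, hC₁⟩ := exists_bound_partialDeriv_cutKernel hn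
  obtain ⟨C₂, hC₂0, hC₂⟩ := exists_bound_commutator hn hR hχR hχ1
  have hu' : ∫⁻ y in Ω, ‖u y‖ₑ ≠ ⊤ := hu.2.ne
  refine ⟨ENNReal.ofReal (C₁ * M) + ENNReal.ofReal C₂ * ∫⁻ y in Ω, ‖u y‖ₑ,
    ENNReal.add_ne_top.2 ⟨ENNReal.ofReal_ne_top, ENNReal.mul_ne_top ENNReal.ofReal_ne_top hu'⟩,
    fun x hx ε hε hεR i => ?_⟩
  set I := ∫⁻ y in Metric.ball x₀ R, rieszKernel ((n : ℝ) - 1) (x - y) * ‖G y‖ₑ with hI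
  have hx' : dist x x₀ < R / 4 := hx
  have hxε : Metric.closedBall x ε ⊆ Metric.ball x₀ (R / 2) := fun z hz => by
    have hz' : dist z x ≤ ε := hz
    rw [Metric.mem_ball]
    linarith [dist_triangle z x x₀]
  have hρ : IsTestFunction Ω fun y => cutBump n ε (y - x) := isTestFunction_cutBump hn hε
    (hxε.trans ((Metric.ball_subset_ball (by linarith)).trans hball))
  have hKi := contDiff_partialDeriv (contDiff_cutKernel n ε) i
  have hp : ContDiff ℝ ∞ fun y => partialDeriv i (cutKernel n ε) (y - x) := contDiff_comp_sub hKi x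
  -- Testing `Δu = d` with `χ ∂ᵢΓ_ε(· - x)` produces `∂ᵢρ_ε` on the other side, hence a
  -- mollification of `∂ᵢu`.
  have hζ : IsTestFunction Ω fun y => χ y * partialDeriv i (cutKernel n ε) (y - x) := by
    simpa only [mul_comm] using hχ.smooth_mul hp
  have hlap : ∀ y, laplace (fun y => χ y * partialDeriv i (cutKernel n ε) (y - x)) y +
      partialDeriv i (fun y => cutBump n ε (y - x)) y =
      (∑ j, 2 * partialDeriv j χ y *
        partialDeriv j (fun y => partialDeriv i (cutKernel n ε) (y - x)) y) +
        partialDeriv i (cutKernel n ε) (y - x) * laplace χ y := by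
    intro y
    rw [laplace_mul χ.contDiff hp, laplace_comp_sub, laplace_partialDeriv (contDiff_cutKernel n ε)]
    have e1 : partialDeriv i (laplace (cutKernel n ε)) (y - x) =
        -partialDeriv i (fun y => cutBump n ε (y - x)) y := by
      rw [partialDeriv_comp_sub]
      change _ = -(fderiv ℝ (fun y => -laplace (cutKernel n ε) y) (y - x) (basisVec i))
      rw [fderiv_fun_neg]
      simp [partialDeriv]
    rw [e1]
    -- The term `-χ ∂ᵢρ_ε` loses its cutoff, because `χ = 1` on a ball containing the support of
    -- `ρ_ε(· - x)`.
    by_cases hy : y ∈ Metric.ball x₀ (R / 2)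
    · rw [hχ1 y hy]; ring
    · rw [partialDeriv_eq_zero_of_notMem_tsupport
        (fun hc => hy (hxε (tsupport_cutBump_subset hn hε x hc)))]
      ring
  have hlu : IntegrableOn (fun y => laplace
      (fun y => χ y * partialDeriv i (cutKernel n ε) (y - x)) y * u y) Ω := by
    simp only [laplace, Finset.sum_mul]
    exact integrable_finsetSum _ fun j _ => ((hζ.partialDeriv j).partialDeriv j).integrable_mul hu
  -- The mollified gradient is the potential of `d` with the localised kernel `χ ∂ᵢΓ_ε`, minus a
  -- commutator integral against `u` that is bounded uniformly in `ε`.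
  have key : ∫ y in Ω, cutBump n ε (y - x) * G y i =
      (∫ y in Ω, χ y * partialDeriv i (cutKernel n ε) (y - x) * d y) -
      ∫ y in Ω, ((∑ j, 2 * partialDeriv j χ y *
        partialDeriv j (fun y => partialDeriv i (cutKernel n ε) (y - x)) y) +
        partialDeriv i (cutKernel n ε) (y - x) * laplace χ y) * u y := by
    simp only [← hlap, add_mul]
    rw [integral_add hlu ((hρ.partialDeriv i).integrable_mul hu),
      h.integral_mul_laplace hΩ hd hζ]
    have := h.integral_eq _ hρ i
    simp only [mul_comm (u _)] at this
    linarith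
  rw [key]
  refine (enorm_sub_le).trans ?_
  have b1 : ‖∫ y in Ω, χ y * partialDeriv i (cutKernel n ε) (y - x) * d y‖ₑ ≤
      ENNReal.ofReal (C₁ * M) * I := by
    refine (enorm_integral_le_lintegral_enorm _).trans ?_
    rw [hI, ← lintegral_const_mul' _ _ ENNReal.ofReal_ne_top]
    refine lintegral_restrict_le_of_support Metric.isOpen_ball.measurableSet ?_
    filter_upwards [hdM] with y hy
    by_cases hyR : y ∈ Metric.ball x₀ R
    · rw [indicator_of_mem hyR, rieszKernel_sub_one hn, ← ofReal_norm (G y), ← ofReal_norm,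
        ← ENNReal.ofReal_mul (by positivity), ← ENNReal.ofReal_mul (by positivity)]
      refine ENNReal.ofReal_le_ofReal ?_
      rw [norm_mul, norm_mul, Real.norm_of_nonneg χ.nonneg]
      calc χ y * |partialDeriv i (cutKernel n ε) (y - x)| * |d y|
          ≤ 1 * (C₁ * (‖y - x‖ ^ (n - 1))⁻¹) * (M * ‖G y‖) := by
            have a1 : χ y ≤ 1 := χ.le_one
            have a2 := hC₁ ε hε (y - x) i
            have a3 : 0 ≤ χ y := χ.nonneg
            gcongr
        _ = _ := by ring
    · rw [indicator_of_notMem hyR, image_eq_zero_of_notMem_tsupport fun hc => hyR (hsupp hc)]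
      simp
  have b2 : ‖∫ y in Ω, ((∑ j, 2 * partialDeriv j χ y *
        partialDeriv j (fun y => partialDeriv i (cutKernel n ε) (y - x)) y) +
        partialDeriv i (cutKernel n ε) (y - x) * laplace χ y) * u y‖ₑ ≤
      ENNReal.ofReal C₂ * ∫⁻ y in Ω, ‖u y‖ₑ := by
    refine (enorm_integral_le_lintegral_enorm _).trans ?_
    rw [← lintegral_const_mul' _ _ ENNReal.ofReal_ne_top]
    refine lintegral_mono fun y => ?_
    rw [enorm_mul]
    refine mul_le_mul_left ?_ _
    rw [← ofReal_norm]
    exact ENNReal.ofReal_le_ofReal (hC₂ x hx ε hε hεR i y)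
  refine (add_le_add b1 b2).trans ?_
  rw [add_comm]
  refine add_le_add ?_ (mul_le_mul_left ?_ _)
  · exact le_add_self
  · exact le_self_add

/-- The gradient of a solution of `Δu = d`, `|d| ≤ M |∇u|`, is bounded by its Riesz potential. -/
theorem exists_ae_grad_le (hn : 3 ≤ n) (hΩo : IsOpen Ω) (hΩ : volume Ω ≠ ⊤) {u d : Eucl n → ℝ}
    {G : Eucl n → Eucl n} (h : HasSobolevGradient Ω 1 u G)
    (hd : HasWeakDivergence Ω (fun i y => G y i) d) {M : ℝ} (hM : 0 ≤ M)
    (hdM : ∀ᵐ y ∂(volume.restrict Ω), |d y| ≤ M * ‖G y‖) {x₀ : Eucl n} {R : ℝ} (hR : 0 < R)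
    (hball : Metric.ball x₀ R ⊆ Ω) :
    ∃ C : ℝ≥0∞, C ≠ ⊤ ∧ ∀ᵐ x ∂(volume.restrict (Metric.ball x₀ (R / 4))),
      ‖G x‖ₑ ≤ C + C * ∫⁻ y in Metric.ball x₀ R, rieszKernel ((n : ℝ) - 1) (x - y) * ‖G y‖ₑ := by
  obtain ⟨hu, hG⟩ := h.integrableOn le_rfl hΩ
  obtain ⟨C, hC, hle⟩ := exists_bound_integral_cutBump_grad hn hΩ h hd hM hdM hR hball
  refine ⟨n * C, ENNReal.mul_ne_top (ENNReal.natCast_ne_top n) hC, ?_⟩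
  have hsub : Metric.ball x₀ (R / 4) ⊆ Ω :=
    (Metric.ball_subset_ball (by linarith)).trans hball
  have hlim : ∀ i, ∀ᵐ x ∂(volume.restrict (Metric.ball x₀ (R / 4))),
      Tendsto (fun ε => ∫ y in Ω, cutBump n ε (y - x) * G y i) (𝓝[>] 0) (𝓝 (G x i)) := fun i =>
    ae_restrict_of_ae_restrict_of_subset hsub (ae_tendsto_setIntegral_cutBump hn hΩo (hG i))
  filter_upwards [ae_all_iff.2 hlim, ae_restrict_mem Metric.isOpen_ball.measurableSet] with x hx hxb
  have h1 : ∀ i, ‖G x i‖ₑ ≤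
      C + C * ∫⁻ y in Metric.ball x₀ R, rieszKernel ((n : ℝ) - 1) (x - y) * ‖G y‖ₑ := by
    intro i
    -- The bound does not depend on `ε`, so it survives the limit wherever the mollifications of `G
    -- i` converge.
    refine le_of_tendsto (hx i).enorm ?_
    filter_upwards [Ioc_mem_nhdsGT (show (0 : ℝ) < R / 8 by positivity)] with ε hε
    exact hle x hxb ε hε.1 hε.2 i
  have h2 : ‖G x‖ₑ ≤ ∑ i, ‖G x i‖ₑ := by
    have h3 : G x = ∑ i, G x i • (basisVec i : Eucl n) := by
      have := (EuclideanSpace.basisFun (Fin n) ℝ).sum_repr (G x)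
      simpa [basisVec] using this.symm
    have h4 : ∀ i, ‖(basisVec i : Eucl n)‖ₑ = 1 := fun i => by
      rw [← ofReal_norm]; simp [basisVec]
    calc ‖G x‖ₑ = ‖∑ i, G x i • (basisVec i : Eucl n)‖ₑ := by rw [← h3]
      _ ≤ ∑ i, ‖G x i • (basisVec i : Eucl n)‖ₑ := enorm_sum_le _ _
      _ = _ := Finset.sum_congr rfl fun i _ => by rw [enorm_smul, h4, mul_one]
  refine h2.trans ((Finset.sum_le_sum fun i _ => h1 i).trans_eq ?_)
  simp only [Finset.sum_const, Finset.card_univ, Fintype.card_fin, nsmul_eq_mul]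
  ring

end GradientEstimate

/-! ### Composition of Riesz kernels and the bootstrap. -/

section RieszPotential

variable {n : ℕ} {Ω : Set (Eucl n)}

/-- The smaller of `a` and `b`, raised to the total exponent, already dominates the product. -/
theorem rpow_neg_mul_rpow_neg_le {a b α β : ℝ} (ha : 0 < a) (hb : 0 < b) (hα : 0 ≤ α)
    (hβ : 0 ≤ β) : a ^ (-α) * b ^ (-β) ≤ a ^ (-(α + β)) + b ^ (-(α + β)) := by
  have h1 : ∀ t : ℝ, 0 < t → 0 ≤ t ^ (-(α + β)) := fun t ht => Real.rpow_nonneg ht.le _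
  rw [neg_add, Real.rpow_add ha, Real.rpow_add hb]
  have pa : 0 < a ^ (-α) := Real.rpow_pos_of_pos ha _
  have pb : 0 < b ^ (-β) := Real.rpow_pos_of_pos hb _
  have pa' : 0 < a ^ (-β) := Real.rpow_pos_of_pos ha _
  have pb' : 0 < b ^ (-α) := Real.rpow_pos_of_pos hb _
  rcases le_total a b with hab | hab
  · have : b ^ (-β) ≤ a ^ (-β) := Real.rpow_le_rpow_of_nonpos ha hab (by linarith)
    have := mul_le_mul_of_nonneg_left this pa.le
    have := mul_pos pb' pb
    linarith
  · have : a ^ (-α) ≤ b ^ (-α) := Real.rpow_le_rpow_of_nonpos hb hab (by linarith)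
    have := mul_le_mul_of_nonneg_right this pb.le
    have := mul_pos pa pa'
    linarith

/-- One of `a`, `b` is at least `c/2`, and the power `s - 1/2` is peeled off that factor. What
remains has total exponent `N - 1/2`, which is below the dimension when `N = n` and hence locally
integrable. Gaining only half a power per composition provides this margin. -/
theorem rpow_neg_mul_rpow_neg_le_of_le_add {a b c s N : ℝ} (ha : 0 < a) (hb : 0 < b) (hc : 0 < c)
    (habc : c ≤ a + b) (hs : 1 / 2 ≤ s) (hsN : s ≤ N - 1 / 2) :
    a ^ (-s) * b ^ (-(N - 1)) ≤
      (2 : ℝ) ^ (s - 1 / 2) * c ^ (-(s - 1 / 2)) * (a ^ (-(N - 1 / 2)) + b ^ (-(N - 1 / 2))) := by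
  have hc2 : (c / 2) ^ (-(s - 1 / 2)) = (2 : ℝ) ^ (s - 1 / 2) * c ^ (-(s - 1 / 2)) := by
    rw [Real.div_rpow hc.le (by norm_num), Real.rpow_neg (by norm_num : (0 : ℝ) ≤ 2), div_inv_eq_mul,
      mul_comm]
  rw [← hc2]
  rcases le_total (c / 2) a with h | h
  · have e1 : a ^ (-s) = a ^ (-(s - 1 / 2)) * a ^ (-(1 / 2 : ℝ)) := by
      rw [← Real.rpow_add ha]; congr 1; ring
    have h1 : a ^ (-(s - 1 / 2)) ≤ (c / 2) ^ (-(s - 1 / 2)) :=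
      Real.rpow_le_rpow_of_nonpos (by positivity) h (by linarith)
    have h2 := rpow_neg_mul_rpow_neg_le ha hb (α := 1 / 2) (β := N - 1) (by norm_num) (by linarith)
    rw [show (1 / 2 : ℝ) + (N - 1) = N - 1 / 2 by ring] at h2
    rw [e1, mul_assoc]
    exact mul_le_mul h1 h2 (by positivity) (by positivity)
  · have hb' : c / 2 ≤ b := by linarith
    have e1 : b ^ (-(N - 1)) = b ^ (-(s - 1 / 2)) * b ^ (-(N - 1 / 2 - s)) := by
      rw [← Real.rpow_add hb]; congr 1; ring
    have h1 : b ^ (-(s - 1 / 2)) ≤ (c / 2) ^ (-(s - 1 / 2)) :=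
      Real.rpow_le_rpow_of_nonpos (by positivity) hb' (by linarith)
    have h2 := rpow_neg_mul_rpow_neg_le ha hb (α := s) (β := N - 1 / 2 - s) (by linarith)
      (by linarith)
    rw [show s + (N - 1 / 2 - s) = N - 1 / 2 by ring] at h2
    rw [e1, mul_left_comm]
    exact mul_le_mul h1 h2 (by positivity) (by positivity)

theorem nontrivial_eucl (hn : 3 ≤ n) : Nontrivial (Eucl n) := by
  refine Module.nontrivial_of_finrank_pos (R := ℝ) ?_
  rw [finrank_euclideanSpace_fin]
  omega

theorem measurable_rieszKernel (s : ℝ) : Measurable (rieszKernel s : Eucl n → ℝ≥0∞) :=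
  ENNReal.measurable_ofReal.comp (measurable_norm.pow_const _)

theorem rieszKernel_ne_top (s : ℝ) (z : Eucl n) : rieszKernel s z ≠ ⊤ := ENNReal.ofReal_ne_top

theorem rieszKernel_neg (s : ℝ) (z : Eucl n) : rieszKernel s (-z) = rieszKernel s z := by
  rw [rieszKernel, rieszKernel, norm_neg]

theorem lintegral_rieszKernel_lt_top (hn : 3 ≤ n) {s : ℝ} (hs : s < n) (r : ℝ) :
    ∫⁻ z in Metric.ball (0 : Eucl n) r, rieszKernel s z < ⊤ := by
  have := nontrivial_eucl hn
  have h : IntegrableOn (fun z : Eucl n => ‖z‖ ^ (-s)) (Metric.ball 0 r) := by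
    rw [integrableOn_fun_norm_addHaar (volume : Measure (Eucl n)) (f := fun t => t ^ (-s))]
    rw [finrank_euclideanSpace_fin]
    have h1 : IntegrableOn (fun t : ℝ => t ^ ((n : ℝ) - 1 - s)) (Ioo 0 r) := by
      rcases le_or_gt r 0 with hr | hr
      · simp [Ioo_eq_empty_of_le hr]
      · exact (intervalIntegral.integrableOn_Ioo_rpow_iff hr).2 (by linarith)
    refine h1.congr_fun (fun t ht => ?_) measurableSet_Ioo
    have ht0 : 0 < t := ht.1
    rw [smul_eq_mul, ← Real.rpow_natCast, ← Real.rpow_add ht0, Nat.cast_sub (by omega)]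
    push_cast
    congr 1
  have h2 := h.lintegral_lt_top
  exact h2

theorem exists_bound_lintegral_rieszKernel (hn : 3 ≤ n) {s : ℝ} (hs : s < n) (x₀ : Eucl n)
    (R : ℝ) : ∃ K : ℝ≥0∞, K ≠ ⊤ ∧ ∀ x ∈ Metric.ball x₀ R,
      ∫⁻ z in Metric.ball x₀ R, rieszKernel s (x - z) ≤ K := by
  refine ⟨_, (lintegral_rieszKernel_lt_top hn hs (2 * R)).ne, fun x hx => ?_⟩
  rw [← lintegral_indicator Metric.isOpen_ball.measurableSet,
    ← lintegral_indicator Metric.isOpen_ball.measurableSet,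
    ← lintegral_sub_left_eq_self ((Metric.ball (0 : Eucl n) (2 * R)).indicator _) x]
  refine lintegral_mono fun z => ?_
  by_cases hz : z ∈ Metric.ball x₀ R
  · have : x - z ∈ Metric.ball (0 : Eucl n) (2 * R) := by
      rw [mem_ball_zero_iff, ← dist_eq_norm]
      have h1 : dist x x₀ < R := hx
      have h2 : dist z x₀ < R := hz
      linarith [dist_triangle_right x z x₀]
    simp only [indicator_of_mem hz, indicator_of_mem this]
    exact le_rfl
  · simp only [indicator_of_notMem hz]
    exact zero_le

/-- Composition with the kernel of exponent `n - 1` lowers the exponent by `1/2`. The diagonal is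
excluded because the real power convention makes `rieszKernel t 0 = 0` for `t ≠ 0`. -/
theorem exists_bound_lintegral_rieszKernel_mul (hn : 3 ≤ n) {s : ℝ} (hs : 1 / 2 ≤ s)
    (hsn : s ≤ n - 1 / 2) (x₀ : Eucl n) (R : ℝ) :
    ∃ K : ℝ≥0∞, K ≠ ⊤ ∧ ∀ x ∈ Metric.ball x₀ R, ∀ y ∈ Metric.ball x₀ R, x ≠ y →
      ∫⁻ z in Metric.ball x₀ R, rieszKernel s (x - z) * rieszKernel ((n : ℝ) - 1) (z - y) ≤
        K * rieszKernel (s - 1 / 2) (x - y) := by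
  obtain ⟨K, hK, hle⟩ := exists_bound_lintegral_rieszKernel hn
    (show (n : ℝ) - 1 / 2 < n by linarith) x₀ R
  refine ⟨ENNReal.ofReal ((2 : ℝ) ^ (s - 1 / 2)) * (K + K), ENNReal.mul_ne_top
    ENNReal.ofReal_ne_top (ENNReal.add_ne_top.2 ⟨hK, hK⟩), fun x hx y hy hxy => ?_⟩
  have hpt : ∀ᵐ z ∂(volume.restrict (Metric.ball x₀ R)),
      rieszKernel s (x - z) * rieszKernel ((n : ℝ) - 1) (z - y) ≤
      ENNReal.ofReal ((2 : ℝ) ^ (s - 1 / 2)) * rieszKernel (s - 1 / 2) (x - y) *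
      (rieszKernel ((n : ℝ) - 1 / 2) (x - z) + rieszKernel ((n : ℝ) - 1 / 2) (y - z)) := by
    refine ae_restrict_of_ae ?_
    have hne : ∀ w : Eucl n, ∀ᵐ z : Eucl n, z ≠ w := fun w => by
      have := nontrivial_eucl hn
      exact compl_mem_ae_iff.2 (measure_singleton w)
    filter_upwards [hne x, hne y] with z hzx hzy
    have a1 : 0 < ‖x - z‖ := norm_pos_iff.2 (sub_ne_zero.2 (Ne.symm hzx))
    have a2 : 0 < ‖z - y‖ := norm_pos_iff.2 (sub_ne_zero.2 hzy)
    have a3 : 0 < ‖x - y‖ := norm_pos_iff.2 (sub_ne_zero.2 hxy)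
    have h := rpow_neg_mul_rpow_neg_le_of_le_add a1 a2 a3 (norm_sub_le_norm_sub_add_norm_sub x z y)
      hs hsn
    rw [← rieszKernel_neg _ (y - z), neg_sub]
    simp only [rieszKernel]
    rw [← ENNReal.ofReal_mul (by positivity), ← ENNReal.ofReal_mul (by positivity),
      ← ENNReal.ofReal_add (by positivity) (by positivity), ← ENNReal.ofReal_mul (by positivity)]
    exact ENNReal.ofReal_le_ofReal h
  refine (lintegral_mono_ae hpt).trans ?_
  have hm : ∀ (t : ℝ) (x : Eucl n), Measurable fun z => rieszKernel t (x - z) := fun t x =>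
    (measurable_rieszKernel t).comp (measurable_const.sub measurable_id)
  rw [lintegral_const_mul' _ _ (ENNReal.mul_ne_top ENNReal.ofReal_ne_top (rieszKernel_ne_top _ _)),
    lintegral_add_left (hm _ x)]
  refine (mul_le_mul_right (add_le_add (hle x hx) (hle y hy)) _).trans_eq ?_
  ring

/-- If `g` is bounded by its Riesz potential, then an estimate for the potential of `g` with
exponent `s - 1/2` improves to one with exponent `s`. -/
theorem exists_bound_lintegral_rieszKernel_succ (hn : 3 ≤ n) {g : Eucl n → ℝ≥0∞} {x₀ : Eucl n}
    {r R : ℝ} (hrR : r ≤ R) (hg : AEMeasurable g (volume.restrict (Metric.ball x₀ R)))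
    {C : ℝ≥0∞} (hC : C ≠ ⊤)
    (hle : ∀ᵐ x ∂(volume.restrict (Metric.ball x₀ r)),
      g x ≤ C + C * ∫⁻ y in Metric.ball x₀ R, rieszKernel ((n : ℝ) - 1) (x - y) * g y)
    {s : ℝ} (hs : 1 / 2 ≤ s) (hsn : s ≤ n - 1 / 2) {B : ℝ≥0∞} (hB : B ≠ ⊤)
    (hpot : ∀ x ∈ Metric.ball x₀ R,
      ∫⁻ y in Metric.ball x₀ R, rieszKernel (s - 1 / 2) (x - y) * g y ≤ B) :
    ∃ B' : ℝ≥0∞, B' ≠ ⊤ ∧ ∀ x ∈ Metric.ball x₀ r,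
      ∫⁻ y in Metric.ball x₀ r, rieszKernel s (x - y) * g y ≤ B' := by
  obtain ⟨K, hK, hKle⟩ := exists_bound_lintegral_rieszKernel hn
    (show s < n by linarith) x₀ R
  obtain ⟨K', hK', hK'le⟩ := exists_bound_lintegral_rieszKernel_mul hn hs hsn x₀ R
  have hm : ∀ (t : ℝ) (x : Eucl n), Measurable fun z => rieszKernel t (x - z) := fun t x =>
    (measurable_rieszKernel t).comp (measurable_const.sub measurable_id)
  have hsub : Metric.ball x₀ r ⊆ Metric.ball x₀ R := Metric.ball_subset_ball hrR
  refine ⟨C * K + C * (K' * B), ENNReal.add_ne_top.2 ⟨ENNReal.mul_ne_top hC hK,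
    ENNReal.mul_ne_top hC (ENNReal.mul_ne_top hK' hB)⟩, fun x hx => ?_⟩
  have h1 : ∫⁻ z in Metric.ball x₀ r, rieszKernel s (x - z) * g z ≤
      ∫⁻ z in Metric.ball x₀ r, (C * rieszKernel s (x - z) + C * (rieszKernel s (x - z) *
        ∫⁻ y in Metric.ball x₀ R, rieszKernel ((n : ℝ) - 1) (z - y) * g y)) := by
    refine lintegral_mono_ae ?_
    filter_upwards [hle] with z hz
    refine (mul_le_mul_right hz _).trans_eq ?_
    ring
  refine h1.trans ?_
  rw [lintegral_add_left ((hm s x).const_mul C), lintegral_const_mul' _ _ hC,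
    lintegral_const_mul' _ _ hC]
  refine add_le_add (mul_le_mul_right ((lintegral_mono_set hsub).trans (hKle x (hsub hx))) _)
    (mul_le_mul_right ?_ _)
  have h2 : ∀ z, rieszKernel s (x - z) *
      ∫⁻ y in Metric.ball x₀ R, rieszKernel ((n : ℝ) - 1) (z - y) * g y =
      ∫⁻ y in Metric.ball x₀ R,
        rieszKernel s (x - z) * (rieszKernel ((n : ℝ) - 1) (z - y) * g y) := fun z =>
    (lintegral_const_mul' _ _ ENNReal.ofReal_ne_top).symm
  simp only [h2]
  refine (lintegral_mono_set hsub).trans ?_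
  rw [lintegral_lintegral_swap]
  · have := nontrivial_eucl hn
    -- After Tonelli the inner integral is a composition of two kernels, estimated off the diagonal,
    -- whose section `{x}` is null.
    have hne : ∀ᵐ y ∂(volume.restrict (Metric.ball x₀ R)), y ≠ x :=
      ae_restrict_of_ae (compl_mem_ae_iff.2 (measure_singleton x))
    calc ∫⁻ y in Metric.ball x₀ R, ∫⁻ z in Metric.ball x₀ R,
          rieszKernel s (x - z) * (rieszKernel ((n : ℝ) - 1) (z - y) * g y)
        ≤ ∫⁻ y in Metric.ball x₀ R, K' * (rieszKernel (s - 1 / 2) (x - y) * g y) := by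
          refine lintegral_mono_ae ?_
          filter_upwards [hne, ae_restrict_mem Metric.isOpen_ball.measurableSet] with y hyx hy
          have hmy : Measurable fun z => rieszKernel ((n : ℝ) - 1) (z - y) :=
            (measurable_rieszKernel _).comp (measurable_id.sub measurable_const)
          have hmul : Measurable fun z => rieszKernel s (x - z) * rieszKernel ((n : ℝ) - 1) (z - y) :=
            (hm s x).mul hmy
          simp only [← mul_assoc]
          rw [lintegral_mul_const _ hmul]
          exact mul_le_mul_left (hK'le x (hsub hx) y hy hyx.symm) _
      _ ≤ K' * B := by
          rw [lintegral_const_mul' _ _ hK']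
          exact mul_le_mul_right (hpot x (hsub hx)) _
  · refine AEMeasurable.mul ((hm s x).comp measurable_fst).aemeasurable
      (AEMeasurable.mul ?_ hg.comp_snd)
    exact ((measurable_rieszKernel _).comp (measurable_fst.sub measurable_snd)).aemeasurable

/-- The local Riesz potentials of the gradient of a solution of `Δu = d`, `|d| ≤ M |∇u|`, are
bounded. -/
theorem exists_bound_lintegral_rieszKernel_grad (hn : 3 ≤ n) (hΩo : IsOpen Ω) (hΩ : volume Ω ≠ ⊤)
    {u d : Eucl n → ℝ}
    {G : Eucl n → Eucl n} (h : HasSobolevGradient Ω 1 u G)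
    (hd : HasWeakDivergence Ω (fun i y => G y i) d) {M : ℝ} (hM : 0 ≤ M)
    (hdM : ∀ᵐ y ∂(volume.restrict Ω), |d y| ≤ M * ‖G y‖) {x₀ : Eucl n} (hx₀ : x₀ ∈ Ω)
    (k : ℕ) (hk : (k : ℝ) / 2 ≤ n - 1 / 2) :
    ∃ r > 0, ∃ C : ℝ≥0∞, C ≠ ⊤ ∧ Metric.ball x₀ r ⊆ Ω ∧ ∀ x ∈ Metric.ball x₀ r,
      ∫⁻ y in Metric.ball x₀ r, rieszKernel ((k : ℝ) / 2) (x - y) * ‖G y‖ₑ ≤ C := by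
  -- At exponent `0` the potential is at most the `L¹` norm of the gradient. Each half step shrinks
  -- the radius by the factor `4` lost in `exists_ae_grad_le`.
  induction k with
  | zero =>
    obtain ⟨r, hr, hball⟩ := Metric.isOpen_iff.1 hΩo x₀ hx₀
    refine ⟨r, hr, ∫⁻ y in Ω, ‖G y‖ₑ, (memLp_one_iff_integrable.1 h.memLp_grad).2.ne, hball, fun x _ => ?_⟩
    simp only [rieszKernel, Nat.cast_zero, zero_div, neg_zero, Real.rpow_zero, ENNReal.ofReal_one,
      one_mul]
    exact lintegral_mono_set hball
  | succ k ih =>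
    push_cast at hk
    obtain ⟨R, hR, B, hB, hball, hpot⟩ := ih (by linarith)
    obtain ⟨C, hC, hle⟩ := exists_ae_grad_le hn hΩo hΩ h hd hM hdM hR hball
    have hrR : R / 4 ≤ R := by linarith
    have hmeas : AEMeasurable (fun y => ‖G y‖ₑ) (volume.restrict (Metric.ball x₀ R)) :=
      (h.memLp_grad.1.mono_measure (Measure.restrict_mono hball le_rfl)).enorm
    obtain ⟨B', hB', hle'⟩ := exists_bound_lintegral_rieszKernel_succ hn hrR hmeas hC hle
      (s := ((k + 1 : ℕ) : ℝ) / 2) (by push_cast; have := k.cast_nonneg (α := ℝ); linarith)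
      (by push_cast; linarith) hB (by
        convert hpot using 6
        push_cast
        ring_nf)
    exact ⟨R / 4, by positivity, B', hB', (Metric.ball_subset_ball hrR).trans hball, hle'⟩

end RieszPotential

/-! ### The Newtonian potential of `d` and removal of the truncation. -/

section NewtonPotential

variable {n : ℕ} {Ω : Set (Eucl n)}

/-- The integrand of the Newtonian potential of `d`. -/
noncomputable def newtonIntegrand (n : ℕ) (d : Eucl n → ℝ) (x y : Eucl n) : ℝ :=
  newtonConst n * (1 / ‖y - x‖ ^ (n - 2)) * d y

/-- The exponent `n - 3/2` exceeds the Newtonian `n - 2` by one half; on a ball of radius `ε` the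
surplus is worth `ε^{1/2}`. At `z = 0` the left side is zero by the division convention. -/
theorem one_div_norm_pow_le (hn : 3 ≤ n) {ε : ℝ} {z : Eucl n} (hz : ‖z‖ ≤ ε) :
    1 / ‖z‖ ^ (n - 2) ≤ ε ^ (1 / 2 : ℝ) * ‖z‖ ^ (-((n : ℝ) - 3 / 2)) := by
  rcases (norm_nonneg z).eq_or_lt with h0 | h0
  · rw [← h0, zero_pow (by omega), div_zero]
    exact mul_nonneg (Real.rpow_nonneg (h0.trans_le hz) _) (Real.rpow_nonneg le_rfl _)
  · have h1 : 1 / ‖z‖ ^ (n - 2) = ‖z‖ ^ (1 / 2 : ℝ) * ‖z‖ ^ (-((n : ℝ) - 3 / 2)) := by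
      rw [← Real.rpow_add h0, ← Real.rpow_natCast, one_div, ← Real.rpow_neg h0.le,
        Nat.cast_sub (by omega)]
      congr 1
      push_cast
      ring
    rw [h1]
    gcongr

/-- Truncating the Newtonian kernel changes the potential by `O(ε^{1/2})`. -/
theorem lintegral_newtonIntegrand_sub_le (hn : 3 ≤ n) {d : Eucl n → ℝ} {G : Eucl n → Eucl n}
    {M : ℝ} (hM : 0 ≤ M) (hdM : ∀ᵐ y ∂(volume.restrict Ω), |d y| ≤ M * ‖G y‖) {x₀ : Eucl n}
    {r : ℝ} {C : ℝ≥0∞} (hC : ∀ x ∈ Metric.ball x₀ r,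
      ∫⁻ y in Metric.ball x₀ r, rieszKernel ((n : ℝ) - 3 / 2) (x - y) * ‖G y‖ₑ ≤ C)
    {x : Eucl n} (hx : x ∈ Metric.ball x₀ (r / 2)) {ε : ℝ} (hε : 0 < ε) (hεr : ε ≤ r / 2) :
    ∫⁻ y in Ω, ‖newtonIntegrand n d x y - cutKernel n ε (y - x) * d y‖ₑ ≤
      ENNReal.ofReal (2 * newtonConst n * M * ε ^ (1 / 2 : ℝ)) * C := by
  have hx' : dist x x₀ < r / 2 := hx
  have hr : 0 < r := by linarith [dist_nonneg (x := x) (y := x₀)]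
  have hc := newtonConst_pos hn
  have hxr : x ∈ Metric.ball x₀ r := Metric.ball_subset_ball (by linarith) hx
  refine le_trans ?_ (mul_le_mul_right (hC x hxr) _)
  rw [← lintegral_const_mul' _ _ ENNReal.ofReal_ne_top]
  refine lintegral_restrict_le_of_support Metric.isOpen_ball.measurableSet ?_
  filter_upwards [hdM] with y hy
  rcases le_or_gt ε ‖y - x‖ with hyx | hyx
  · rw [newtonIntegrand, cutKernel_of_ge hn hε hyx, sub_self, enorm_zero]
    exact zero_le
  · have hyr : y ∈ Metric.ball x₀ r := by
      rw [Metric.mem_ball]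
      rw [← dist_eq_norm] at hyx
      linarith [dist_triangle y x x₀]
    rw [indicator_of_mem hyr, rieszKernel, ← ofReal_norm, ← ofReal_norm,
      ← ENNReal.ofReal_mul (by positivity), ← ENNReal.ofReal_mul (by positivity)]
    refine ENNReal.ofReal_le_ofReal ?_
    have h1 := abs_cutKernel_le hn hε (y - x)
    have h2 := one_div_norm_pow_le hn hyx.le
    rw [newtonIntegrand, ← sub_mul, norm_mul, norm_sub_rev x y]
    have h0 : 0 ≤ newtonConst n * (1 / ‖y - x‖ ^ (n - 2)) := by positivity
    have h3 : ‖newtonConst n * (1 / ‖y - x‖ ^ (n - 2)) - cutKernel n ε (y - x)‖ ≤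
        2 * newtonConst n * (ε ^ (1 / 2 : ℝ) * ‖y - x‖ ^ (-((n : ℝ) - 3 / 2))) := by
      refine (norm_sub_le _ _).trans ?_
      rw [Real.norm_of_nonneg h0, Real.norm_eq_abs]
      have := mul_le_mul_of_nonneg_left h2 hc.le
      linarith
    calc _ ≤ 2 * newtonConst n * (ε ^ (1 / 2 : ℝ) * ‖y - x‖ ^ (-((n : ℝ) - 3 / 2))) *
          (M * ‖G y‖) := mul_le_mul h3 hy (abs_nonneg _) (by positivity)
      _ = _ := by ring

theorem integrableOn_cutKernel_mul {d : Eucl n → ℝ} (hd : IntegrableOn d Ω) {ε : ℝ}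
    (hΩ : IsLipschitzDomain Ω) (x : Eucl n) :
    IntegrableOn (fun y => cutKernel n ε (y - x) * d y) Ω := by
  have hcont := (contDiff_comp_sub (contDiff_cutKernel n ε) x).continuous
  obtain ⟨C, hC⟩ := exists_bound_of_continuous hΩ hcont
  exact hd.bdd_mul hcont.aestronglyMeasurable
    ((ae_restrict_mem hΩ.isOpen.measurableSet).mono fun y hy => hC y (subset_closure hy))

theorem aestronglyMeasurable_newtonIntegrand {d : Eucl n → ℝ} (hd : IntegrableOn d Ω)
    (x : Eucl n) : AEStronglyMeasurable (newtonIntegrand n d x) (volume.restrict Ω) := by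
  refine AEStronglyMeasurable.mul ?_ hd.1
  exact Measurable.aestronglyMeasurable (by fun_prop)

theorem continuous_integral_cutBump (hn : 3 ≤ n) {u : Eucl n → ℝ} (hu : IntegrableOn u Ω) {ε : ℝ}
    (hε : 0 < ε) : Continuous fun x => ∫ y in Ω, cutBump n ε (y - x) * u y := by
  obtain ⟨C, hC0, hC⟩ := exists_bound_cutBump hn
  have hcont := continuous_cutBump hn hε
  refine continuous_of_dominated (bound := fun y => C * (ε ^ n)⁻¹ * ‖u y‖) (fun x => ?_) (fun x => ?_)
    (hu.norm.const_mul _) (ae_of_all _ fun y => ?_)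
  · exact (hcont.comp (continuous_id.sub continuous_const)).aestronglyMeasurable.mul hu.1
  · refine ae_of_all _ fun y => ?_
    rw [norm_mul]
    exact mul_le_mul_of_nonneg_right (hC ε hε _) (norm_nonneg _)
  · exact (hcont.comp (continuous_const.sub continuous_id)).mul continuous_const

/-- The Newtonian potential of `d` and the mollifications of `u` near a point. -/
theorem exists_uniform_approx (hn : 3 ≤ n) (hΩ : IsLipschitzDomain Ω) {u d : Eucl n → ℝ}
    {G : Eucl n → Eucl n} (h : HasSobolevGradient Ω 1 u G)
    (hd : HasWeakDivergence Ω (fun i y => G y i) d) {M : ℝ} (hM : 0 ≤ M)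
    (hdM : ∀ᵐ y ∂(volume.restrict Ω), |d y| ≤ M * ‖G y‖) {x₀ : Eucl n} (hx₀ : x₀ ∈ Ω) :
    ∃ r > 0, ∃ C, Metric.ball x₀ (2 * r) ⊆ Ω ∧ ∀ x ∈ Metric.ball x₀ r,
      IntegrableOn (newtonIntegrand n d x) Ω ∧ ∀ ε : ℝ, 0 < ε → ε ≤ r →
      |(∫ y in Ω, newtonIntegrand n d x y) - ∫ y in Ω, cutKernel n ε (y - x) * d y| ≤
        C * ε ^ (1 / 2 : ℝ) := by
  have hc := newtonConst_pos hn
  have hvol : volume Ω ≠ ⊤ := hΩ.isBounded.measure_lt_top.ne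
  -- The bootstrap is run for `2n - 3` half steps, one more than the Newtonian exponent `n - 2`
  -- would need; the extra half step provides the rate `ε^{1/2}`.
  have hcast : ((2 * n - 3 : ℕ) : ℝ) / 2 = (n : ℝ) - 3 / 2 := by
    rw [Nat.cast_sub (by omega)]
    push_cast
    ring
  obtain ⟨r, hr, C, hCtop, hball, hC⟩ := exists_bound_lintegral_rieszKernel_grad hn hΩ.isOpen hvol h
    hd hM hdM hx₀ (2 * n - 3) (by rw [hcast]; linarith)
  rw [hcast] at hC
  refine ⟨r / 2, by positivity, 2 * newtonConst n * M * C.toReal, by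
    rwa [mul_div_cancel₀ r two_ne_zero], fun x hx => ?_⟩
  have hle := fun {ε : ℝ} (hε : 0 < ε) (hεr : ε ≤ r / 2) =>
    lintegral_newtonIntegrand_sub_le hn hM hdM hC hx hε hεr
  have hfin : ∀ ε : ℝ, ENNReal.ofReal (2 * newtonConst n * M * ε ^ (1 / 2 : ℝ)) * C ≠ ⊤ := fun ε =>
    ENNReal.mul_ne_top ENNReal.ofReal_ne_top hCtop
  have hcut := fun ε => integrableOn_cutKernel_mul hd.integrableOn_div (ε := ε) hΩ x
  -- The truncated integrand is a bounded kernel times an integrable function, and the difference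
  -- from it has finite integral by `hle`.
  have hint : IntegrableOn (newtonIntegrand n d x) Ω := by
    have h1 : IntegrableOn (fun y => newtonIntegrand n d x y - cutKernel n (r / 2) (y - x) * d y) Ω :=
      ⟨(aestronglyMeasurable_newtonIntegrand hd.integrableOn_div x).sub (hcut _).1,
        (hle (by positivity) le_rfl).trans_lt (hfin _).lt_top⟩
    exact Integrable.congr (h1.add (hcut (r / 2))) (ae_of_all _ fun y => by simp)
  refine ⟨hint, fun ε hε hεr => ?_⟩
  rw [← integral_sub hint (hcut ε), ← Real.norm_eq_abs, ← toReal_enorm]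
  refine (ENNReal.toReal_mono (hfin ε)
    ((enorm_integral_le_lintegral_enorm _).trans (hle hε hεr))).trans_eq ?_
  rw [ENNReal.toReal_mul, ENNReal.toReal_ofReal (by positivity)]
  ring

/-- A function that is approximated by the mollifications of `u`, uniformly near each point, is
the continuous representative of `u`. -/
theorem continuousOn_and_ae_eq_of_approx (hn : 3 ≤ n) (hΩ : IsOpen Ω) {u v : Eucl n → ℝ}
    (hu : IntegrableOn u Ω)
    (h : ∀ x₀ ∈ Ω, ∃ r > 0, ∃ C, ∀ x ∈ Metric.ball x₀ r, ∀ ε : ℝ, 0 < ε → ε < r →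
      |v x - ∫ y in Ω, cutBump n ε (y - x) * u y| ≤ C * ε ^ (1 / 2 : ℝ)) :
    ContinuousOn v Ω ∧ ∀ᵐ y ∂(volume.restrict Ω), v y = u y := by
  have hlim : ∀ C : ℝ, Tendsto (fun ε : ℝ => C * ε ^ (1 / 2 : ℝ)) (𝓝[>] 0) (𝓝 0) := by
    intro C
    have h1 : Tendsto (fun ε : ℝ => ε ^ (1 / 2 : ℝ)) (𝓝 0) (𝓝 ((0 : ℝ) ^ (1 / 2 : ℝ))) :=
      (Real.continuous_rpow_const (by norm_num)).tendsto 0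
    rw [Real.zero_rpow (by norm_num)] at h1
    simpa using (h1.mono_left nhdsWithin_le_nhds).const_mul C
  have hunif : ∀ x₀ ∈ Ω, ∃ r > 0, TendstoUniformlyOn
      (fun (ε : ℝ) x => ∫ y in Ω, cutBump n ε (y - x) * u y) v (𝓝[>] 0) (Metric.ball x₀ r) := by
    intro x₀ hx₀
    obtain ⟨r, hr, C, hC⟩ := h x₀ hx₀
    refine ⟨r, hr, Metric.tendstoUniformlyOn_iff.2 fun δ hδ => ?_⟩
    filter_upwards [Ioo_mem_nhdsGT hr, (hlim C).eventually (Iio_mem_nhds hδ)] with ε hε hε' x hx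
    exact (hC x hx ε hε.1 hε.2).trans_lt hε'
  refine ⟨fun x₀ hx₀ => ?_, ?_⟩
  · obtain ⟨r, hr, hT⟩ := hunif x₀ hx₀
    have hcont : ContinuousOn v (Metric.ball x₀ r) := by
      refine hT.continuousOn (Eventually.frequently ?_)
      filter_upwards [self_mem_nhdsWithin] with ε hε
      exact (continuous_integral_cutBump hn hu hε).continuousOn
    exact (hcont.continuousAt (Metric.ball_mem_nhds x₀ hr)).continuousWithinAt
  · filter_upwards [ae_tendsto_setIntegral_cutBump hn hΩ hu, ae_restrict_mem hΩ.measurableSet]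
      with x hx hxΩ
    obtain ⟨r, hr, hT⟩ := hunif x hxΩ
    exact tendsto_nhds_unique (hT.tendsto_at (Metric.mem_ball_self hr)) hx

theorem volumeIntegrand_eq {f d : Eucl n → ℝ} {gradf gradu : Eucl n → Eucl n} (x : Eucl n)
    {y : Eucl n} (hd : d y = -2 * inner ℝ ((f y)⁻¹ • gradf y) (gradu y)) :
    volumeIntegrand f gradf gradu x y = -newtonIntegrand n d x y := by
  rw [volumeIntegrand, newtonIntegrand, hd, newtonConst, norm_sub_rev x y]
  ring

theorem exists_bound_of_eq_inner {f d : Eucl n → ℝ} {gradf G : Eucl n → Eucl n} {c : ℝ} (hc : 0 < c)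
    (hfc : ∀ᵐ y ∂(volume.restrict Ω), c ≤ |f y|) (hgradf : MemLp gradf ⊤ (volume.restrict Ω))
    (hd : ∀ᵐ y ∂(volume.restrict Ω), d y = -2 * inner ℝ ((f y)⁻¹ • gradf y) (G y)) :
    ∃ M : ℝ, 0 ≤ M ∧ ∀ᵐ y ∂(volume.restrict Ω), |d y| ≤ M * ‖G y‖ := by
  refine ⟨2 * (c⁻¹ * |lpNorm gradf ⊤ (volume.restrict Ω)|), by positivity, ?_⟩
  filter_upwards [hfc, hd, ae_le_lpNorm_exponent_top hgradf] with y h1 h2 h3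
  rw [h2, abs_mul, abs_neg, abs_two, mul_assoc]
  refine mul_le_mul_of_nonneg_left ((abs_real_inner_le_norm _ _).trans ?_) zero_le_two
  rw [norm_smul, norm_inv, Real.norm_eq_abs]
  have h4 := h3.trans (le_abs_self _)
  gcongr

end NewtonPotential
-- Proof of the representation formula.
theorem mainTheorem9 (n : ℕ) (hn : 3 ≤ n)
    (Ω : Set (Eucl n)) (hΩ : IsLipschitzDomain Ω)
    -- a scalar function `f` in `W^{1,∞}(Ω)`, away from zero
    (f : Eucl n → ℝ) (gradf : Eucl n → Eucl n) (hf : HasSobolevGradient Ω ⊤ f gradf)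
    (hf_away : ∃ c > 0, ∀ᵐ y ∂(volume.restrict Ω), c ≤ |f y|)
    -- a solution `w` of the main Vekua equation
    (p : ℝ≥0∞) (hp_one : 1 < p) (hp_top : p < ⊤)
    (w : Eucl n → Cl n) (hw : IsMainVekuaSolution Ω p f gradf w)
    -- `u₀ = Sc(w) / f` has boundary values `φ` and normal derivative `ψ`
    (u₀ : Eucl n → ℝ) (hu₀ : ∀ᵐ y ∂(volume.restrict Ω), u₀ y = scalarPart (w y) / f y)
    (gradu₀ : Eucl n → Eucl n) (hgradu₀ : HasSobolevGradient Ω 1 u₀ gradu₀)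
    (φ ψ : Eucl n → ℝ) (hφ : HasTrace Ω u₀ gradu₀ φ) (hψ : HasNormalTrace Ω gradu₀ ψ) :
    -- all the integrals converge,
    (∀ x ∈ Ω ∪ (closure Ω)ᶜ,
      Integrable (boundaryIntegrand Ω φ ψ x) (surfaceMeasure Ω) ∧
      IntegrableOn (volumeIntegrand f gradf gradu₀ x) Ω) ∧
    -- the formula holds in `Ω` for the continuous representative of `u₀`,
    (∃ v : Eucl n → ℝ, ContinuousOn v Ω ∧ (∀ᵐ y ∂(volume.restrict Ω), v y = u₀ y) ∧
      ∀ x ∈ Ω,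
        (∫ y, boundaryIntegrand Ω φ ψ x y ∂(surfaceMeasure Ω))
          + (∫ y in Ω, volumeIntegrand f gradf gradu₀ x y) = v x) ∧
    -- and the same expression vanishes outside the closure of `Ω`
    (∀ x ∈ (closure Ω)ᶜ,
      (∫ y, boundaryIntegrand Ω φ ψ x y ∂(surfaceMeasure Ω))
        + (∫ y in Ω, volumeIntegrand f gradf gradu₀ x y) = 0) := by
  have hvol : volume Ω ≠ ⊤ := hΩ.isBounded.measure_lt_top.ne
  obtain ⟨hu, hG⟩ := hgradu₀.integrableOn le_rfl hvol
  obtain ⟨hψint, d, V, hd, hV, h1, h2, h3⟩ := hψ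
  have hdiv := hasWeakDivergence_of_tendsto hΩ hG hψint hd hV h1 h2 h3
  have hdeq := hw.laplacian_eq hp_one.le hΩ.isOpen hvol hf hf_away hu₀ hgradu₀ hdiv
  obtain ⟨M, hM, hdM⟩ : ∃ M : ℝ, 0 ≤ M ∧ ∀ᵐ y ∂(volume.restrict Ω), |d y| ≤ M * ‖gradu₀ y‖ := by
    obtain ⟨c, hc, hfc⟩ := hf_away
    exact exists_bound_of_eq_inner hc hfc hf.memLp_grad hdeq
  have hvolume : ∀ x, -newtonIntegrand n d x =ᵐ[volume.restrict Ω]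
      volumeIntegrand f gradf gradu₀ x := fun x => by
    filter_upwards [hdeq] with y hy using (volumeIntegrand_eq x hy).symm
  have hrepr := fun {x : Eucl n} {ε : ℝ} (hε : 0 < ε) (hx : ∀ y ∈ frontier Ω, ε < ‖y - x‖) =>
    boundaryIntegrand_integral hn hΩ hu hG hφ hψint hd hV h1 h2 h3 hε hx
  -- The volume integrand is `-Γ d`. By the truncated formula, the left side minus the mollification
  -- of `u₀` is therefore `∫ (Γ_ε - Γ) d`, which is `O(ε^{1/2})` near `x₀`.
  have happrox : ∀ x₀ ∈ Ω, ∃ r > 0, ∃ C, ∀ x ∈ Metric.ball x₀ r,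
      (Integrable (boundaryIntegrand Ω φ ψ x) (surfaceMeasure Ω) ∧
        IntegrableOn (volumeIntegrand f gradf gradu₀ x) Ω) ∧
      ∀ ε : ℝ, 0 < ε → ε < r → |((∫ y, boundaryIntegrand Ω φ ψ x y ∂(surfaceMeasure Ω))
        + ∫ y in Ω, volumeIntegrand f gradf gradu₀ x y) -
          ∫ y in Ω, cutBump n ε (y - x) * u₀ y| ≤ C * ε ^ (1 / 2 : ℝ) := by
    intro x₀ hx₀
    obtain ⟨r, hr, C, hball, hC⟩ := exists_uniform_approx hn hΩ hgradu₀ hdiv hM hdM hx₀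
    have hfr : ∀ x ∈ Metric.ball x₀ r, ∀ y ∈ frontier Ω, r < ‖y - x‖ := by
      intro x hx y hy
      by_contra! hle
      rw [← dist_eq_norm] at hle
      rw [hΩ.isOpen.frontier_eq] at hy
      refine hy.2 (hball ?_)
      rw [Metric.mem_ball] at hx ⊢
      linarith [dist_triangle y x x₀]
    refine ⟨r, hr, C, fun x hx => ⟨⟨(hrepr hr (hfr x hx)).1,
      Integrable.congr (hC x hx).1.neg (hvolume x)⟩, fun ε hε hεr => ?_⟩⟩
    have hb := (hrepr hε fun y hy => hεr.trans (hfr x hx y hy)).2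
    have hk := (hC x hx).2 ε hε hεr.le
    rw [hb, ← integral_congr_ae (hvolume x)]
    simp only [Pi.neg_apply, integral_neg]
    rw [abs_sub_comm] at hk
    convert hk using 2
    ring
  have hout : ∀ x ∈ (closure Ω)ᶜ, ∃ ε > 0, ∀ y ∈ closure Ω, ε < ‖y - x‖ := by
    intro x hx
    obtain ⟨δ, hδ, hball⟩ := Metric.isOpen_iff.1 isClosed_closure.isOpen_compl x hx
    refine ⟨δ / 2, by positivity, fun y hy => ?_⟩
    by_contra! hle
    refine hball ?_ hy
    rw [Metric.mem_ball, dist_eq_norm]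
    linarith
  have hcut : ∀ {x : Eucl n} {ε : ℝ}, 0 < ε → (∀ y ∈ closure Ω, ε < ‖y - x‖) →
      (fun y => cutKernel n ε (y - x) * d y) =ᵐ[volume.restrict Ω] newtonIntegrand n d x := by
    intro x ε hε hx
    filter_upwards [ae_restrict_mem hΩ.isOpen.measurableSet] with y hy
    rw [newtonIntegrand, cutKernel_of_ge hn hε (hx y (subset_closure hy)).le]
  -- The continuous representative is taken to be the left side of the formula itself, so the
  -- identity holds by definition; continuity and agreement with `u₀` are what remain to be shown.
  refine ⟨?_, ⟨fun x => (∫ y, boundaryIntegrand Ω φ ψ x y ∂(surfaceMeasure Ω))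
      + ∫ y in Ω, volumeIntegrand f gradf gradu₀ x y, ?_, ?_, fun x _ => rfl⟩, ?_⟩
  · rintro x (hx | hx)
    · obtain ⟨r, hr, C, hC⟩ := happrox x hx
      exact (hC x (Metric.mem_ball_self hr)).1
    · obtain ⟨ε, hε, hεx⟩ := hout x hx
      exact ⟨(hrepr hε fun y hy => hεx y (frontier_subset_closure hy)).1,
        Integrable.congr (Integrable.congr (integrableOn_cutKernel_mul hd hΩ x)
          (hcut hε hεx)).neg (hvolume x)⟩
  · exact (continuousOn_and_ae_eq_of_approx hn hΩ.isOpen hu fun x₀ hx₀ => by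
      obtain ⟨r, hr, C, hC⟩ := happrox x₀ hx₀
      exact ⟨r, hr, C, fun x hx => (hC x hx).2⟩).1
  · exact (continuousOn_and_ae_eq_of_approx hn hΩ.isOpen hu fun x₀ hx₀ => by
      obtain ⟨r, hr, C, hC⟩ := happrox x₀ hx₀
      exact ⟨r, hr, C, fun x hx => (hC x hx).2⟩).2
  · intro x hx
    obtain ⟨ε, hε, hεx⟩ := hout x hx
    rw [(hrepr hε fun y hy => hεx y (frontier_subset_closure hy)).2,
      ← integral_congr_ae (hvolume x), integral_congr_ae (hcut hε hεx)]
    -- The bump around an exterior point does not meet `Ω`, so no value of `u₀` is picked up, and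
    -- the two integrals of `Γ d` cancel.
    have h0 : ∫ y in Ω, cutBump n ε (y - x) * u₀ y = 0 :=
      setIntegral_eq_zero_of_forall_eq_zero fun y hy => by
        rw [cutBump_of_gt hn hε (hεx y (subset_closure hy)), zero_mul]
    rw [h0]
    simp only [Pi.neg_apply, integral_neg]
    ring
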